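/- Let $M>0$ and $H\in\mathbb R$, and write $h(r)=1-\frac{2M}{r}$. The Kruskal extension is the product of $\{(X,T): X^2-T^2>-2M\}$ and $\mathbb S^2$ with the metric $\frac{16M^2e^{-r/2M}}{r}(-dT^2+dX^2)+r^2(d\theta^2+\sin^2\theta\,d\phi^2)$, where $r>0$ is given by $(r-2M)e^{r/2M}=X^2-T^2$, and $\partial_T$ is future directed. Schwarzschild coordinates $(t,r)$ are mapped to the $(X,T)$-plane in region I by $$X=\tfrac12\sqrt{r-2M}\,\bigl(e^{\frac{r+t}{4M}}+e^{\frac{r-t}{4M}}\bigr),\quad T=\tfrac12\sqrt{r-2M}\,\bigl(e^{\frac{r+t}{4M}}-e^{\frac{r-t}{4M}}\bigr)\qquad(r>2M),$$ in region I$'$ by the negatives of these expressions, and in region II by $$X=\tfrac12\sqrt{2M-r}\,\bigl(e^{\frac{r+t}{4M}}-e^{\frac{r-t}{4M}}\bigr),\quad T=\tfrac12\sqrt{2M-r}\,\bigl(e^{\frac{r+t}{4M}}+e^{\frac{r-t}{4M}}\bigr)\qquad(0<r<2M).$$ The common boundary of I and II is $L_+=\{X=T>0\}$ ($r=2M$,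 $t=\infty$), that of II and I$'$ is $L_-=\{-X=T>0\}$ ($r=2M$, $t=-\infty$). An SS-CMC hypersurface with mean curvature $H$ is a smooth embedded spacelike spherically symmetric hypersurface such that $\frac13\sum g^{ij}\langle\nabla_{e_i}N,e_j\rangle=H$ for its future directed unit normal $N$. For constants $c,\bar c$ and base points $r_1,r_3>2M$ and $r_2\in(0,2M)$ put $$f_1(r)=\int_{r_1}^r\frac{l_1}{h}\sqrt{\frac1{1+l_1^2}}\,dx+\bar c,\quad l_1=\frac1{\sqrt h}\Bigl(Hr+\frac c{r^2}\Bigr),\qquad f_3(r)=\int_{r_3}^r\frac{l_3}{h}\sqrt{\frac1{1+l_3^2}}\,dx+\bar c,\quad l_3=-l_1,$$ $$f_2^{*}(r)=\int_{r_2}^r\frac1{-h}\sqrt{\frac{l_2^2}{l_2^2-1}}\,dx+\bar c,\qquad f_2^{**}(r)=\int_{r_2}^r\frac1{h}\sqrt{\frac{l_2^2}{l_2^2-1}}\,dx+\bar c,\qquad l_2=\frac1{\sqrt{-h}}\Bigl(-Hr-\frac c{r^2}\Bigr),$$ where $f_2^*,f_2^{**}$ are defined at those $r\in(0,2M)$ for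 which $l_2>1$ strictly between $r_2$ and $r$ and the integral is finite. Let $\Sigma^1_{H,c,\bar c}$ be the hypersurface $t=f_1(r)$, $r>2M$, in region I, let $\Sigma^{2,*}_{H,c,\bar c}$ and $\Sigma^{2,**}_{H,c,\bar c}$ be the hypersurfaces $t=f_2^{*}(r)$ and $t=f_2^{**}(r)$ in region II, and let $\Sigma^3_{H,c,\bar c}$ be the hypersurface $t=f_3(r)$, $r>2M$, in region I$'$. **Theorem 1.** The function $k_H(r)=-Hr^3-r^{3/2}(2M-r)^{1/2}$ has a unique minimum point $r_H$ on $(0,2M)$; it satisfies $3Hr_H^{3/2}(2M-r_H)^{1/2}=2r_H-3M$, and $c_H:=k_H(r_H)<-8M^3H$. Let $c_1<-8M^3H$ and $\bar c_1\in\mathbb R$. Then $\Sigma^1=\Sigma^1_{H,c_1,\bar c_1}$ is an SS-CMC hypersurface with mean curvature $H$, and it joins smoothly, across one sphere of $L_+$, to an SS-CMC hypersurface $\Sigma^2$ of region II with the same constants $H$ and $c_1$. More precisely: (a) If $c_1<c_H$, then $f_2^*$ is defined on $(0,2M)$ for each base point, and there is $\bar c_2$ such that $\Sigma^1$, $\Sigma^2=\Sigma^{2,*}_{H,c_1,\bar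 c_2}$ and a sphere of $L_+$ together form a smooth SS-CMC hypersurface with mean curvature $H$ that is complete in the Kruskal extension and has two ends. (b) If $c_1=c_H$, then $f_2^*$ is defined on $(r_H,2M)$ for each base point $r_2\in(r_H,2M)$, and there is $\bar c_2$ such that $\Sigma^1$, $\Sigma^2=\Sigma^{2,*}_{H,c_1,\bar c_2}$ and a sphere of $L_+$ together form a smooth SS-CMC hypersurface with mean curvature $H$ that is complete in the Kruskal extension and has two ends. (c) If $c_H<c_1<-8M^3H$, then there is $r''\in(r_H,2M)$ with $k_H(r'')=c_1$ such that for the base point $r_2=r''$ the functions $f_2^*$ and $f_2^{**}$ are defined on $[r'',2M)$; there is $\bar c_2$ such that $\Sigma^2=\Sigma^{2,*}_{H,c_1,\bar c_2}\cup\Sigma^{2,**}_{H,c_1,\bar c_2}$ is SS-CMC with mean curvature $H$, and there is $\bar c_3$ such that $\Sigma^3=\Sigma^3_{H,c_1,\bar c_3}$ is SS-CMC with mean curvature $H$ and $\Sigma^1$, $\Sigma^2$, $\Sigma^3$, a sphere of $L_+$ and a sphere of $L_-$ together form a smooth SS-CMC hypersurface with mean curvature $H$ that is complete in the Kruskal extension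 and has two ends. Here "complete in the Kruskal extension" means complete up to the singularity $r=0$: the hypersurface is a closed subset of the Kruskal extension, and each of its curves of finite length has an end point on it or runs into $r=0$. In cases (b) and (c) the hypersurface is moreover complete as a Riemannian manifold. -/

import Mathlib

open Set Filter Topology
open scoped ContDiff

noncomputable section

namespace Kruskal

/-! ### Pseudo-Riemannian geometry of a parametrized hypersurface in coordinates -/

/-- The partial derivative `∂f/∂xⁱ`. -/
def pd {n : ℕ} (i : Fin n) (f : (Fin n → ℝ) → ℝ) (x : Fin n → ℝ) : ℝ :=
  fderiv ℝ f x (Pi.single i 1)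

/-- The Christoffel symbol `Γᵏᵢⱼ` of the metric `g`. -/
def christoffel (g : (Fin 4 → ℝ) → Matrix (Fin 4) (Fin 4) ℝ) (k i j : Fin 4)
    (x : Fin 4 → ℝ) : ℝ :=
  (1 / 2) * ∑ l, (g x)⁻¹ k l *
    (pd i (fun y => g y j l) x + pd j (fun y => g y i l) x - pd l (fun y => g y i j) x)

/-- The scalar product `⟨v, w⟩` at the point `x`. -/
def scalarProd (g : (Fin 4 → ℝ) → Matrix (Fin 4) (Fin 4) ℝ) (x v w : Fin 4 → ℝ) : ℝ :=
  ∑ a, ∑ b, g x a b * v a * w b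

/-- The coordinate tangent vector `∂Φ/∂uⁱ` of a parametrized hypersurface `Φ`. -/
def tangentVec (Φ : (Fin 3 → ℝ) → (Fin 4 → ℝ)) (i : Fin 3) (u : Fin 3 → ℝ) : Fin 4 → ℝ :=
  fun a => pd i (fun v => Φ v a) u

/-- The covariant derivative (Levi-Civita) of a vector field `Y` along `Φ` in the direction
`∂Φ/∂uⁱ`. -/
def covDeriv (g : (Fin 4 → ℝ) → Matrix (Fin 4) (Fin 4) ℝ) (Φ Y : (Fin 3 → ℝ) → (Fin 4 → ℝ))
    (i : Fin 3) (u : Fin 3 → ℝ) : Fin 4 → ℝ :=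
  fun k => pd i (fun v => Y v k) u +
    ∑ a, ∑ b, christoffel g k a b (Φ u) * tangentVec Φ i u a * Y u b

/-- The induced metric `gᵢⱼ = ⟨eᵢ, eⱼ⟩`, `eᵢ = ∂Φ/∂uⁱ`. -/
def inducedMetric (g : (Fin 4 → ℝ) → Matrix (Fin 4) (Fin 4) ℝ)
    (Φ : (Fin 3 → ℝ) → (Fin 4 → ℝ)) (u : Fin 3 → ℝ) : Matrix (Fin 3) (Fin 3) ℝ :=
  Matrix.of fun i j => scalarProd g (Φ u) (tangentVec Φ i u) (tangentVec Φ j u)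

/-- The second fundamental form `hᵢⱼ = ⟨∇_{eᵢ} N, eⱼ⟩`. -/
def secondFundamentalForm (g : (Fin 4 → ℝ) → Matrix (Fin 4) (Fin 4) ℝ)
    (Φ N : (Fin 3 → ℝ) → (Fin 4 → ℝ)) (u : Fin 3 → ℝ) (i j : Fin 3) : ℝ :=
  scalarProd g (Φ u) (covDeriv g Φ N i u) (tangentVec Φ j u)

/-- The mean curvature `H = (1/3) ∑ gⁱʲ hᵢⱼ`. -/
def meanCurvature (g : (Fin 4 → ℝ) → Matrix (Fin 4) (Fin 4) ℝ)
    (Φ N : (Fin 3 → ℝ) → (Fin 4 → ℝ)) (u : Fin 3 → ℝ) : ℝ :=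
  (1 / 3) * ∑ i, ∑ j, (inducedMetric g Φ u)⁻¹ i j * secondFundamentalForm g Φ N u i j

/-! ### The Kruskal extension -/

/-- The Kruskal plane: the points `(X, T)` with `X² - T² > -2M`. -/
def plane (M : ℝ) : Set (ℝ × ℝ) := {x | -(2 * M) < x.1 ^ 2 - x.2 ^ 2}

/-- The area radius `r` at the point `(X, T)` of the Kruskal plane: the positive solution of
`(r - 2M) exp (r / 2M) = X² - T²`. -/
def radius (M : ℝ) (x : ℝ × ℝ) : ℝ :=
  Function.invFunOn (fun r : ℝ => (r - 2 * M) * Real.exp (r / (2 * M))) (Ioi 0)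
    (x.1 ^ 2 - x.2 ^ 2)

/-- The factor `16 M² exp (-r / 2M) / r` of the Kruskal metric. -/
def conformalFactor (M : ℝ) (x : ℝ × ℝ) : ℝ :=
  16 * M ^ 2 * Real.exp (-(radius M x) / (2 * M)) / radius M x

/-- The Kruskal metric
`(16 M² exp (-r / 2M) / r) (dX² - dT²) + r² dθ² + r² sin² θ dφ²` in the coordinates
`(X, T, θ, φ)`. -/
def metric (M : ℝ) (x : Fin 4 → ℝ) : Matrix (Fin 4) (Fin 4) ℝ :=
  Matrix.diagonal ![conformalFactor M (x 0, x 1), -conformalFactor M (x 0, x 1),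
    radius M (x 0, x 1) ^ 2, radius M (x 0, x 1) ^ 2 * Real.sin (x 2) ^ 2]

/-- The Kruskal extension as a topological space: the product of the Kruskal plane and the
unit sphere of `ℝ³`. -/
abbrev Extension (M : ℝ) : Type :=
  {p : (ℝ × ℝ) × Metric.sphere (0 : EuclideanSpace ℝ (Fin 3)) 1 // p.1 ∈ plane M}

/-- The spherically symmetric subset of the Kruskal extension over a subset `Γ` of the
Kruskal plane. -/
def sphericalLift (M : ℝ) (Γ : Set (ℝ × ℝ)) : Set (Extension M) := {p | p.1.1 ∈ Γ}

/-- The map `(s, θ, φ) ↦ (X(s), T(s), θ, φ)` that parametrizes the spherically symmetric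
hypersurface over a curve of the Kruskal plane. -/
def rotate (γ : ℝ → ℝ × ℝ) (u : Fin 3 → ℝ) : Fin 4 → ℝ :=
  ![(γ (u 0)).1, (γ (u 0)).2, u 1, u 2]

/-- The spherically symmetric hypersurface over the curve `γ : (-ε, ε) → ℝ²` is spacelike and
its mean curvature with respect to the future directed (`∂_T` is future directed) timelike
unit normal `N` is the constant `H`. Since rotations are isometries, it is enough to look
at the hypersurface off the axis of the spherical coordinates. -/
def SpacelikeCMC (M H : ℝ) (γ : ℝ → ℝ × ℝ) (ε : ℝ) : Prop :=
  ∃ N : (Fin 3 → ℝ) → (Fin 4 → ℝ),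
    ContDiffOn ℝ ∞ N {u | u 0 ∈ Ioo (-ε) ε ∧ u 1 ∈ Ioo 0 Real.pi} ∧
    ∀ u : Fin 3 → ℝ, u 0 ∈ Ioo (-ε) ε → u 1 ∈ Ioo 0 Real.pi →
      (inducedMetric (metric M) (rotate γ) u).PosDef ∧
      (∀ i, scalarProd (metric M) (rotate γ u) (N u) (tangentVec (rotate γ) i u) = 0) ∧
      scalarProd (metric M) (rotate γ u) (N u) (N u) = -1 ∧
      0 < N u 1 ∧
      meanCurvature (metric M) (rotate γ) N u = H

/-- The spherically symmetric subset over `Γ` is a smooth embedded spacelike hypersurface of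
the Kruskal extension with constant mean curvature `H`: near each of its points, `Γ` is the
homeomorphic image of a smooth curve `γ` on an open interval (`s` is the inverse of `γ`) over
which the hypersurface is spacelike (in particular immersed) with mean curvature `H`. -/
structure IsSSCMC (M H : ℝ) (Γ : Set (ℝ × ℝ)) : Prop where
  subset_plane : Γ ⊆ plane M
  chart : ∀ p ∈ Γ, ∃ (O : Set (ℝ × ℝ)) (γ : ℝ → ℝ × ℝ) (s : ℝ × ℝ → ℝ) (ε : ℝ),
    IsOpen O ∧ p ∈ O ∧ 0 < ε ∧ γ 0 = p ∧ ContDiffOn ℝ ∞ γ (Ioo (-ε) ε) ∧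
    γ '' Ioo (-ε) ε = Γ ∩ O ∧ ContinuousOn s (Γ ∩ O) ∧ (∀ u ∈ Ioo (-ε) ε, s (γ u) = u) ∧
    SpacelikeCMC M H γ ε

/-! ### Completeness and ends -/

/-- The speed of a curve `σ = ((X, T), ω)` in the Kruskal extension, `ω` on the unit sphere of
`ℝ³`, for the Kruskal metric. -/
def speed (M : ℝ) (σ : ℝ → (ℝ × ℝ) × EuclideanSpace ℝ (Fin 3)) (τ : ℝ) : ℝ :=
  Real.sqrt (conformalFactor M (σ τ).1 * ((deriv σ τ).1.1 ^ 2 - (deriv σ τ).1.2 ^ 2)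
    + radius M (σ τ).1 ^ 2 * ‖(deriv σ τ).2‖ ^ 2)

/-- `σ` is a `C¹` curve `[0, 1) → Σ` of finite length, where `Σ` is the spherically symmetric
hypersurface over `Γ`. -/
structure IsFiniteLengthCurve (M : ℝ) (Γ : Set (ℝ × ℝ))
    (σ : ℝ → (ℝ × ℝ) × EuclideanSpace ℝ (Fin 3)) : Prop where
  contDiffOn : ContDiffOn ℝ 1 σ (Ico 0 1)
  mem : ∀ τ ∈ Ico (0 : ℝ) 1, (σ τ).1 ∈ Γ ∧ ‖(σ τ).2‖ = 1
  finite_length : MeasureTheory.IntegrableOn (speed M σ) (Ioo 0 1)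

/-- The end point of `σ` exists in the spherically symmetric hypersurface over `Γ`. -/
def HasEndPoint (Γ : Set (ℝ × ℝ)) (σ : ℝ → (ℝ × ℝ) × EuclideanSpace ℝ (Fin 3)) : Prop :=
  ∃ q : (ℝ × ℝ) × EuclideanSpace ℝ (Fin 3), q.1 ∈ Γ ∧ ‖q.2‖ = 1 ∧ Tendsto σ (𝓝[<] 1) (𝓝 q)

/-- The spherically symmetric hypersurface over `Γ`, with the induced Riemannian metric, is
complete: each of its curves of finite length has an end point. -/
def IsRiemannianComplete (M : ℝ) (Γ : Set (ℝ × ℝ)) : Prop :=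
  ∀ σ, IsFiniteLengthCurve M Γ σ → HasEndPoint Γ σ

/-- The spherically symmetric hypersurface over `Γ` is complete in the Kruskal extension, that
is, up to the singularity `r = 0`: it is a closed subset of the Kruskal extension, and each of
its curves of finite length has an end point on it or runs into the singularity `r = 0`. -/
def IsCompleteInExtension (M : ℝ) (Γ : Set (ℝ × ℝ)) : Prop :=
  IsClosed (sphericalLift M Γ) ∧
  ∀ σ, IsFiniteLengthCurve M Γ σ →
    HasEndPoint Γ σ ∨ Tendsto (fun τ => radius M (σ τ).1) (𝓝[<] 1) (𝓝 0)

/-- The connected components of the complement of `K` that are not relatively compact. -/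
def unboundedComponents {E : Type*} [TopologicalSpace E] (K : Set E) : Set (Set E) :=
  {C | (∃ x ∈ Kᶜ, C = connectedComponentIn Kᶜ x) ∧ ¬ IsCompact (closure C)}

/-- The space `E` is connected and has exactly `n` ends: the complement of each sufficiently
large compact set has exactly `n` components that are not relatively compact. -/
def HasEnds (n : ℕ) (E : Type*) [TopologicalSpace E] : Prop :=
  ConnectedSpace E ∧ ∃ K₀ : Set E, IsCompact K₀ ∧
    ∀ K : Set E, IsCompact K → K₀ ⊆ K → (unboundedComponents K).encard = n

/-! ### The four maps from Schwarzschild coordinates `(t, r)` to the Kruskal plane -/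

/-- Region I. -/
def toI (M t r : ℝ) : ℝ × ℝ :=
  (Real.sqrt (r - 2 * M) * (Real.exp ((r + t) / (4 * M)) + Real.exp ((r - t) / (4 * M))) / 2,
   Real.sqrt (r - 2 * M) * (Real.exp ((r + t) / (4 * M)) - Real.exp ((r - t) / (4 * M))) / 2)

/-- Region II. -/
def toII (M t r : ℝ) : ℝ × ℝ :=
  (Real.sqrt (2 * M - r) * (Real.exp ((r + t) / (4 * M)) - Real.exp ((r - t) / (4 * M))) / 2,
   Real.sqrt (2 * M - r) * (Real.exp ((r + t) / (4 * M)) + Real.exp ((r - t) / (4 * M))) / 2)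

/-- Region I'. -/
def toI' (M t r : ℝ) : ℝ × ℝ :=
  (-(Real.sqrt (r - 2 * M) *
      (Real.exp ((r + t) / (4 * M)) + Real.exp ((r - t) / (4 * M))) / 2),
   -(Real.sqrt (r - 2 * M) *
      (Real.exp ((r + t) / (4 * M)) - Real.exp ((r - t) / (4 * M))) / 2))

/-- The half-line `L₊` (`r = 2M`, `t = ∞`), common boundary of the regions I and II. -/
def Lplus : Set (ℝ × ℝ) := {x | 0 < x.2 ∧ x.1 = x.2}

/-- The half-line `L₋` (`r = 2M`, `t = -∞`), common boundary of the regions II and I'. -/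
def Lminus : Set (ℝ × ℝ) := {x | 0 < x.2 ∧ x.1 = -x.2}

/-! ### The solutions in the regions I, II and I' -/

/-- `h(r) = 1 - 2M / r`. -/
def h (M r : ℝ) : ℝ := 1 - 2 * M / r

/-- `l₁(r) = (1 / √h(r)) (H r + c / r²)`. -/
def l₁ (M H c r : ℝ) : ℝ := 1 / Real.sqrt (h M r) * (H * r + c / r ^ 2)

/-- `l₂(r) = (1 / √(-h(r))) (-H r - c / r²)`. -/
def l₂ (M H c r : ℝ) : ℝ := 1 / Real.sqrt (-h M r) * (-H * r - c / r ^ 2)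

/-- `l₃(r) = (1 / √h(r)) (-H r - c / r²)`. -/
def l₃ (M H c r : ℝ) : ℝ := 1 / Real.sqrt (h M r) * (-H * r - c / r ^ 2)

/-- The height function `f₁(r; H, c, c')` of region I, with base point `r₁`. -/
def f₁ (M H c r₁ c' r : ℝ) : ℝ :=
  (∫ x in r₁..r, l₁ M H c x / h M x * Real.sqrt (1 / (1 + l₁ M H c x ^ 2))) + c'

/-- The positive derivative `(1 / (-h)) √(l₂² / (l₂² - 1))` of the height functions of
region II. -/
def slope₂ (M H c r : ℝ) : ℝ :=
  1 / (-h M r) * Real.sqrt (l₂ M H c r ^ 2 / (l₂ M H c r ^ 2 - 1))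

/-- The increasing height function `f₂*(r; H, c, c')` of region II, with base point `r₂`. -/
def f₂star (M H c r₂ c' r : ℝ) : ℝ := (∫ x in r₂..r, slope₂ M H c x) + c'

/-- The decreasing height function `f₂**(r; H, c, c')` of region II, with base point `r₂`. -/
def f₂starstar (M H c r₂ c' r : ℝ) : ℝ := (∫ x in r₂..r, -slope₂ M H c x) + c'

/-- The height function `f₃(r; H, c, c')` of region I', with base point `r₃`. -/
def f₃ (M H c r₃ c' r : ℝ) : ℝ :=
  (∫ x in r₃..r, l₃ M H c x / h M x * Real.sqrt (1 / (1 + l₃ M H c x ^ 2))) + c'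

/-- The interval on which the height functions `f₂*` and `f₂**` with base point `r₂` are
defined: the `r` in `(0, 2M)` such that `l₂ > 1` strictly between `r₂` and `r` and the integral
from `r₂` to `r` is finite. -/
def domain₂ (M H c r₂ : ℝ) : Set ℝ :=
  {r | r ∈ Ioo 0 (2 * M) ∧ (∀ x ∈ Ioo (min r₂ r) (max r₂ r), 1 < l₂ M H c x) ∧
    IntervalIntegrable (slope₂ M H c) MeasureTheory.volume r₂ r}

/-- The curve of `Σ¹` in the Kruskal plane. -/
def Sigma₁ (M H c r₁ c' : ℝ) : Set (ℝ × ℝ) :=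
  (fun r => toI M (f₁ M H c r₁ c' r) r) '' Ioi (2 * M)

/-- The curve of `Σ²` in the Kruskal plane, for `f₂ = f₂*`. -/
def Sigma₂star (M H c r₂ c' : ℝ) : Set (ℝ × ℝ) :=
  (fun r => toII M (f₂star M H c r₂ c' r) r) '' domain₂ M H c r₂

/-- The curve of `Σ²` in the Kruskal plane, for `f₂ = f₂**`. -/
def Sigma₂starstar (M H c r₂ c' : ℝ) : Set (ℝ × ℝ) :=
  (fun r => toII M (f₂starstar M H c r₂ c' r) r) '' domain₂ M H c r₂

/-- The curve of `Σ³` in the Kruskal plane. -/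
def Sigma₃ (M H c r₃ c' : ℝ) : Set (ℝ × ℝ) :=
  (fun r => toI' M (f₃ M H c r₃ c' r) r) '' Ioi (2 * M)

/-- `k_H(r) = -H r³ - r^{3/2} (2M - r)^{1/2}`, for `0 < r < 2M`. -/
def k (M H r : ℝ) : ℝ := -H * r ^ 3 - Real.sqrt (r ^ 3 * (2 * M - r))

/-- `c_H`, the minimum of `k_H` on `(0, 2M)`. -/
def cMin (M H : ℝ) : ℝ := sInf (k M H '' Ioo 0 (2 * M))

end Kruskal

end

open Kruskal

namespace Kruskal

/-! A spherically symmetric spacelike hypersurface is a curve in the Kruskal plane. Let w and P be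
the derivatives of the area radius r along its unit tangent and along its future unit normal. The
gradient of r has square h, so w² = h + P². For P = Hr + c/r² (`rate`), the first integral of 3H =
P' + 2P/r, the hypersurface has mean curvature H. The radius then obeys (dr/ds)² = E(r) with E = h +
P² (`energy`), like a particle in a potential.

On (0, 2M] the function r⁴E factors, with k_H(r) - c as one factor (`energy_mul_eq`), and k_H
decreases and then increases. If c < c_H, E has no zero and r runs from 0 to ∞. If c = c_H, E has a
double zero at r_H, which is approached only asymptotically. If c > c_H, the zero r'' on the
increasing branch is simple; r turns back there and the curve goes on into region I'.

No gluing along L₊ or L₋ is needed. A `Profile` consists of a smooth solution of the radial equation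
and of the component α of the unit tangent along X + T, which solves a linear equation. Both null
coordinates X + T and X - T are algebraic in α, w, P, r and exp(r/2M), and regular at r = 2M. Hence
the whole curve is smooth in Kruskal coordinates, and `Profile.spacelikeCMC` computes its mean
curvature. Conversely the Schwarzschild time 2M log|(X + T)/(X - T)| has arc length derivative P/h
off r = 2M. This is the integrand of all the height functions after substituting r, so the pieces of
the curve are the prescribed graphs (`sigma₁_eq`, `sigma₂star_eq`, `sigma₂starstar_eq`,
`sigma₃_eq`). A constant factor in α is a boost, that is, a shift of the time; it adjusts the curve
to the given constant of Σ¹ (`exists_profile`).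

The curve is parametrized over all of ℝ, by r - a = exp v (`exists_profile_exp`) or by r - a = sinh²
v at a simple zero (`exists_profile_sinh`). In the last two cases the speed has a positive lower
bound, so the arc length exhausts ℝ and the hypersurface is complete; in the first case this holds
for v ≥ 0, and what fails to converge has v → -∞, hence r → 0 (`hasEndPoint_or_tendsto`). The
parameter is a proper function with connected fibres, which gives two ends (`hasEnds_two`). -/

/-! ### The area radius and the conformal factor -/

/-- The function `r ↦ (r - 2M) exp (r / 2M)`, whose inverse is the area radius. -/
noncomputable def radial (M r : ℝ) : ℝ := (r - 2 * M) * Real.exp (r / (2 * M))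

lemma radial_zero (M : ℝ) : radial M 0 = -(2 * M) := by simp [radial]

lemma contDiff_radial (M : ℝ) : ContDiff ℝ ∞ (radial M) := by
  unfold radial; fun_prop

lemma hasDerivAt_radial {M : ℝ} (hM : 0 < M) (r : ℝ) :
    HasDerivAt (radial M) (r / (2 * M) * Real.exp (r / (2 * M))) r := by
  have h1 : HasDerivAt (fun r : ℝ => r / (2 * M)) (1 / (2 * M)) r :=
    (hasDerivAt_id r).div_const _
  have h2 := ((hasDerivAt_id r).sub_const (2 * M)).mul h1.exp
  refine h2.congr_deriv ?_
  simp only [id]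
  field_simp
  ring

lemma strictMonoOn_radial {M : ℝ} (hM : 0 < M) : StrictMonoOn (radial M) (Ici 0) := by
  refine strictMonoOn_of_deriv_pos (convex_Ici 0) (contDiff_radial M).continuous.continuousOn ?_
  intro x hx
  rw [interior_Ici] at hx
  rw [(hasDerivAt_radial hM x).deriv]
  have : (0 : ℝ) < x := hx
  positivity

lemma radius_eq {M : ℝ} (hM : 0 < M) {x : ℝ × ℝ} {r : ℝ} (hr : 0 < r)
    (h : x.1 ^ 2 - x.2 ^ 2 = radial M r) : radius M x = r := by
  have hex : ∃ a ∈ Ioi (0 : ℝ), (fun r : ℝ => (r - 2 * M) * Real.exp (r / (2 * M))) a =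
      x.1 ^ 2 - x.2 ^ 2 := ⟨r, hr, h.symm⟩
  have h1 := Function.invFunOn_mem hex
  have h2 := Function.invFunOn_eq hex
  exact (strictMonoOn_radial hM).injOn (Ioi_subset_Ici_self h1) hr.le (h2.trans h)

lemma exists_radial_eq {M : ℝ} (hM : 0 < M) {y : ℝ} (hy : -(2 * M) < y) :
    ∃ r, 0 < r ∧ radial M r = y := by
  have hb : y ≤ radial M (2 * M + |y|) := by
    have h1 : (1 : ℝ) ≤ Real.exp ((2 * M + |y|) / (2 * M)) := Real.one_le_exp (by positivity)
    unfold radial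
    nlinarith [le_abs_self y, abs_nonneg y]
  have h0 : (0 : ℝ) ≤ 2 * M + |y| := by positivity
  obtain ⟨r, hr, hry⟩ := intermediate_value_Icc h0 (contDiff_radial M).continuous.continuousOn
    (show y ∈ Icc _ _ from ⟨by rw [radial_zero]; exact hy.le, hb⟩)
  refine ⟨r, lt_of_le_of_ne hr.1 ?_, hry⟩
  rintro rfl
  rw [radial_zero] at hry
  exact hy.ne hry

lemma radius_spec {M : ℝ} (hM : 0 < M) {x : ℝ × ℝ} (hx : x ∈ plane M) :
    0 < radius M x ∧ radial M (radius M x) = x.1 ^ 2 - x.2 ^ 2 := by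
  obtain ⟨r, hr, h⟩ := exists_radial_eq hM (y := x.1 ^ 2 - x.2 ^ 2) hx
  rw [radius_eq hM hr h.symm]
  exact ⟨hr, h⟩

lemma mem_plane_of_radial {M : ℝ} (hM : 0 < M) {x : ℝ × ℝ} {r : ℝ} (hr : 0 < r)
    (h : x.1 ^ 2 - x.2 ^ 2 = radial M r) : x ∈ plane M := by
  have := strictMonoOn_radial hM (show (0 : ℝ) ∈ Ici 0 from self_mem_Ici) hr.le hr
  rw [radial_zero, ← h] at this
  exact this

/-- The area radius as a function of `X² - T²`. -/
lemma exists_hasDerivAt_radius {M : ℝ} (hM : 0 < M) {r : ℝ} (hr : 0 < r) :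
    ∃ ψ : ℝ → ℝ, ψ (radial M r) = r ∧
      HasDerivAt ψ (r / (2 * M) * Real.exp (r / (2 * M)))⁻¹ (radial M r) ∧
      ∀ᶠ y in 𝓝 (radial M r), ∀ x : ℝ × ℝ, x.1 ^ 2 - x.2 ^ 2 = y → radius M x = ψ y := by
  have hd : HasStrictDerivAt (radial M) (r / (2 * M) * Real.exp (r / (2 * M))) r :=
    ((contDiff_radial M).contDiffAt.hasStrictDerivAt' (hasDerivAt_radial hM r) (by simp))
  have hne : r / (2 * M) * Real.exp (r / (2 * M)) ≠ 0 := by positivity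
  have hd' := hd.to_localInverse hne
  have h0 : hd.localInverse _ _ _ hne (radial M r) = r :=
    HasStrictFDerivAt.localInverse_apply_image (hd.hasStrictFDerivAt_equiv hne)
  refine ⟨hd.localInverse _ _ _ hne, h0, hd'.hasDerivAt, ?_⟩
  have hpos : ∀ᶠ y in 𝓝 (radial M r), 0 < hd.localInverse _ _ _ hne y := by
    refine hd'.hasDerivAt.continuousAt.eventually ?_
    rw [h0]
    exact lt_mem_nhds hr
  filter_upwards [hpos, HasStrictFDerivAt.eventually_right_inverse
    (hd.hasStrictFDerivAt_equiv hne)] with y h1 h2 x hx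
  exact radius_eq hM h1 (hx.trans h2.symm)

/-- Implicit differentiation of (r - 2M) exp(r/2M) = X² - T². The coefficient 4M exp(-r/2M)/r is the
conformal factor divided by 4M, so derivatives of the metric stay rational in r and that factor. -/
lemma hasFDerivAt_radius {M : ℝ} (hM : 0 < M) {x : ℝ × ℝ} (hx : x ∈ plane M) :
    HasFDerivAt (radius M) ((conformalFactor M x / (4 * M)) •
      (x.1 • ContinuousLinearMap.fst ℝ ℝ ℝ - x.2 • ContinuousLinearMap.snd ℝ ℝ ℝ)) x := by
  obtain ⟨hr, hrx⟩ := radius_spec hM hx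
  obtain ⟨ψ, -, hψ, hev⟩ := exists_hasDerivAt_radius hM hr
  have hq : HasFDerivAt (fun y : ℝ × ℝ => y.1 ^ 2 - y.2 ^ 2)
      ((2 * x.1) • ContinuousLinearMap.fst ℝ ℝ ℝ - (2 * x.2) • ContinuousLinearMap.snd ℝ ℝ ℝ)
      x := by
    have h1 := (hasFDerivAt_fst (𝕜 := ℝ) (p := x)).pow 2
    have h2 := (hasFDerivAt_snd (𝕜 := ℝ) (p := x)).pow 2
    refine (h1.sub h2).congr_fderiv ?_
    ext <;> simp
  rw [hrx] at hψ hev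
  have h3 := hψ.comp_hasFDerivAt x hq
  have h4 : radius M =ᶠ[𝓝 x] ψ ∘ fun y : ℝ × ℝ => y.1 ^ 2 - y.2 ^ 2 := by
    filter_upwards [hq.continuousAt.eventually hev] with y hy
    exact hy y rfl
  refine (h3.congr_of_eventuallyEq h4).congr_fderiv ?_
  have he : Real.exp (-(radius M x) / (2 * M)) = (Real.exp (radius M x / (2 * M)))⁻¹ := by
    rw [← Real.exp_neg]; ring_nf
  have := hr.ne'
  ext <;> simp [conformalFactor, he] <;> field_simp <;> ring

lemma continuousAt_radius {M : ℝ} (hM : 0 < M) {x : ℝ × ℝ} (hx : x ∈ plane M) :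
    ContinuousAt (radius M) x := (hasFDerivAt_radius hM hx).continuousAt

lemma conformalFactor_pos {M : ℝ} (hM : 0 < M) {x : ℝ × ℝ} (hx : x ∈ plane M) :
    0 < conformalFactor M x := by
  have := (radius_spec hM hx).1
  unfold conformalFactor
  positivity

/-- The derivative of the conformal factor with respect to the area radius. -/
noncomputable def conformalSlope (M : ℝ) (x : ℝ × ℝ) : ℝ :=
  -conformalFactor M x * (1 / (2 * M) + 1 / radius M x)

lemma hasFDerivAt_conformalFactor {M : ℝ} (hM : 0 < M) {x : ℝ × ℝ} (hx : x ∈ plane M) :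
    HasFDerivAt (conformalFactor M) ((conformalSlope M x * (conformalFactor M x / (4 * M))) •
      (x.1 • ContinuousLinearMap.fst ℝ ℝ ℝ - x.2 • ContinuousLinearMap.snd ℝ ℝ ℝ)) x := by
  have hr := (radius_spec hM hx).1
  have h1 : HasDerivAt (fun r : ℝ => 16 * M ^ 2 * Real.exp (-r / (2 * M)) / r)
      (conformalSlope M x) (radius M x) := by
    have h2 : HasDerivAt (fun r : ℝ => -r / (2 * M)) (-1 / (2 * M)) (radius M x) :=
      (hasDerivAt_id _).neg.div_const _
    refine ((h2.exp.const_mul (16 * M ^ 2)).div (hasDerivAt_id _) hr.ne').congr_deriv ?_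
    simp only [conformalSlope, conformalFactor, id]
    have := hr.ne'
    field_simp
    ring
  refine (h1.comp_hasFDerivAt x (hasFDerivAt_radius hM hx)).congr_fderiv ?_
  rw [smul_smul]

/-! ### Christoffel symbols of the Kruskal metric -/

lemma hasFDerivAt_comp_pair {f : ℝ × ℝ → ℝ} {f' : ℝ × ℝ →L[ℝ] ℝ} {x : Fin 4 → ℝ}
    (hf : HasFDerivAt f f' (x 0, x 1)) :
    HasFDerivAt (fun y : Fin 4 → ℝ => f (y 0, y 1))
      (f'.comp ((ContinuousLinearMap.proj (R := ℝ) (φ := fun _ : Fin 4 => ℝ) 0).prod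
        (ContinuousLinearMap.proj (R := ℝ) (φ := fun _ : Fin 4 => ℝ) 1))) x := by
  have h : HasFDerivAt (fun y : Fin 4 → ℝ => (y 0, y 1))
      ((ContinuousLinearMap.proj (R := ℝ) (φ := fun _ : Fin 4 => ℝ) 0).prod
        (ContinuousLinearMap.proj (R := ℝ) (φ := fun _ : Fin 4 => ℝ) 1)) x :=
    (hasFDerivAt_apply 0 x).prodMk (hasFDerivAt_apply 1 x)
  exact HasFDerivAt.comp x hf h

/-- The diagonal entries of the Kruskal metric. -/
noncomputable def metricDiag (M : ℝ) (x : Fin 4 → ℝ) : Fin 4 → ℝ :=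
  ![conformalFactor M (x 0, x 1), -conformalFactor M (x 0, x 1),
    radius M (x 0, x 1) ^ 2, radius M (x 0, x 1) ^ 2 * Real.sin (x 2) ^ 2]

/-- The partial derivatives `∂gⱼⱼ/∂xⁱ` of the diagonal entries of the Kruskal metric. -/
noncomputable def metricDeriv (M : ℝ) (x : Fin 4 → ℝ) : Fin 4 → Fin 4 → ℝ :=
  let Q := conformalFactor M (x 0, x 1)
  let q := conformalSlope M (x 0, x 1)
  let r := radius M (x 0, x 1)
  let rX := Q / (4 * M) * x 0
  let rT := -(Q / (4 * M) * x 1)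
  ![![q * rX, -(q * rX), 2 * r * rX, 2 * r * rX * Real.sin (x 2) ^ 2],
    ![q * rT, -(q * rT), 2 * r * rT, 2 * r * rT * Real.sin (x 2) ^ 2],
    ![0, 0, 0, r ^ 2 * (2 * Real.sin (x 2) * Real.cos (x 2))],
    ![0, 0, 0, 0]]

lemma pd_metric {M : ℝ} (hM : 0 < M) {x : Fin 4 → ℝ} (hx : (x 0, x 1) ∈ plane M)
    (i j l : Fin 4) :
    pd i (fun y => metric M y j l) x = if j = l then metricDeriv M x i j else 0 := by
  split_ifs with hjl
  · subst hjl
    have hQ := hasFDerivAt_comp_pair (hasFDerivAt_conformalFactor hM hx)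
    have hr := (hasFDerivAt_comp_pair (hasFDerivAt_radius hM hx)).pow 2
    have hs : HasFDerivAt (fun y : Fin 4 → ℝ => Real.sin (y 2) ^ 2) _ x :=
      ((hasFDerivAt_apply (𝕜 := ℝ) (F' := fun _ : Fin 4 => ℝ) 2 x).sin).pow 2
    have hrs : HasFDerivAt (fun y : Fin 4 → ℝ =>
        radius M (y 0, y 1) ^ 2 * Real.sin (y 2) ^ 2) _ x := hr.mul hs
    have hQ' : HasFDerivAt (fun y : Fin 4 → ℝ => -conformalFactor M (y 0, y 1)) _ x := hQ.neg
    fin_cases j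
    · have e : (fun y : Fin 4 → ℝ => metric M y 0 0) =
        fun y => conformalFactor M (y 0, y 1) := by ext y; simp [metric]
      simp only [pd, Fin.zero_eta, e, hQ.fderiv]
      fin_cases i <;> simp [metricDeriv] <;> ring
    · have e : (fun y : Fin 4 → ℝ => metric M y 1 1) =
        fun y => -conformalFactor M (y 0, y 1) := by ext y; simp [metric]
      simp only [pd, Fin.mk_one, e, hQ'.fderiv]
      fin_cases i <;> simp [metricDeriv] <;> ring
    · have e : (fun y : Fin 4 → ℝ => metric M y 2 2) =
        fun y => radius M (y 0, y 1) ^ 2 := by ext y; simp [metric]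
      simp only [pd, Fin.reduceFinMk, e, hr.fderiv]
      fin_cases i <;> simp [metricDeriv]
    · have e : (fun y : Fin 4 → ℝ => metric M y 3 3) =
        fun y => radius M (y 0, y 1) ^ 2 * Real.sin (y 2) ^ 2 := by ext y; simp [metric]
      simp only [pd, Fin.reduceFinMk, e, hrs.fderiv]
      fin_cases i <;> simp [metricDeriv] <;> ring
  · have : (fun y => metric M y j l) = fun _ => 0 := by
      ext y; exact Matrix.diagonal_apply_ne _ hjl
    rw [this]; simp [pd]

lemma metric_inv {M : ℝ} (hM : 0 < M) {x : Fin 4 → ℝ} (hx : (x 0, x 1) ∈ plane M)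
    (hs : Real.sin (x 2) ≠ 0) :
    (metric M x)⁻¹ = Matrix.diagonal fun k => (metricDiag M x k)⁻¹ := by
  refine Matrix.inv_eq_left_inv ?_
  have h1 := (conformalFactor_pos hM hx).ne'
  have h2 := (radius_spec hM hx).1.ne'
  change Matrix.diagonal _ * Matrix.diagonal (metricDiag M x) = 1
  rw [Matrix.diagonal_mul_diagonal, ← Matrix.diagonal_one]
  congr 1
  ext k
  refine inv_mul_cancel₀ ?_
  fin_cases k <;> simp [metricDiag, h1, h2, hs]

/-- The metric is diagonal, so only the term l = k of the defining sum survives. The condition on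
the sine keeps the point off the axis, where the coordinate metric degenerates. -/
lemma christoffel_metric {M : ℝ} (hM : 0 < M) {x : Fin 4 → ℝ} (hx : (x 0, x 1) ∈ plane M)
    (hs : Real.sin (x 2) ≠ 0) (k i j : Fin 4) :
    christoffel (metric M) k i j x = 1 / 2 * ((metricDiag M x k)⁻¹ *
      ((if j = k then metricDeriv M x i j else 0) + (if i = k then metricDeriv M x j i else 0) -
        (if i = j then metricDeriv M x k i else 0))) := by
  unfold christoffel
  simp only [pd_metric hM hx, metric_inv hM hx hs]
  rw [Finset.sum_eq_single k]
  · simp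
  · intro l _ hl
    simp [Matrix.diagonal_apply_ne _ hl.symm]
  · simp

lemma scalarProd_metric (M : ℝ) (x v w : Fin 4 → ℝ) :
    scalarProd (metric M) x v w = ∑ a, metricDiag M x a * v a * w a := by
  unfold scalarProd
  refine Finset.sum_congr rfl fun a _ => ?_
  rw [Finset.sum_eq_single a]
  · simp [metric, metricDiag]
  · intro b _ hb
    simp [metric, Matrix.diagonal_apply_ne _ hb.symm]
  · simp

/-! ### The mean curvature of a rotated curve -/

lemma pd_comp_zero {f : ℝ → ℝ} {f' : ℝ} {u : Fin 3 → ℝ} (hf : HasDerivAt f f' (u 0))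
    (i : Fin 3) : pd i (fun v => f (v 0)) u = if i = 0 then f' else 0 := by
  have h : HasFDerivAt (fun v : Fin 3 → ℝ => f (v 0)) _ u :=
    hf.comp_hasFDerivAt u (hasFDerivAt_apply (𝕜 := ℝ) (F' := fun _ : Fin 3 => ℝ) 0 u)
  rw [pd, h.fderiv]
  fin_cases i <;> simp

lemma pd_apply (j i : Fin 3) (u : Fin 3 → ℝ) :
    pd i (fun v => v j) u = if i = j then 1 else 0 := by
  rw [pd, (hasFDerivAt_apply (𝕜 := ℝ) (F' := fun _ : Fin 3 => ℝ) j u).fderiv]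
  simp [Pi.single_apply, eq_comm]

lemma tangentVec_rotate {γ : ℝ → ℝ × ℝ} {u : Fin 3 → ℝ} {x' t' : ℝ}
    (hX : HasDerivAt (fun s => (γ s).1) x' (u 0)) (hT : HasDerivAt (fun s => (γ s).2) t' (u 0))
    (i : Fin 3) :
    tangentVec (rotate γ) i u =
      (![![x', t', 0, 0], ![0, 0, 1, 0], ![0, 0, 0, 1]] : Fin 3 → Fin 4 → ℝ) i := by
  ext k
  have h0 := pd_comp_zero hX i
  have h1 := pd_comp_zero hT i
  have h2 := pd_apply 1 i u
  have h3 := pd_apply 2 i u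
  fin_cases k <;> simp [tangentVec, rotate, h0, h1, h2, h3] <;> (fin_cases i <;> simp)

/-- The vector field `b(s) ∂_X + a(s) ∂_T` along a rotated curve. -/
def normalField (a b : ℝ → ℝ) (u : Fin 3 → ℝ) : Fin 4 → ℝ := ![b (u 0), a (u 0), 0, 0]

lemma inducedMetric_rotate {M : ℝ} {γ : ℝ → ℝ × ℝ} {u : Fin 3 → ℝ} {x' t' : ℝ}
    (hX : HasDerivAt (fun s => (γ s).1) x' (u 0)) (hT : HasDerivAt (fun s => (γ s).2) t' (u 0)) :
    inducedMetric (metric M) (rotate γ) u = Matrix.diagonal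
      ![conformalFactor M (γ (u 0)) * (x' ^ 2 - t' ^ 2), radius M (γ (u 0)) ^ 2,
        radius M (γ (u 0)) ^ 2 * Real.sin (u 1) ^ 2] := by
  ext i j
  simp only [inducedMetric, Matrix.of_apply, tangentVec_rotate hX hT, scalarProd_metric,
    Fin.sum_univ_four]
  fin_cases i <;> fin_cases j <;> simp [metricDiag, rotate] <;> ring

lemma posDef_inducedMetric_rotate {M : ℝ} (hM : 0 < M) {γ : ℝ → ℝ × ℝ} {u : Fin 3 → ℝ} {x' t' : ℝ}
    (hX : HasDerivAt (fun s => (γ s).1) x' (u 0)) (hT : HasDerivAt (fun s => (γ s).2) t' (u 0))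
    (hp : γ (u 0) ∈ plane M) (hs : Real.sin (u 1) ≠ 0)
    (h : t' ^ 2 < x' ^ 2) :
    (inducedMetric (metric M) (rotate γ) u).PosDef := by
  rw [inducedMetric_rotate hX hT, Matrix.posDef_diagonal_iff]
  have h1 := conformalFactor_pos hM hp
  have h2 := (radius_spec hM hp).1
  intro i
  fin_cases i
  · exact mul_pos h1 (sub_pos.2 h)
  · simpa using pow_pos h2 2
  · simpa using mul_pos (pow_pos h2 2) (by positivity : 0 < Real.sin (u 1) ^ 2)

/-- The mean curvature of a rotated curve with velocity `l (a, b)` where `(a, b)` has length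
one. -/
lemma meanCurvature_rotate {M : ℝ} (hM : 0 < M) {γ : ℝ → ℝ × ℝ} {u : Fin 3 → ℝ} {x' t' : ℝ}
    (hX : HasDerivAt (fun s => (γ s).1) x' (u 0)) (hT : HasDerivAt (fun s => (γ s).2) t' (u 0))
    (hp : γ (u 0) ∈ plane M) (hs : Real.sin (u 1) ≠ 0)
    {a b : ℝ → ℝ} {l a' b' : ℝ} (hl : l ≠ 0)
    (hx : x' = l * a (u 0)) (ht : t' = l * b (u 0))
    (ha : HasDerivAt a a' (u 0)) (hb : HasDerivAt b b' (u 0))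
    (hu : conformalFactor M (γ (u 0)) * (a (u 0) ^ 2 - b (u 0) ^ 2) = 1) :
    meanCurvature (metric M) (rotate γ) (normalField a b) u =
      1 / 3 * (conformalFactor M (γ (u 0)) * (a (u 0) * b' - b (u 0) * a') / l +
        conformalSlope M (γ (u 0)) / (8 * M) *
          ((γ (u 0)).1 * b (u 0) - (γ (u 0)).2 * a (u 0)) +
        2 * (conformalFactor M (γ (u 0)) / (4 * M) *
          ((γ (u 0)).1 * b (u 0) - (γ (u 0)).2 * a (u 0))) / radius M (γ (u 0))) := by
  have hQ := conformalFactor_pos hM hp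
  have hr := (radius_spec hM hp).1
  set Q := conformalFactor M (γ (u 0)) with hQd
  set q := conformalSlope M (γ (u 0)) with hqd
  set r := radius M (γ (u 0)) with hrd
  have hinv : (inducedMetric (metric M) (rotate γ) u)⁻¹ = Matrix.diagonal
      ![(l ^ 2)⁻¹, (r ^ 2)⁻¹, (r ^ 2 * Real.sin (u 1) ^ 2)⁻¹] := by
    refine Matrix.inv_eq_left_inv ?_
    rw [inducedMetric_rotate hX hT, Matrix.diagonal_mul_diagonal, ← Matrix.diagonal_one]
    congr 1
    ext i
    fin_cases i
    · simp only [Fin.zero_eta, Matrix.cons_val_zero]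
      -- The vector (a, b) has length one, so the induced length of the velocity is l.
      have : Q * (x' ^ 2 - t' ^ 2) = l ^ 2 := by
        rw [hx, ht]; linear_combination l ^ 2 * hu
      rw [this]; exact inv_mul_cancel₀ (pow_ne_zero 2 hl)
    · exact inv_mul_cancel₀ (by positivity)
    · exact inv_mul_cancel₀ (by positivity)
  have hrot : (rotate γ u 0, rotate γ u 1) = γ (u 0) := rfl
  have hrot2 : rotate γ u 2 = u 1 := rfl
  have hrot0 : rotate γ u 0 = (γ (u 0)).1 := rfl
  have hrot1 : rotate γ u 1 = (γ (u 0)).2 := rfl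
  -- Cancels the factor of the inverse metric against the one in the derivative of the conformal
  -- factor.
  have hQc : ∀ y, Q⁻¹ * (q * (Q / (4 * M) * y)) = q / (4 * M) * y := fun y => by
    field_simp
  have hC := christoffel_metric hM (x := rotate γ u) (by rwa [hrot]) (by rwa [hrot2])
  have hpa := pd_comp_zero ha
  have hpb := pd_comp_zero hb
  have hp0 : ∀ i : Fin 3, pd i (fun _ => (0 : ℝ)) u = 0 := fun i => by simp [pd]
  -- The normal is b ∂_X + a ∂_T, and Q/(4M) (X b - T a) is the derivative of r along it. The two
  -- spherical entries below are r, respectively r sin² θ, times this derivative; the radial entry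
  -- carries the bending of the curve.
  have h00 : secondFundamentalForm (metric M) (rotate γ) (normalField a b) u 0 0 =
      l * Q * (a (u 0) * b' - b (u 0) * a') + l ^ 2 * (q / (8 * M) *
          ((γ (u 0)).1 * b (u 0) - (γ (u 0)).2 * a (u 0))) := by
    simp only [secondFundamentalForm, scalarProd_metric, covDeriv, tangentVec_rotate hX hT,
      Fin.sum_univ_four, hC]
    simp [metricDiag, metricDeriv, hrot2, normalField, hpa, hpb, hp0,
      ← hQd, ← hqd, ← hrd, hx, ht, hrot0, hrot1, hQc]
    linear_combination l ^ 2 * q / (8 * M) *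
      ((γ (u 0)).1 * b (u 0) - (γ (u 0)).2 * a (u 0)) * hu
  have h11 : secondFundamentalForm (metric M) (rotate γ) (normalField a b) u 1 1 =
      r * (Q / (4 * M) * ((γ (u 0)).1 * b (u 0) - (γ (u 0)).2 * a (u 0))) := by
    simp only [secondFundamentalForm, scalarProd_metric, covDeriv, tangentVec_rotate hX hT,
      Fin.sum_univ_four, hC]
    simp [metricDiag, metricDeriv, hrot2, normalField, hpa, hpb, hp0,
      ← hQd, ← hqd, ← hrd, hx, ht, hrot0, hrot1, hQc]
    field_simp
    ring
  have h22 : secondFundamentalForm (metric M) (rotate γ) (normalField a b) u 2 2 =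
      Real.sin (u 1) ^ 2 * r *
        (Q / (4 * M) * ((γ (u 0)).1 * b (u 0) - (γ (u 0)).2 * a (u 0))) := by
    simp only [secondFundamentalForm, scalarProd_metric, covDeriv, tangentVec_rotate hX hT,
      Fin.sum_univ_four, hC]
    simp [metricDiag, metricDeriv, hrot2, normalField, hpa, hpb, hp0,
      ← hQd, ← hqd, ← hrd, hx, ht, hrot0, hrot1, hQc]
    field_simp
    ring
  simp only [meanCurvature, hinv, Fin.sum_univ_three, h00, h11, h22]
  simp
  field_simp
  ring

/-! ### Profile curves and their constant mean curvature -/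

/-- The derivative of the area radius in the direction of the unit normal of an SS-CMC
hypersurface. -/
noncomputable def rate (H c r : ℝ) : ℝ := H * r + c / r ^ 2

/-- The derivative of `rate`. -/
noncomputable def rateDeriv (H c r : ℝ) : ℝ := H - 2 * c / r ^ 3

lemma hasDerivAt_rate (H c : ℝ) {r : ℝ} (hr : r ≠ 0) :
    HasDerivAt (rate H c) (rateDeriv H c r) r := by
  have h1 : HasDerivAt (fun r : ℝ => c / r ^ 2) _ r :=
    (hasDerivAt_const r c).div (hasDerivAt_pow 2 r) (pow_ne_zero 2 hr)
  refine (((hasDerivAt_id r).const_mul H).add h1).congr_deriv ?_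
  simp only [rateDeriv]
  field_simp
  ring

/-- The data of the profile curve of an SS-CMC hypersurface: the area radius `ρ`, its derivative
`w` with respect to the arc length, the speed `l` and the component `α` of the unit tangent vector
in the direction of the null coordinate `X + T`, as functions of a parameter. -/
structure Profile (M H c : ℝ) where
  /-- area radius -/
  ρ : ℝ → ℝ
  /-- derivative of the area radius with respect to the arc length -/
  w : ℝ → ℝ
  /-- speed -/
  l : ℝ → ℝ
  /-- null component of the unit tangent vector -/
  α : ℝ → ℝ
  contDiff_ρ : ContDiff ℝ ∞ ρ
  contDiff_w : ContDiff ℝ ∞ w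
  contDiff_l : ContDiff ℝ ∞ l
  contDiff_α : ContDiff ℝ ∞ α
  ρ_pos : ∀ v, 0 < ρ v
  l_pos : ∀ v, 0 < l v
  α_pos : ∀ v, 0 < α v
  w_sq : ∀ v, w v ^ 2 = h M (ρ v) + rate H c (ρ v) ^ 2
  hasDerivAt_ρ : ∀ v, HasDerivAt ρ (l v * w v) v
  hasDerivAt_w : ∀ v, HasDerivAt w
    (l v * (M / ρ v ^ 2 + rate H c (ρ v) * rateDeriv H c (ρ v))) v
  hasDerivAt_α : ∀ v, HasDerivAt α (α v * (l v * (rateDeriv H c (ρ v) +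
    (1 / (2 * M) + 1 / ρ v) * (w v + rate H c (ρ v)) / 2))) v

namespace Profile
variable {M H c : ℝ} (p : Profile M H c)

/-- The other null component of the unit tangent vector. -/
noncomputable def β (v : ℝ) : ℝ := p.ρ v * Real.exp (p.ρ v / (2 * M)) / (16 * M ^ 2 * p.α v)

/-- The null coordinate `X + T` of the profile curve. -/
noncomputable def V (v : ℝ) : ℝ := 4 * M * p.α v * (p.w v - rate H c (p.ρ v))

/-- The null coordinate `X - T` of the profile curve. -/
noncomputable def U (v : ℝ) : ℝ := 4 * M * p.β v * (p.w v + rate H c (p.ρ v))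

/-- The `X` component of the unit tangent vector. -/
noncomputable def a (v : ℝ) : ℝ := (p.α v + p.β v) / 2

/-- The `T` component of the unit tangent vector. -/
noncomputable def b (v : ℝ) : ℝ := (p.α v - p.β v) / 2

/-- The coordinate `X` of the profile curve. -/
noncomputable def X (v : ℝ) : ℝ := (p.V v + p.U v) / 2

/-- The coordinate `T` of the profile curve. -/
noncomputable def T (v : ℝ) : ℝ := (p.V v - p.U v) / 2

/-- The profile curve in the Kruskal plane. -/
noncomputable def curve (v : ℝ) : ℝ × ℝ := (p.X v, p.T v)

lemma hasDerivAt_rate_ρ (v : ℝ) : HasDerivAt (fun v => rate H c (p.ρ v))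
    (rateDeriv H c (p.ρ v) * (p.l v * p.w v)) v :=
  (hasDerivAt_rate H c (p.ρ_pos v).ne').comp v (p.hasDerivAt_ρ v)

lemma contDiff_rate : ContDiff ℝ ∞ fun v => rate H c (p.ρ v) := by
  unfold rate
  exact (contDiff_const.mul p.contDiff_ρ).add
    (contDiff_const.div (p.contDiff_ρ.pow 2) fun v => pow_ne_zero 2 (p.ρ_pos v).ne')

/-- `V` is defined algebraically, so it has to be checked that it is a coordinate of a curve with
velocity `l` times the unit tangent. In V'/(4Mlα) the terms with P' cancel, and w² - P² = h leaves
(1/(2M) + 1/r) h/2 + M/r², which is 1/(4M). -/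
lemma hasDerivAt_V (hM : 0 < M) (v : ℝ) : HasDerivAt p.V (p.l v * p.α v) v := by
  have h1 := ((p.hasDerivAt_α v).const_mul (4 * M)).mul
    ((p.hasDerivAt_w v).sub (p.hasDerivAt_rate_ρ v))
  refine h1.congr_deriv ?_
  have h2 := p.w_sq v
  have h3 := (p.ρ_pos v).ne'
  simp only [h] at h2
  simp only [Pi.sub_apply]
  generalize rate H c (p.ρ v) = P at *
  generalize rateDeriv H c (p.ρ v) = P' at *
  have h4 : P ^ 2 = p.w v ^ 2 - 1 + 2 * M / p.ρ v := by linarith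
  field_simp at h4 ⊢
  ring_nf at h4 ⊢
  linear_combination (-4 * p.ρ v - 8 * M) * p.α v * p.l v * h4

lemma β_pos (hM : 0 < M) (v : ℝ) : 0 < p.β v := by
  have := p.ρ_pos v
  have := p.α_pos v
  unfold β
  positivity

/-- The product αβ is the inverse of the conformal factor, with logarithmic derivative (1/(2M) +
1/r) l w; that of α is subtracted. -/
lemma hasDerivAt_β (hM : 0 < M) (v : ℝ) : HasDerivAt p.β
    (p.β v * (p.l v * (-rateDeriv H c (p.ρ v) +
      (1 / (2 * M) + 1 / p.ρ v) * (p.w v - rate H c (p.ρ v)) / 2))) v := by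
  have h0 : HasDerivAt (fun v => p.ρ v / (2 * M)) _ v := (p.hasDerivAt_ρ v).div_const _
  have h3 := (p.ρ_pos v).ne'
  have h4 := (p.α_pos v).ne'
  have h1 := ((p.hasDerivAt_ρ v).mul h0.exp).div ((p.hasDerivAt_α v).const_mul (16 * M ^ 2))
    (by positivity)
  refine h1.congr_deriv ?_
  simp only [β, Pi.mul_apply]
  field_simp
  ring

lemma hasDerivAt_U (hM : 0 < M) (v : ℝ) : HasDerivAt p.U (p.l v * p.β v) v := by
  have h1 := ((p.hasDerivAt_β hM v).const_mul (4 * M)).mul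
    ((p.hasDerivAt_w v).add (p.hasDerivAt_rate_ρ v))
  refine h1.congr_deriv ?_
  have h2 := p.w_sq v
  have h3 := (p.ρ_pos v).ne'
  simp only [h] at h2
  simp only [Pi.add_apply]
  generalize rate H c (p.ρ v) = P at *
  generalize rateDeriv H c (p.ρ v) = P' at *
  have h4 : P ^ 2 = p.w v ^ 2 - 1 + 2 * M / p.ρ v := by linarith
  field_simp at h4 ⊢
  ring_nf at h4 ⊢
  linear_combination (-4 * p.ρ v - 8 * M) * p.β v * p.l v * h4

lemma hasDerivAt_X (hM : 0 < M) (v : ℝ) : HasDerivAt p.X (p.l v * p.a v) v :=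
  (((p.hasDerivAt_V hM v).add (p.hasDerivAt_U hM v)).div_const 2).congr_deriv
    (by simp only [a]; ring)

lemma hasDerivAt_T (hM : 0 < M) (v : ℝ) : HasDerivAt p.T (p.l v * p.b v) v :=
  (((p.hasDerivAt_V hM v).sub (p.hasDerivAt_U hM v)).div_const 2).congr_deriv
    (by simp only [b]; ring)

lemma a_pos (hM : 0 < M) (v : ℝ) : 0 < p.a v := by
  have := p.β_pos hM v
  have := p.α_pos v
  unfold a; positivity

/-- The product is 16 M² αβ (w² - P²) = r exp(r/2M) h(r). This is what makes `ρ` the area radius of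
the curve. -/
lemma U_mul_V (hM : 0 < M) (v : ℝ) : p.U v * p.V v = radial M (p.ρ v) := by
  have h2 := p.w_sq v
  have h3 := (p.ρ_pos v).ne'
  have h4 := (p.α_pos v).ne'
  simp only [h] at h2
  simp only [U, V, β, radial]
  have h5 : (p.w v + rate H c (p.ρ v)) * (p.w v - rate H c (p.ρ v)) = 1 - 2 * M / p.ρ v := by
    linarith
  have h6 : p.ρ v * (1 - 2 * M / p.ρ v) = p.ρ v - 2 * M := by field_simp
  rw [← h6, ← h5]
  field_simp
  ring

lemma curve_sq (hM : 0 < M) (v : ℝ) :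
    (p.curve v).1 ^ 2 - (p.curve v).2 ^ 2 = radial M (p.ρ v) := by
  rw [← p.U_mul_V hM]
  simp only [curve, X, T]
  ring

lemma curve_mem_plane (hM : 0 < M) (v : ℝ) : p.curve v ∈ plane M :=
  mem_plane_of_radial hM (p.ρ_pos v) (p.curve_sq hM v)

lemma radius_curve (hM : 0 < M) (v : ℝ) : radius M (p.curve v) = p.ρ v :=
  radius_eq hM (p.ρ_pos v) (p.curve_sq hM v)

lemma conformalFactor_curve (hM : 0 < M) (v : ℝ) :
    conformalFactor M (p.curve v) * (p.α v * p.β v) = 1 := by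
  have h3 := (p.ρ_pos v).ne'
  have h4 := (p.α_pos v).ne'
  have he : Real.exp (-(p.ρ v) / (2 * M)) = (Real.exp (p.ρ v / (2 * M)))⁻¹ := by
    rw [← Real.exp_neg]; ring_nf
  rw [conformalFactor, p.radius_curve hM, β, he]
  field_simp

lemma contDiff_β (hM : 0 < M) : ContDiff ℝ ∞ p.β := by
  unfold β
  exact (p.contDiff_ρ.mul (p.contDiff_ρ.div_const _).exp).div
    (contDiff_const.mul p.contDiff_α) fun v => by have := p.α_pos v; positivity

lemma contDiff_V : ContDiff ℝ ∞ p.V :=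
  (contDiff_const.mul p.contDiff_α).mul (p.contDiff_w.sub p.contDiff_rate)

lemma contDiff_U (hM : 0 < M) : ContDiff ℝ ∞ p.U :=
  (contDiff_const.mul (p.contDiff_β hM)).mul (p.contDiff_w.add p.contDiff_rate)

lemma contDiff_a (hM : 0 < M) : ContDiff ℝ ∞ p.a :=
  (p.contDiff_α.add (p.contDiff_β hM)).div_const 2

lemma contDiff_b (hM : 0 < M) : ContDiff ℝ ∞ p.b :=
  (p.contDiff_α.sub (p.contDiff_β hM)).div_const 2

lemma contDiff_X (hM : 0 < M) : ContDiff ℝ ∞ p.X :=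
  (p.contDiff_V.add (p.contDiff_U hM)).div_const 2

lemma contDiff_T (hM : 0 < M) : ContDiff ℝ ∞ p.T :=
  (p.contDiff_V.sub (p.contDiff_U hM)).div_const 2

lemma contDiff_curve (hM : 0 < M) : ContDiff ℝ ∞ p.curve :=
  (p.contDiff_X hM).prodMk (p.contDiff_T hM)

lemma unit_tangent (hM : 0 < M) (v : ℝ) :
    conformalFactor M (p.curve v) * (p.a v ^ 2 - p.b v ^ 2) = 1 := by
  rw [← p.conformalFactor_curve hM v, a, b]; ring

/-- Up to the factor 4M the left side is the derivative of r along the unit normal; this identifies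
`rate` geometrically. -/
lemma rate_eq (hM : 0 < M) (v : ℝ) :
    conformalFactor M (p.curve v) * ((p.curve v).1 * p.b v - (p.curve v).2 * p.a v) =
      4 * M * rate H c (p.ρ v) := by
  have h1 := p.conformalFactor_curve hM v
  simp only [a, b, X, T, curve, U, V] at h1 ⊢
  linear_combination (4 * M * rate H c (p.ρ v)) * h1

lemma spacelikeCMC (hM : 0 < M) (v₀ ε : ℝ) :
    SpacelikeCMC M H (fun s => p.curve (v₀ + s)) ε := by
  refine ⟨normalField (fun s => p.a (v₀ + s)) fun s => p.b (v₀ + s), ?_, ?_⟩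
  · apply ContDiff.contDiffOn
    have h1 : ContDiff ℝ ∞ fun u : Fin 3 → ℝ => p.b (v₀ + u 0) :=
      (p.contDiff_b hM).comp (by fun_prop)
    have h2 : ContDiff ℝ ∞ fun u : Fin 3 → ℝ => p.a (v₀ + u 0) :=
      (p.contDiff_a hM).comp (by fun_prop)
    rw [contDiff_pi]
    intro i
    fin_cases i
    · simpa [normalField] using h1
    · simpa [normalField] using h2
    · exact contDiff_const
    · exact contDiff_const
  intro u _ hu
  set v := v₀ + u 0 with hv
  have hs : Real.sin (u 1) ≠ 0 := (Real.sin_pos_of_mem_Ioo hu).ne'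
  have hX : HasDerivAt (fun s => (p.curve (v₀ + s)).1) (p.l v * p.a v) (u 0) :=
    (p.hasDerivAt_X hM v).comp_const_add v₀ (u 0)
  have hT : HasDerivAt (fun s => (p.curve (v₀ + s)).2) (p.l v * p.b v) (u 0) :=
    (p.hasDerivAt_T hM v).comp_const_add v₀ (u 0)
  have ha : HasDerivAt (fun s => p.a (v₀ + s)) _ (u 0) :=
    (((p.hasDerivAt_α v).add (p.hasDerivAt_β hM v)).div_const 2).comp_const_add v₀ (u 0)
  have hb : HasDerivAt (fun s => p.b (v₀ + s)) _ (u 0) :=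
    (((p.hasDerivAt_α v).sub (p.hasDerivAt_β hM v)).div_const 2).comp_const_add v₀ (u 0)
  have hp := p.curve_mem_plane hM v
  have hQ := conformalFactor_pos hM hp
  have hl := p.l_pos v
  have hunit := p.unit_tangent hM v
  have hrate := p.rate_eq hM v
  have hr := p.ρ_pos v
  refine ⟨posDef_inducedMetric_rotate hM hX hT hp hs ?_, ?_, ?_,
    by simpa [normalField] using p.a_pos hM v, ?_⟩
  · have : 0 < p.a v ^ 2 - p.b v ^ 2 := by
      by_contra hcon
      nlinarith
    have := mul_pos (pow_pos hl 2) this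
    nlinarith
  · intro i
    rw [tangentVec_rotate hX hT, scalarProd_metric]
    fin_cases i <;> simp [Fin.sum_univ_four, normalField, metricDiag, rotate, ← hv]
    ring
  · rw [scalarProd_metric]
    simp only [Fin.sum_univ_four, normalField, metricDiag, ← hv]
    simp [rotate, ← hv]
    linear_combination -hunit
  · rw [meanCurvature_rotate hM hX hT hp hs hl.ne' rfl rfl ha hb hunit]
    have hq : conformalSlope M (p.curve v) =
        -conformalFactor M (p.curve v) * (1 / (2 * M) + 1 / p.ρ v) := by
      rw [conformalSlope, p.radius_curve hM]
    have hQab := p.conformalFactor_curve hM v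
    change 1 / 3 * (conformalFactor M (p.curve v) * (p.a v * _ - p.b v * _) / p.l v +
      conformalSlope M (p.curve v) / (8 * M) * ((p.curve v).1 * p.b v - (p.curve v).2 * p.a v) +
      2 * (conformalFactor M (p.curve v) / (4 * M) *
        ((p.curve v).1 * p.b v - (p.curve v).2 * p.a v)) / radius M (p.curve v)) = H
    rw [hq, p.radius_curve hM]
    generalize conformalFactor M (p.curve v) = Q at *
    have e1 : -Q * (1 / (2 * M) + 1 / p.ρ v) / (8 * M) *
        ((p.curve v).1 * p.b v - (p.curve v).2 * p.a v) =
        -(1 / (2 * M) + 1 / p.ρ v) * rate H c (p.ρ v) / 2 := by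
      rw [show -Q * (1 / (2 * M) + 1 / p.ρ v) / (8 * M) *
        ((p.curve v).1 * p.b v - (p.curve v).2 * p.a v) =
        -(1 / (2 * M) + 1 / p.ρ v) / (8 * M) *
          (Q * ((p.curve v).1 * p.b v - (p.curve v).2 * p.a v)) by ring, hrate]
      field_simp
      ring
    have e2 : Q / (4 * M) * ((p.curve v).1 * p.b v - (p.curve v).2 * p.a v) =
        rate H c (p.ρ v) := by
      rw [div_mul_eq_mul_div, hrate]; field_simp
    -- With x and y the logarithmic derivatives of α and β by arc length, the bending term is (x -
    -- y)/2 = P' + (1/(2M) + 1/r) P/2. The second summand cancels against `e1`, and P' + 2P/r = 3H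
    -- remains.
    have e3 : ∀ x y : ℝ, Q * (p.a v * ((p.α v * (p.l v * x) - p.β v * (p.l v * y)) / 2) -
        p.b v * ((p.α v * (p.l v * x) + p.β v * (p.l v * y)) / 2)) / p.l v = (x - y) / 2 := by
      intro x y
      rw [a, b]
      field_simp
      linear_combination 2 * (x - y) * hQab
    rw [e1, e2, e3, rate, rateDeriv]
    field_simp
    ring

end Profile

/-! ### The profile curve is embedded -/

/-- The local inverse of the inverse function theorem agrees with the global left inverse near f v,
because f is injective. Surjectivity is not needed. -/
lemma hasDerivAt_invFun {f f' : ℝ → ℝ} (hf : ContDiff ℝ ∞ f) (hd : ∀ v, HasDerivAt f (f' v) v)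
    (hpos : ∀ v, 0 < f' v) (v : ℝ) :
    HasDerivAt (Function.invFun f) (f' v)⁻¹ (f v) := by
  have hinj : Function.Injective f := (strictMono_of_hasDerivAt_pos hd hpos).injective
  have hs : HasStrictDerivAt f (f' v) v :=
    hf.contDiffAt.hasStrictDerivAt' (hd v) (by simp)
  have hne := (hpos v).ne'
  refine (hs.to_localInverse hne).hasDerivAt.congr_of_eventuallyEq ?_
  filter_upwards [HasStrictFDerivAt.eventually_right_inverse (hs.hasStrictFDerivAt_equiv hne)]
    with y hy
  conv_lhs => rw [← hy]
  exact Function.leftInverse_invFun hinj _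

lemma isOpenMap_of_hasDerivAt_pos {f f' : ℝ → ℝ} (hf : ContDiff ℝ ∞ f)
    (hd : ∀ v, HasDerivAt f (f' v) v) (hpos : ∀ v, 0 < f' v) : IsOpenMap f :=
  isOpenMap_of_hasStrictDerivAt
    (fun v => hf.contDiffAt.hasStrictDerivAt' (hd v) (by simp)) fun v => (hpos v).ne'

namespace Profile
variable {M H c : ℝ} (p : Profile M H c)

lemma X_deriv_pos (hM : 0 < M) (v : ℝ) : 0 < p.l v * p.a v :=
  mul_pos (p.l_pos v) (p.a_pos hM v)

/-- A spacelike curve is a graph over the X axis. This is the source of embeddedness: the parameter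
is a function of X alone. -/
lemma strictMono_X (hM : 0 < M) : StrictMono p.X :=
  strictMono_of_hasDerivAt_pos (p.hasDerivAt_X hM) (p.X_deriv_pos hM)

/-- The parameter of a point of the profile curve, as a function on the Kruskal plane. -/
noncomputable def param (x : ℝ × ℝ) : ℝ := Function.invFun p.X x.1

lemma param_curve (hM : 0 < M) (v : ℝ) : p.param (p.curve v) = v :=
  Function.leftInverse_invFun (p.strictMono_X hM).injective v

lemma continuousAt_param (hM : 0 < M) (v : ℝ) : ContinuousAt p.param (p.curve v) := by
  have h1 : ContinuousAt (Function.invFun p.X) (p.curve v).1 :=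
    (hasDerivAt_invFun (p.contDiff_X hM) (p.hasDerivAt_X hM) (p.X_deriv_pos hM) v).continuousAt
  exact ContinuousAt.comp (f := Prod.fst) h1 continuousAt_fst

lemma continuousOn_param (hM : 0 < M) : ContinuousOn p.param (range p.curve) := by
  rintro _ ⟨v, rfl⟩
  exact (p.continuousAt_param hM v).continuousWithinAt

/-- The hypersurface over an open piece of the profile curve is an SS-CMC hypersurface. -/
lemma isSSCMC_image (hM : 0 < M) {J : Set ℝ} (hJ : IsOpen J) : IsSSCMC M H (p.curve '' J) := by
  constructor
  · rintro _ ⟨v, -, rfl⟩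
    exact p.curve_mem_plane hM v
  rintro _ ⟨v, hv, rfl⟩
  obtain ⟨ε, hε, hball⟩ := Metric.isOpen_iff.1 hJ v hv
  rw [Real.ball_eq_Ioo] at hball
  -- The neighbourhood is the vertical strip over the X-interval of a short piece; by monotonicity
  -- of X it meets no other part of the curve.
  have hopen : IsOpen (p.X '' Ioo (v - ε) (v + ε)) :=
    isOpenMap_of_hasDerivAt_pos (p.contDiff_X hM) (p.hasDerivAt_X hM) (p.X_deriv_pos hM) _
      isOpen_Ioo
  refine ⟨Prod.fst ⁻¹' (p.X '' Ioo (v - ε) (v + ε)), fun s => p.curve (v + s),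
    fun x => p.param x - v, ε, hopen.preimage continuous_fst,
    ⟨v, ⟨by linarith, by linarith⟩, rfl⟩, hε, by simp, ?_, ?_, ?_, ?_, p.spacelikeCMC hM v ε⟩
  · exact ((p.contDiff_curve hM).comp (by fun_prop)).contDiffOn
  · ext x
    constructor
    · rintro ⟨s, hs, rfl⟩
      have : v + s ∈ Ioo (v - ε) (v + ε) := ⟨by linarith [hs.1], by linarith [hs.2]⟩
      exact ⟨⟨v + s, hball this, rfl⟩, v + s, this, rfl⟩
    · rintro ⟨⟨t, -, rfl⟩, t', ht', h⟩
      obtain rfl : t' = t := (p.strictMono_X hM).injective h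
      exact ⟨t' - v, ⟨by linarith [ht'.1], by linarith [ht'.2]⟩, by simp⟩
  · refine ((p.continuousOn_param hM).mono ?_).sub continuousOn_const
    rintro _ ⟨⟨t, -, rfl⟩, -⟩
    exact ⟨t, rfl⟩
  · intro s _
    simp only [p.param_curve hM]
    ring

lemma isSSCMC_range (hM : 0 < M) : IsSSCMC M H (range p.curve) := by
  rw [← image_univ]
  exact p.isSSCMC_image hM isOpen_univ

end Profile

/-! ### Ends -/

/-- A space that is exhausted by a proper function whose superlevel and sublevel sets are connected
has two ends. -/
lemma hasEnds_two {E S : Type*} [TopologicalSpace E] [TopologicalSpace S] [CompactSpace S]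
    [ConnectedSpace S] {Θ : ℝ × S → E} {φ : E → ℝ} (hΘ : Continuous Θ)
    (hsurj : Function.Surjective Θ) (hφ : Continuous φ) (hφΘ : ∀ x, φ (Θ x) = x.1) :
    HasEnds 2 E := by
  have hpre : ∀ A : Set ℝ, φ ⁻¹' A = Θ '' (A ×ˢ univ) := by
    intro A
    ext e
    obtain ⟨x, rfl⟩ := hsurj e
    constructor
    · intro h
      exact ⟨x, ⟨by simpa [hφΘ] using h, mem_univ _⟩, rfl⟩
    · rintro ⟨y, hy, hyx⟩
      rw [mem_preimage, ← hyx, hφΘ]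
      exact hy.1
  have hcomp : ∀ A : Set ℝ, IsCompact A → IsCompact (φ ⁻¹' A) := fun A hA => by
    rw [hpre]; exact (hA.prod isCompact_univ).image hΘ
  have hconn : ∀ A : Set ℝ, IsConnected A → IsConnected (φ ⁻¹' A) := fun A hA => by
    rw [hpre]; exact (hA.prod isConnected_univ).image _ hΘ.continuousOn
  -- The fibre over 0 is compact and separates the two ends, so no component of the complement of a
  -- larger compact set reaches both.
  refine ⟨?_, φ ⁻¹' {0}, hcomp _ isCompact_singleton, ?_⟩
  · have := hconn univ isConnected_univ
    rw [preimage_univ] at this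
    exact connectedSpace_iff_univ.2 this
  intro K hK hK0
  obtain ⟨R, hR⟩ : ∃ R, ∀ x ∈ φ '' K, |x| ≤ R := by
    obtain ⟨R, hR⟩ := (hK.image hφ).isBounded.subset_closedBall 0
    exact ⟨R, fun x hx => by simpa using hR hx⟩
  set ρ := max R 1 with hρ
  have hρ1 : (1 : ℝ) ≤ ρ := le_max_right _ _
  have hKρ : ∀ e, ρ < |φ e| → e ∈ Kᶜ := fun e he heK =>
    absurd (hR _ ⟨e, heK, rfl⟩) (not_le.2 ((le_max_left _ _).trans_lt he))
  have hne : ∀ t : ℝ, ∃ e, φ e = t := fun t => by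
    obtain ⟨s⟩ := (inferInstance : Nonempty S)
    exact ⟨Θ (t, s), hφΘ _⟩
  have hnc : ∀ C : Set E, (¬ BddAbove (φ '' C) ∨ ¬ BddBelow (φ '' C)) →
      ¬ IsCompact (closure C) := by
    intro C hC hcl
    have hb := (hcl.image hφ).isBounded.subset (image_mono subset_closure)
    exact hC.elim (fun h => h hb.bddAbove) fun h => h hb.bddBelow
  obtain ⟨eP, heP⟩ := hne (ρ + 1)
  obtain ⟨eN, heN⟩ := hne (-(ρ + 1))
  have hPsub : φ ⁻¹' Ioi ρ ⊆ Kᶜ := fun e he => hKρ e (lt_of_lt_of_le he (le_abs_self _))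
  have hNsub : φ ⁻¹' Iio (-ρ) ⊆ Kᶜ := fun e he => hKρ e (by
    have : φ e < -ρ := he
    exact lt_of_lt_of_le (by linarith) (neg_le_abs _))
  have hP : φ ⁻¹' Ioi ρ ⊆ connectedComponentIn Kᶜ eP :=
    (hconn _ isConnected_Ioi).isPreconnected.subset_connectedComponentIn
      (by simp [heP]) hPsub
  have hN : φ ⁻¹' Iio (-ρ) ⊆ connectedComponentIn Kᶜ eN :=
    (hconn _ isConnected_Iio).isPreconnected.subset_connectedComponentIn
      (by simp [heN]) hNsub
  -- a connected subset of the complement of `K` lies on one side of the zero set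
  have hside : ∀ x ∈ Kᶜ, ∀ y ∈ connectedComponentIn Kᶜ x, 0 < φ x → 0 < φ y := by
    intro x hx y hy hpos
    by_contra hcon
    have hc := (isPreconnected_connectedComponentIn (x := x) (F := Kᶜ)).image φ hφ.continuousOn
    have h0 : (0 : ℝ) ∈ φ '' connectedComponentIn Kᶜ x :=
      hc.ordConnected.out ⟨y, hy, rfl⟩ ⟨x, mem_connectedComponentIn hx, rfl⟩
        ⟨not_lt.1 hcon, hpos.le⟩
    obtain ⟨z, hz, hz0⟩ := h0
    exact connectedComponentIn_subset _ _ hz (hK0 hz0)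
  have hPK : eP ∈ Kᶜ := hPsub (by simp [heP])
  have hNK : eN ∈ Kᶜ := hNsub (by simp [heN])
  have hPN : connectedComponentIn Kᶜ eP ≠ connectedComponentIn Kᶜ eN := by
    intro h
    have := hside eP hPK eN (h ▸ mem_connectedComponentIn hNK) (by rw [heP]; linarith)
    rw [heN] at this
    linarith
  have hset : unboundedComponents K =
      {connectedComponentIn Kᶜ eP, connectedComponentIn Kᶜ eN} := by
    ext C
    simp only [unboundedComponents, mem_ofPred_eq, mem_insert_iff, mem_singleton_iff]
    constructor
    · rintro ⟨⟨x, hx, rfl⟩, hC⟩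
      by_contra hcon
      push Not at hcon
      -- A component different from the two distinguished ones misses both halves, so it lies over
      -- the compact interval [-ρ, ρ].
      refine hC ((hcomp (Icc (-ρ) ρ) isCompact_Icc).of_isClosed_subset isClosed_closure ?_)
      refine closure_minimal ?_ (isClosed_Icc.preimage hφ)
      intro y hy
      constructor
      · by_contra hlt
        exact hcon.2 ((connectedComponentIn_eq hy).trans
          (connectedComponentIn_eq (hN (not_le.1 hlt))).symm)
      · by_contra hlt
        exact hcon.1 ((connectedComponentIn_eq hy).trans
          (connectedComponentIn_eq (hP (not_le.1 hlt))).symm)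
    · rintro (rfl | rfl)
      · refine ⟨⟨eP, hPK, rfl⟩, hnc _ (Or.inl ?_)⟩
        rintro ⟨B, hB⟩
        obtain ⟨e, he⟩ := hne (max B ρ + 1)
        have := hB ⟨e, hP (by
          rw [mem_preimage, he]; exact lt_of_le_of_lt (le_max_right B ρ) (lt_add_one _)), rfl⟩
        rw [he] at this
        linarith [le_max_left B ρ]
      · refine ⟨⟨eN, hNK, rfl⟩, hnc _ (Or.inr ?_)⟩
        rintro ⟨B, hB⟩
        obtain ⟨e, he⟩ := hne (min B (-ρ) - 1)
        have := hB ⟨e, hN (by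
          rw [mem_preimage, he]; exact lt_of_lt_of_le (sub_one_lt _) (min_le_right B (-ρ))), rfl⟩
        rw [he] at this
        linarith [min_le_left B (-ρ)]
  rw [hset, encard_pair hPN]
  rfl

namespace Profile
variable {M H c : ℝ} (p : Profile M H c)

lemma hasEnds_two_range (hM : 0 < M) : HasEnds 2 (sphericalLift M (range p.curve)) := by
  have hconn : IsConnected (Metric.sphere (0 : EuclideanSpace ℝ (Fin 3)) 1) :=
    isConnected_sphere (by
      rw [← Module.finrank_eq_rank]; simp) 0 zero_le_one
  have : ConnectedSpace (Metric.sphere (0 : EuclideanSpace ℝ (Fin 3)) 1) :=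
    isConnected_iff_connectedSpace.1 hconn
  refine hasEnds_two (S := Metric.sphere (0 : EuclideanSpace ℝ (Fin 3)) 1)
    (Θ := fun x => ⟨⟨(p.curve x.1, x.2), p.curve_mem_plane hM x.1⟩, ⟨x.1, rfl⟩⟩)
    (φ := fun e => p.param e.1.1.1) ?_ ?_ ?_ ?_
  · exact (((p.contDiff_curve hM).continuous.comp continuous_fst).prodMk
      continuous_snd).subtype_mk _ |>.subtype_mk _
  · rintro ⟨⟨⟨x, z⟩, hx⟩, ⟨v, hv⟩⟩
    refine ⟨(v, z), ?_⟩
    ext1; ext1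
    exact Prod.ext hv rfl
  · refine (p.continuousOn_param hM).comp_continuous (by fun_prop) fun e => e.2
  · intro x
    exact p.param_curve hM x.1

/-- The hypersurface is closed as soon as the parameters of its points near a given point of the
Kruskal extension are bounded. -/
lemma isClosed_sphericalLift (hM : 0 < M)
    (hproper : ∀ x ∈ plane M, ∃ A B : ℝ, ∀ᶠ y in 𝓝 x, ∀ v, p.curve v = y → v ∈ Icc A B) :
    IsClosed (sphericalLift M (range p.curve)) := by
  have hcl : ∀ x ∈ plane M, x ∈ closure (range p.curve) → x ∈ range p.curve := by
    intro x hx hxc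
    obtain ⟨A, B, hAB⟩ := hproper x hx
    have h1 : x ∈ closure (p.curve '' Icc A B) := by
      rw [mem_closure_iff_frequently] at hxc ⊢
      refine (hxc.and_eventually hAB).mono ?_
      rintro y ⟨⟨v, rfl⟩, hy⟩
      exact ⟨v, hy v rfl, rfl⟩
    rw [(isCompact_Icc.image (p.contDiff_curve hM).continuous).isClosed.closure_eq] at h1
    exact image_subset_range _ _ h1
  refine isClosed_of_closure_subset fun e he => hcl _ e.2 ?_
  have hcont : Continuous fun e : Extension M => e.1.1 := by fun_prop
  refine closure_mono ?_ (image_closure_subset_closure_image hcont ⟨e, he, rfl⟩)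
  rintro _ ⟨e, he, rfl⟩
  exact he

end Profile

/-! ### Arc length and curves of finite length -/

/-- A function with integrable derivative has a limit at the end of the interval. -/
lemma exists_tendsto_of_norm_deriv_le {E : Type*} [NormedAddCommGroup E] [NormedSpace ℝ E]
    [CompleteSpace E] [SecondCountableTopology E] {f : ℝ → E} {g : ℝ → ℝ} {t : ℝ} (ht : t < 1)
    (hd : ∀ τ ∈ Ioo t 1, DifferentiableAt ℝ f τ) (hle : ∀ τ ∈ Ioo t 1, ‖deriv f τ‖ ≤ g τ)
    (hg : MeasureTheory.IntegrableOn g (Ioo t 1)) : ∃ L, Tendsto f (𝓝[<] 1) (𝓝 L) := by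
  borelize E
  have hf : MeasureTheory.IntegrableOn (deriv f) (Ioo t 1) := by
    refine MeasureTheory.Integrable.mono' hg
      (stronglyMeasurable_deriv f).aestronglyMeasurable ?_
    filter_upwards [MeasureTheory.ae_restrict_mem measurableSet_Ioo] with τ hτ
    exact hle τ hτ
  obtain ⟨m, hm1, hm2⟩ := exists_between ht
  have hint : MeasureTheory.IntegrableOn (deriv f) (uIcc m 1) := by
    rw [uIcc_of_le hm2.le, integrableOn_Icc_iff_integrableOn_Ioo]
    exact hf.mono_set (Ioo_subset_Ioo_left hm1.le)
  have hc := intervalIntegral.continuousOn_primitive_interval hint 1 right_mem_uIcc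
  refine ⟨f m + ∫ τ in m..1, deriv f τ, ?_⟩
  have h1 : Tendsto (fun x => f m + ∫ τ in m..x, deriv f τ) (𝓝[<] 1)
      (𝓝 (f m + ∫ τ in m..1, deriv f τ)) := by
    refine tendsto_const_nhds.add (hc.tendsto.mono_left ?_)
    rw [uIcc_of_le hm2.le]
    exact (nhdsWithin_Ioo_eq_nhdsLT hm2).symm.le.trans (nhdsWithin_mono _ Ioo_subset_Icc_self)
  refine h1.congr' ?_
  filter_upwards [Ioo_mem_nhdsLT hm2] with x hx
  have hsub : uIcc m x ⊆ Ioo t 1 := by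
    rw [uIcc_of_le hx.1.le]
    exact fun y hy => ⟨hm1.trans_le hy.1, hy.2.trans_lt hx.2⟩
  rw [intervalIntegral.integral_deriv_eq_sub (fun y hy => hd y (hsub hy))]
  · abel
  · refine (MeasureTheory.IntegrableOn.mono_set hint ?_).intervalIntegrable
    rw [uIcc_of_le hx.1.le, uIcc_of_le hm2.le]
    exact Icc_subset_Icc_right hx.2.le

lemma contDiff_primitive {f : ℝ → ℝ} (hf : ContDiff ℝ ∞ f) :
    (∀ v, HasDerivAt (fun v => ∫ x in (0 : ℝ)..v, f x) (f v) v) ∧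
      ContDiff ℝ ∞ fun v => ∫ x in (0 : ℝ)..v, f x := by
  have hd : ∀ v, HasDerivAt (fun v => ∫ x in (0 : ℝ)..v, f x) (f v) v := fun v =>
    hf.continuous.integral_hasStrictDerivAt 0 v |>.hasDerivAt
  refine ⟨hd, ?_⟩
  rw [contDiff_infty_iff_deriv]
  refine ⟨fun v => (hd v).differentiableAt, ?_⟩
  rwa [funext fun v => (hd v).deriv]

namespace Profile
variable {M H c : ℝ} (p : Profile M H c)

/-- The arc length of the profile curve. -/
noncomputable def arc (v : ℝ) : ℝ := ∫ x in (0 : ℝ)..v, p.l x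

lemma hasDerivAt_arc (v : ℝ) : HasDerivAt p.arc (p.l v) v := (contDiff_primitive p.contDiff_l).1 v

lemma contDiff_arc : ContDiff ℝ ∞ p.arc := (contDiff_primitive p.contDiff_l).2

lemma strictMono_arc : StrictMono p.arc := strictMono_of_hasDerivAt_pos p.hasDerivAt_arc p.l_pos

lemma arc_zero : p.arc 0 = 0 := by simp [arc]

/-- Mean value inequality. The two directions are kept apart because a hypersurface that runs into r
= 0 comes with a speed bound for v ≥ 0 only. -/
lemma le_arc {C : ℝ} (hC : ∀ v, 0 ≤ v → C ≤ p.l v) {v : ℝ} (hv : 0 ≤ v) : C * v ≤ p.arc v := by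
  have h := (convex_Ici (0 : ℝ)).mul_sub_le_image_sub_of_le_deriv
    p.contDiff_arc.continuous.continuousOn
    (fun x _ => (p.hasDerivAt_arc x).differentiableAt.differentiableWithinAt) (C := C)
    (fun x hx => by
      rw [interior_Ici] at hx
      rw [(p.hasDerivAt_arc x).deriv]; exact hC x (le_of_lt hx)) 0 self_mem_Ici v hv hv
  rw [arc_zero] at h
  linarith

lemma arc_le {C : ℝ} (hC : ∀ v, v ≤ 0 → C ≤ p.l v) {v : ℝ} (hv : v ≤ 0) : p.arc v ≤ C * v := by
  have h := (convex_Iic (0 : ℝ)).mul_sub_le_image_sub_of_le_deriv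
    p.contDiff_arc.continuous.continuousOn
    (fun x _ => (p.hasDerivAt_arc x).differentiableAt.differentiableWithinAt) (C := C)
    (fun x hx => by
      rw [interior_Iic] at hx
      rw [(p.hasDerivAt_arc x).deriv]; exact hC x (le_of_lt hx)) v hv 0 self_mem_Iic hv
  rw [arc_zero] at h
  linarith

variable {σ : ℝ → (ℝ × ℝ) × EuclideanSpace ℝ (Fin 3)}

lemma curve_param (hM : 0 < M) (hσ : IsFiniteLengthCurve M (range p.curve) σ) {τ : ℝ}
    (hτ : τ ∈ Ico (0 : ℝ) 1) : p.curve (p.param (σ τ).1) = (σ τ).1 := by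
  obtain ⟨v, hv⟩ := (hσ.mem τ hτ).1
  rw [← hv, p.param_curve hM]

/-- Derivatives along a curve of finite length. -/
lemma speed_bounds (hM : 0 < M) (hσ : IsFiniteLengthCurve M (range p.curve) σ) {τ : ℝ}
    (hτ : τ ∈ Ioo (0 : ℝ) 1) :
    DifferentiableAt ℝ (fun τ => p.arc (p.param (σ τ).1)) τ ∧
    ‖deriv (fun τ => p.arc (p.param (σ τ).1)) τ‖ ≤ speed M σ τ ∧
    DifferentiableAt ℝ (fun τ => (σ τ).2) τ ∧
    p.ρ (p.param (σ τ).1) * ‖deriv (fun τ => (σ τ).2) τ‖ ≤ speed M σ τ := by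
  have hτ' : τ ∈ Ico (0 : ℝ) 1 := Ioo_subset_Ico_self hτ
  have hd : DifferentiableAt ℝ σ τ :=
    (hσ.contDiffOn.contDiffAt (Ico_mem_nhds hτ.1 hτ.2)).differentiableAt (by simp)
  have hd1 : HasDerivAt (fun τ => (σ τ).1) (deriv σ τ).1 τ :=
    (ContinuousLinearMap.fst ℝ (ℝ × ℝ) (EuclideanSpace ℝ (Fin 3))).hasFDerivAt.comp_hasDerivAt τ
      hd.hasDerivAt
  have hd2 : HasDerivAt (fun τ => (σ τ).2) (deriv σ τ).2 τ :=
    (ContinuousLinearMap.snd ℝ (ℝ × ℝ) (EuclideanSpace ℝ (Fin 3))).hasFDerivAt.comp_hasDerivAt τ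
      hd.hasDerivAt
  have hd11 : HasDerivAt (fun τ => (σ τ).1.1) (deriv σ τ).1.1 τ :=
    (ContinuousLinearMap.fst ℝ ℝ ℝ).hasFDerivAt.comp_hasDerivAt τ hd1
  have hd12 : HasDerivAt (fun τ => (σ τ).1.2) (deriv σ τ).1.2 τ :=
    (ContinuousLinearMap.snd ℝ ℝ ℝ).hasFDerivAt.comp_hasDerivAt τ hd1
  have hcurve := p.curve_param hM hσ hτ'
  set v := p.param (σ τ).1 with hv
  have hinv := hasDerivAt_invFun (p.contDiff_X hM) (p.hasDerivAt_X hM) (p.X_deriv_pos hM) v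
  have hXv : p.X v = (σ τ).1.1 := congrArg Prod.fst hcurve
  rw [hXv] at hinv
  have hpar : HasDerivAt (fun τ => p.param (σ τ).1) ((p.l v * p.a v)⁻¹ * (deriv σ τ).1.1) τ :=
    hinv.comp τ hd11
  set v' := (p.l v * p.a v)⁻¹ * (deriv σ τ).1.1 with hv'
  -- Along the hypersurface T is a function of the parameter, so T' is determined by v'.
  have hT : HasDerivAt (fun τ => (σ τ).1.2) (p.l v * p.b v * v') τ := by
    refine ((p.hasDerivAt_T hM v).comp τ hpar).congr_of_eventuallyEq ?_
    filter_upwards [Ico_mem_nhds hτ.1 hτ.2] with t ht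
    exact (congrArg Prod.snd (p.curve_param hM hσ ht)).symm
  have h1 : (deriv σ τ).1.1 = p.l v * p.a v * v' := by
    rw [hv', mul_inv_cancel_left₀ (p.X_deriv_pos hM v).ne']
  have h2 : (deriv σ τ).1.2 = p.l v * p.b v * v' := hd12.unique hT
  have harc : HasDerivAt (fun τ => p.arc (p.param (σ τ).1)) (p.l v * v') τ :=
    HasDerivAt.comp (h₂ := p.arc) (h := fun τ => p.param (σ τ).1) τ (p.hasDerivAt_arc v) hpar
  -- The profile and spherical directions are orthogonal, so the speed dominates both the rate of
  -- change of the arc length and r times the angular speed.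
  have hspeed : speed M σ τ =
      Real.sqrt ((p.l v * v') ^ 2 + (p.ρ v * ‖(deriv σ τ).2‖) ^ 2) := by
    rw [speed, ← hcurve, p.radius_curve hM, h1, h2]
    congr 1
    linear_combination (p.l v * v') ^ 2 * p.unit_tangent hM v
  refine ⟨harc.differentiableAt, ?_, hd2.differentiableAt, ?_⟩
  · rw [harc.deriv, hspeed, Real.norm_eq_abs]
    exact Real.abs_le_sqrt (by nlinarith [sq_nonneg (p.ρ v * ‖(deriv σ τ).2‖)])
  · rw [hd2.deriv, hspeed]
    exact Real.le_sqrt_of_sq_le (by nlinarith [sq_nonneg (p.l v * v')])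

/-- A curve of finite length has an end point or its parameter tends to `-∞`. -/
lemma hasEndPoint_or_tendsto (hM : 0 < M) (hσ : IsFiniteLengthCurve M (range p.curve) σ)
    {C : ℝ} (hC0 : 0 < C) (hC : ∀ v, 0 ≤ v → C ≤ p.l v) :
    HasEndPoint (range p.curve) σ ∨
      ((∃ L, ∀ v, L < p.arc v) ∧ Tendsto (fun τ => p.param (σ τ).1) (𝓝[<] 1) atBot) := by
  -- The arc length coordinate of a curve of finite length converges; the only question is whether
  -- its limit L is attained on the profile curve.
  obtain ⟨L, hL⟩ := exists_tendsto_of_norm_deriv_le zero_lt_one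
    (fun τ hτ => (p.speed_bounds hM hσ hτ).1) (fun τ hτ => (p.speed_bounds hM hσ hτ).2.1)
    hσ.finite_length
  have hmono := p.strictMono_arc
  by_cases hLr : L ∈ range p.arc
  · left
    obtain ⟨v, rfl⟩ := hLr
    have hinv := (hasDerivAt_invFun p.contDiff_arc p.hasDerivAt_arc p.l_pos v).continuousAt
    have hpar : Tendsto (fun τ => p.param (σ τ).1) (𝓝[<] 1) (𝓝 v) := by
      have := hinv.tendsto.comp hL
      rw [Function.leftInverse_invFun hmono.injective v] at this
      refine this.congr fun τ => ?_
      exact Function.leftInverse_invFun hmono.injective _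
    have h1 : Tendsto (fun τ => (σ τ).1) (𝓝[<] 1) (𝓝 (p.curve v)) := by
      refine ((p.contDiff_curve hM).continuous.continuousAt.tendsto.comp hpar).congr' ?_
      filter_upwards [Ioo_mem_nhdsLT zero_lt_one] with τ hτ
      exact p.curve_param hM hσ (Ioo_subset_Ico_self hτ)
    -- Near the end r stays above half its limit value, so the angular speed is bounded by an
    -- integrable function and the spherical component converges too.
    have hρ : ∀ᶠ τ in 𝓝[<] (1 : ℝ), p.ρ v / 2 < p.ρ (p.param (σ τ).1) :=
      (p.contDiff_ρ.continuous.continuousAt.tendsto.comp hpar).eventually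
        (lt_mem_nhds (half_lt_self (p.ρ_pos v)))
    obtain ⟨t, ht, hsub⟩ := (mem_nhdsLT_iff_exists_Ioo_subset' zero_lt_one).1
      (Filter.inter_mem hρ (Ioo_mem_nhdsLT (zero_lt_one' ℝ)))
    have hρv := p.ρ_pos v
    obtain ⟨z, hz⟩ := exists_tendsto_of_norm_deriv_le (f := fun τ => (σ τ).2)
      (g := fun τ => 2 / p.ρ v * speed M σ τ) ht
      (fun τ hτ => (p.speed_bounds hM hσ (hsub hτ).2).2.2.1)
      (fun τ hτ => by
        have h1 := (p.speed_bounds hM hσ (hsub hτ).2).2.2.2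
        have h2 : p.ρ v / 2 < p.ρ (p.param (σ τ).1) := (hsub hτ).1
        have h3 : p.ρ v / 2 * ‖deriv (fun τ => (σ τ).2) τ‖ ≤ speed M σ τ :=
          (mul_le_mul_of_nonneg_right h2.le (norm_nonneg _)).trans h1
        rw [div_mul_eq_mul_div, le_div_iff₀ hρv]
        linarith)
      ((hσ.finite_length.mono_set fun τ hτ => (hsub hτ).2).const_mul _)
    refine ⟨(p.curve v, z), ⟨v, rfl⟩, ?_, h1.prodMk_nhds hz⟩
    refine tendsto_nhds_unique hz.norm (tendsto_const_nhds.congr' ?_)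
    filter_upwards [Ioo_mem_nhdsLT zero_lt_one] with τ hτ
    exact (hσ.mem τ (Ioo_subset_Ico_self hτ)).2.symm
  · right
    have hlt : ∀ v, L < p.arc v := by
      intro v
      by_contra hcon
      -- At parameter |L|/C the arc length is at least L. If some value were at most L, the
      -- intermediate value theorem would put L in the range.
      have hb : L ≤ p.arc (max v (|L| / C)) := by
        refine le_trans ?_ (p.le_arc hC (le_max_of_le_right (by positivity)))
        calc L ≤ C * (|L| / C) := by rw [mul_div_cancel₀ _ hC0.ne']; exact le_abs_self L
          _ ≤ _ := mul_le_mul_of_nonneg_left (le_max_right _ _) hC0.le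
      exact hLr (mem_range_of_exists_le_of_exists_ge p.contDiff_arc.continuous
        ⟨v, not_lt.1 hcon⟩ ⟨_, hb⟩)
    refine ⟨⟨L, hlt⟩, tendsto_atBot.2 fun v => ?_⟩
    filter_upwards [hL.eventually (gt_mem_nhds (hlt v))] with τ hτ
    exact (hmono.lt_iff_lt.1 hτ).le

lemma isRiemannianComplete (hM : 0 < M) {C : ℝ} (hC0 : 0 < C) (hC : ∀ v, C ≤ p.l v) :
    IsRiemannianComplete M (range p.curve) := by
  intro σ hσ
  refine (p.hasEndPoint_or_tendsto hM hσ hC0 fun v _ => hC v).resolve_right ?_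
  rintro ⟨⟨L, hL⟩, -⟩
  have h1 := p.arc_le (fun v _ => hC v) (v := -(|L| / C)) (by
    have : 0 ≤ |L| / C := by positivity
    linarith)
  have h2 := hL (-(|L| / C))
  have h3 : C * -(|L| / C) = -|L| := by field_simp
  linarith [neg_abs_le L]

end Profile

/-! ### Comparison with the Schwarzschild coordinates -/

lemma h_pos {M r : ℝ} (hM : 0 < M) (hr : 2 * M < r) : 0 < h M r := by
  have : 0 < r := by linarith
  rw [h, sub_pos, div_lt_one this]; exact hr

lemma h_neg {M r : ℝ} (hr0 : 0 < r) (hr : r < 2 * M) : h M r < 0 := by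
  rw [h, sub_neg, one_lt_div hr0]; exact hr

/-- Since 1 + l₁² = w²/h, multiplying by |dr/ds| = |w| turns the integrand of f₁ into P/h, the
derivative of the Schwarzschild time by arc length. -/
lemma l₁_integrand {M H c r w : ℝ} (hh : 0 < h M r) (hw : w ^ 2 = h M r + rate H c r ^ 2)
    (hw0 : w ≠ 0) :
    l₁ M H c r / h M r * Real.sqrt (1 / (1 + l₁ M H c r ^ 2)) * |w| = rate H c r / h M r := by
  have hs := Real.sq_sqrt hh.le
  have hs0 := Real.sqrt_pos.2 hh
  have h1 : 1 / (1 + l₁ M H c r ^ 2) = (Real.sqrt (h M r) / |w|) ^ 2 := by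
    rw [div_pow, sq_abs, hs, hw, l₁, ← rate, mul_pow, div_pow, hs]
    field_simp
  rw [h1, Real.sqrt_sq (by positivity), l₁, ← rate]
  field_simp

lemma l₃_integrand {M H c r w : ℝ} (hh : 0 < h M r) (hw : w ^ 2 = h M r + rate H c r ^ 2)
    (hw0 : w ≠ 0) :
    l₃ M H c r / h M r * Real.sqrt (1 / (1 + l₃ M H c r ^ 2)) * |w| =
      -1 * (rate H c r / h M r) := by
  have : l₃ M H c r = -l₁ M H c r := by simp only [l₃, l₁]; ring
  rw [this, neg_sq, ← l₁_integrand hh hw hw0]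
  ring

lemma l₂_eq (M H c r : ℝ) : l₂ M H c r = -rate H c r / Real.sqrt (-h M r) := by
  rw [l₂, rate]; ring

/-- Here l₂² - 1 = w²/(-h). The sign of P is used to take the root: √(P²) = -P. -/
lemma slope₂_mul {M H c r w : ℝ} (hh : h M r < 0) (hw : w ^ 2 = h M r + rate H c r ^ 2)
    (hw0 : w ≠ 0) (hP : rate H c r < 0) : slope₂ M H c r * |w| = rate H c r / h M r := by
  have hs := Real.sq_sqrt (neg_pos.2 hh).le
  have hw2 : 0 < w ^ 2 := by positivity
  have h1 : l₂ M H c r ^ 2 / (l₂ M H c r ^ 2 - 1) = (-rate H c r / |w|) ^ 2 := by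
    have h2 : l₂ M H c r ^ 2 = rate H c r ^ 2 / (-h M r) := by
      rw [l₂_eq, div_pow, hs, neg_sq]
    have h3 : l₂ M H c r ^ 2 - 1 = w ^ 2 / (-h M r) := by
      rw [h2, hw]; field_simp [hh.ne]; ring
    rw [h3, h2, div_div_div_cancel_right₀ (neg_pos.2 hh).ne', div_pow, sq_abs, neg_sq]
  rw [slope₂, h1, Real.sqrt_sq (div_nonneg (neg_pos.2 hP).le (abs_nonneg _))]
  have : |w| ≠ 0 := abs_ne_zero.2 hw0
  have := hh.ne
  field_simp

lemma one_lt_l₂_iff {M H c r : ℝ} (hh : h M r < 0) :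
    1 < l₂ M H c r ↔ rate H c r < 0 ∧ 0 < h M r + rate H c r ^ 2 := by
  rw [l₂_eq, one_lt_div (Real.sqrt_pos.2 (neg_pos.2 hh))]
  constructor
  · intro h1
    have h2 : 0 < -rate H c r := (Real.sqrt_nonneg _).trans_lt h1
    refine ⟨neg_pos.1 h2, ?_⟩
    have := (Real.sqrt_lt' h2).1 h1
    nlinarith
  · rintro ⟨h1, h2⟩
    rw [Real.sqrt_lt' (neg_pos.2 h1)]
    nlinarith

lemma slope₂_nonneg {M H c r : ℝ} (hh : h M r < 0) : 0 ≤ slope₂ M H c r := by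
  have := neg_pos.2 hh
  unfold slope₂
  positivity

/-- Applied with s = |r - 2M|: then s exp(r/2M) = |UV| and exp(t/2M) = |V/U|, so the left side of
the hypothesis is V². With -t in place of t it is U². -/
lemma sqrt_mul_exp {M s r t V : ℝ} (hM : 0 < M) (hs : 0 ≤ s) (hV : 0 ≤ V)
    (h : s * Real.exp (r / (2 * M)) * Real.exp (t / (2 * M)) = V ^ 2) :
    Real.sqrt s * Real.exp ((r + t) / (4 * M)) = V := by
  rw [← sq_eq_sq₀ (by positivity) hV, ← h, mul_pow, Real.sq_sqrt hs, ← Real.exp_nat_mul,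
    mul_assoc, ← Real.exp_add]
  congr 2
  field_simp
  push_cast
  ring

namespace Profile
variable {M H c : ℝ} (p : Profile M H c)

/-- The Schwarzschild time along the profile curve. -/
noncomputable def time (v : ℝ) : ℝ := 2 * M * Real.log (p.V v / p.U v)

lemma radial_ne_zero {r : ℝ} (hr : r ≠ 2 * M) : radial M r ≠ 0 :=
  mul_ne_zero (sub_ne_zero.2 hr) (Real.exp_ne_zero _)

lemma U_ne_zero (hM : 0 < M) {v : ℝ} (hv : p.ρ v ≠ 2 * M) : p.U v ≠ 0 := by
  have := p.U_mul_V hM v ▸ radial_ne_zero hv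
  exact left_ne_zero_of_mul this

lemma V_ne_zero (hM : 0 < M) {v : ℝ} (hv : p.ρ v ≠ 2 * M) : p.V v ≠ 0 := by
  have := p.U_mul_V hM v ▸ radial_ne_zero hv
  exact right_ne_zero_of_mul this

lemma h_ne_zero {r : ℝ} (hr0 : 0 < r) (hr : r ≠ 2 * M) : h M r ≠ 0 := by
  intro h0
  rw [h, sub_eq_zero, eq_div_iff hr0.ne', one_mul] at h0
  exact hr h0

/-- V'/V - U'/U = (l/4M)(1/(w - P) - 1/(w + P)) = lP/(2Mh). As `Real.log` only sees the absolute
value, one formula serves the regions I, II and I'. -/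
lemma hasDerivAt_time (hM : 0 < M) {v : ℝ} (hv : p.ρ v ≠ 2 * M) :
    HasDerivAt p.time (p.l v * (rate H c (p.ρ v) / h M (p.ρ v))) v := by
  have hU := p.U_ne_zero hM hv
  have hV := p.V_ne_zero hM hv
  have h1 := (((p.hasDerivAt_V hM v).div (p.hasDerivAt_U hM v) hU).log
    (div_ne_zero hV hU)).const_mul (2 * M)
  refine h1.congr_deriv ?_
  have hα := p.α_pos v
  have hβ := p.β_pos hM v
  have hh := h_ne_zero (p.ρ_pos v) hv
  have hw := p.w_sq v
  simp only [U, V] at hU hV ⊢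
  have h2 : p.w v + rate H c (p.ρ v) ≠ 0 := right_ne_zero_of_mul hU
  have h3 : p.w v - rate H c (p.ρ v) ≠ 0 := right_ne_zero_of_mul hV
  have h4 : h M (p.ρ v) = (p.w v + rate H c (p.ρ v)) * (p.w v - rate H c (p.ρ v)) := by
    linear_combination -hw
  rw [h4]
  simp only [Pi.div_apply, U, V]
  field_simp
  ring

lemma time_eq_of_ratio (hM : 0 < M) {v x : ℝ} (hx : 0 < x)
    (h : p.V v / p.U v = x ∨ p.V v / p.U v = -x) :
    Real.exp (p.time v / (2 * M)) = x ∧ Real.exp (-p.time v / (2 * M)) = x⁻¹ := by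
  have : p.time v / (2 * M) = Real.log x := by
    rw [time, mul_div_cancel_left₀ _ (by positivity)]
    rcases h with h | h <;> simp [h]
  rw [neg_div, this, Real.exp_neg, Real.exp_log hx]
  exact ⟨rfl, rfl⟩

lemma toI_time (hM : 0 < M) {v : ℝ} (hU : 0 < p.U v) (hV : 0 < p.V v) :
    toI M (p.time v) (p.ρ v) = p.curve v := by
  have hUV := p.U_mul_V hM v
  obtain ⟨h1, h2⟩ := p.time_eq_of_ratio hM (div_pos hV hU) (Or.inl rfl)
  have hs : 0 ≤ p.ρ v - 2 * M :=
    (pos_of_mul_pos_left (hUV ▸ mul_pos hU hV) (Real.exp_pos _).le).le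
  have hrad : (p.ρ v - 2 * M) * Real.exp (p.ρ v / (2 * M)) = p.U v * p.V v := hUV.symm
  have e1 : Real.sqrt (p.ρ v - 2 * M) * Real.exp ((p.ρ v + p.time v) / (4 * M)) = p.V v := by
    refine sqrt_mul_exp hM hs hV.le ?_
    rw [h1, hrad]; field_simp
  have e2 : Real.sqrt (p.ρ v - 2 * M) * Real.exp ((p.ρ v - p.time v) / (4 * M)) = p.U v := by
    rw [sub_eq_add_neg (p.ρ v) (p.time v)]
    refine sqrt_mul_exp hM hs hU.le ?_
    rw [h2, hrad]; field_simp
  rw [toI, mul_add, mul_sub, e1, e2]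
  rfl

lemma toII_time (hM : 0 < M) {v : ℝ} (hU : p.U v < 0) (hV : 0 < p.V v) :
    toII M (p.time v) (p.ρ v) = p.curve v := by
  have hUV := p.U_mul_V hM v
  obtain ⟨h1, h2⟩ := p.time_eq_of_ratio hM (div_pos hV (neg_pos.2 hU))
    (Or.inr (by rw [div_neg, neg_neg]))
  have hs : 0 ≤ 2 * M - p.ρ v := by
    have : radial M (p.ρ v) < 0 := hUV ▸ mul_neg_of_neg_of_pos hU hV
    have := neg_of_mul_neg_left this (Real.exp_pos _).le
    linarith
  have hrad : (2 * M - p.ρ v) * Real.exp (p.ρ v / (2 * M)) = -p.U v * p.V v := by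
    rw [neg_mul, hUV, radial]; ring
  have hU' := (neg_pos.2 hU).ne'
  have e1 : Real.sqrt (2 * M - p.ρ v) * Real.exp ((p.ρ v + p.time v) / (4 * M)) = p.V v := by
    refine sqrt_mul_exp hM hs hV.le ?_
    rw [h1, hrad]; field_simp [hU.ne]
  have e2 : Real.sqrt (2 * M - p.ρ v) * Real.exp ((p.ρ v - p.time v) / (4 * M)) = -p.U v := by
    rw [sub_eq_add_neg (p.ρ v) (p.time v)]
    refine sqrt_mul_exp hM hs (neg_pos.2 hU).le ?_
    rw [h2, hrad]; field_simp [hU.ne]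
  rw [toII, mul_add, mul_sub, e1, e2, sub_neg_eq_add, ← sub_eq_add_neg]
  rfl

lemma toI'_time (hM : 0 < M) {v : ℝ} (hU : p.U v < 0) (hV : p.V v < 0) :
    toI' M (p.time v) (p.ρ v) = p.curve v := by
  have hUV := p.U_mul_V hM v
  obtain ⟨h1, h2⟩ := p.time_eq_of_ratio hM (div_pos_of_neg_of_neg hV hU) (Or.inl rfl)
  have hs : 0 ≤ p.ρ v - 2 * M :=
    (pos_of_mul_pos_left (hUV ▸ mul_pos_of_neg_of_neg hU hV) (Real.exp_pos _).le).le
  have hrad : (p.ρ v - 2 * M) * Real.exp (p.ρ v / (2 * M)) = p.U v * p.V v := hUV.symm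
  have e1 : Real.sqrt (p.ρ v - 2 * M) * Real.exp ((p.ρ v + p.time v) / (4 * M)) = -p.V v := by
    refine sqrt_mul_exp hM hs (neg_pos.2 hV).le ?_
    rw [h1, hrad]; field_simp [hU.ne]
  have e2 : Real.sqrt (p.ρ v - 2 * M) * Real.exp ((p.ρ v - p.time v) / (4 * M)) = -p.U v := by
    rw [sub_eq_add_neg (p.ρ v) (p.time v)]
    refine sqrt_mul_exp hM hs (neg_pos.2 hU).le ?_
    rw [h2, hrad]; field_simp [hV.ne]
  rw [toI', mul_add, mul_sub, e1, e2]
  simp only [curve, X, T]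
  ext <;> simp <;> ring

lemma V_pos_iff (hM : 0 < M) (v : ℝ) : 0 < p.V v ↔ rate H c (p.ρ v) < p.w v := by
  have := p.α_pos v
  rw [V, mul_pos_iff_of_pos_left (by positivity), sub_pos]

lemma U_pos_iff (hM : 0 < M) (v : ℝ) : 0 < p.U v ↔ -rate H c (p.ρ v) < p.w v := by
  have := p.β_pos hM v
  rw [U, mul_pos_iff_of_pos_left (by positivity), ← neg_lt_iff_pos_add]

/-- The signs of V and U are those of w - P and w + P. Outside r = 2M one has w² - P² = h > 0, so w
dominates and its sign separates I from I'; inside, P dominates, and P < 0 selects region II. -/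
lemma sign_I (hM : 0 < M) {v : ℝ} (hr : 2 * M < p.ρ v) (hw : 0 < p.w v) :
    0 < p.U v ∧ 0 < p.V v := by
  have h1 := p.w_sq v
  have h2 := h_pos hM hr
  have h3 := abs_lt_of_sq_lt_sq (a := rate H c (p.ρ v)) (by nlinarith) hw.le
  rw [abs_lt] at h3
  rw [p.V_pos_iff hM, p.U_pos_iff hM]
  exact ⟨by linarith, h3.2⟩

lemma sign_I' (hM : 0 < M) {v : ℝ} (hr : 2 * M < p.ρ v) (hw : p.w v < 0) :
    p.U v < 0 ∧ p.V v < 0 := by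
  have h1 := p.w_sq v
  have h2 := h_pos hM hr
  have h3 := abs_lt_of_sq_lt_sq (a := rate H c (p.ρ v)) (b := -p.w v) (by nlinarith)
    (by linarith)
  rw [abs_lt] at h3
  have hU := p.U_ne_zero hM hr.ne'
  have hV := p.V_ne_zero hM hr.ne'
  refine ⟨lt_of_le_of_ne (not_lt.1 ?_) hU, lt_of_le_of_ne (not_lt.1 ?_) hV⟩
  · rw [p.U_pos_iff hM]; linarith
  · rw [p.V_pos_iff hM]; linarith

lemma sign_II (hM : 0 < M) {v : ℝ} (hr : p.ρ v < 2 * M) (hP : rate H c (p.ρ v) < 0) :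
    p.U v < 0 ∧ 0 < p.V v := by
  have h1 := p.w_sq v
  have h2 := h_neg (p.ρ_pos v) hr
  have h3 := abs_lt_of_sq_lt_sq (a := p.w v) (b := -rate H c (p.ρ v)) (by nlinarith)
    (by linarith)
  rw [abs_lt] at h3
  refine ⟨lt_of_le_of_ne (not_lt.1 ?_) (p.U_ne_zero hM hr.ne), ?_⟩
  · rw [p.U_pos_iff hM]; linarith
  · rw [p.V_pos_iff hM]; linarith

/-! ### Height functions as time differences along the profile curve -/

/-- Substitution of the parameter of the profile curve in the integrals that define the height
functions. -/
lemma integral_image (hM : 0 < M) {a b s : ℝ} {φ : ℝ → ℝ} (hab : a ≤ b)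
    (hinj : InjOn p.ρ (Ioo a b)) (hne : ∀ v ∈ Icc a b, p.ρ v ≠ 2 * M)
    (hφ : ∀ v ∈ Ioo a b, φ (p.ρ v) * |p.w v| = s * (rate H c (p.ρ v) / h M (p.ρ v))) :
    MeasureTheory.IntegrableOn φ (p.ρ '' Ioo a b) ∧
      ∫ x in p.ρ '' Ioo a b, φ x = s * (p.time b - p.time a) := by
  have hd : ∀ v ∈ Ioo a b, HasDerivWithinAt p.ρ (p.l v * p.w v) (Ioo a b) v :=
    fun v _ => (p.hasDerivAt_ρ v).hasDerivWithinAt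
  -- In the curve parameter the integrand is continuous up to the end points even if w vanishes
  -- there. So integrability at the throat, where the slope is unbounded in r, needs no separate
  -- estimate.
  have hcont : ContinuousOn (fun v => p.l v * (rate H c (p.ρ v) / h M (p.ρ v))) (Icc a b) := by
    have h1 : Continuous fun v => h M (p.ρ v) := by
      unfold h
      exact continuous_const.sub (continuous_const.div p.contDiff_ρ.continuous
        fun v => (p.ρ_pos v).ne')
    exact p.contDiff_l.continuous.continuousOn.mul (p.contDiff_rate.continuous.continuousOn.div
      h1.continuousOn fun v hv => h_ne_zero (p.ρ_pos v) (hne v hv))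
  have hii : IntervalIntegrable (fun v => p.l v * (rate H c (p.ρ v) / h M (p.ρ v)))
      MeasureTheory.volume a b := by
    apply ContinuousOn.intervalIntegrable
    rwa [uIcc_of_le hab]
  have hftc := intervalIntegral.integral_eq_sub_of_hasDerivAt
    (fun v hv => p.hasDerivAt_time hM (hne v (by rwa [uIcc_of_le hab] at hv))) hii
  have heq : ∀ v ∈ Ioo a b, |p.l v * p.w v| • φ (p.ρ v) =
      s * (p.l v * (rate H c (p.ρ v) / h M (p.ρ v))) := by
    intro v hv
    rw [abs_mul, abs_of_pos (p.l_pos v), smul_eq_mul]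
    linear_combination p.l v * hφ v hv
  constructor
  · rw [MeasureTheory.integrableOn_image_iff_integrableOn_abs_deriv_smul measurableSet_Ioo hd hinj]
    rw [MeasureTheory.integrableOn_congr_fun heq measurableSet_Ioo]
    exact ((intervalIntegrable_iff_integrableOn_Ioo_of_le hab).1 hii).const_mul s
  · rw [MeasureTheory.integral_image_eq_integral_abs_deriv_smul measurableSet_Ioo hd hinj,
      MeasureTheory.setIntegral_congr_fun measurableSet_Ioo heq,
      MeasureTheory.integral_const_mul, ← MeasureTheory.integral_Ioc_eq_integral_Ioo,
      ← intervalIntegral.integral_of_le hab, hftc]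

lemma integral_increasing_of_le (hM : 0 < M) {a b s : ℝ} {φ : ℝ → ℝ} (hab : a ≤ b)
    (hne : ∀ v ∈ Icc a b, p.ρ v ≠ 2 * M) (hw : ∀ v ∈ Ioo a b, 0 < p.w v)
    (hφ : ∀ v ∈ Ioo a b, φ (p.ρ v) * |p.w v| = s * (rate H c (p.ρ v) / h M (p.ρ v))) :
    IntervalIntegrable φ MeasureTheory.volume (p.ρ a) (p.ρ b) ∧
      ∫ x in p.ρ a..p.ρ b, φ x = s * (p.time b - p.time a) := by
  have hmono : StrictMonoOn p.ρ (Icc a b) := by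
    refine strictMonoOn_of_deriv_pos (convex_Icc a b) p.contDiff_ρ.continuous.continuousOn ?_
    intro v hv
    rw [interior_Icc] at hv
    rw [(p.hasDerivAt_ρ v).deriv]
    exact mul_pos (p.l_pos v) (hw v hv)
  have himg : p.ρ '' Ioo a b = Ioo (p.ρ a) (p.ρ b) := by
    refine Subset.antisymm ?_ (intermediate_value_Ioo hab p.contDiff_ρ.continuous.continuousOn)
    rintro _ ⟨v, hv, rfl⟩
    exact ⟨hmono (left_mem_Icc.2 hab) (Ioo_subset_Icc_self hv) hv.1,
      hmono (Ioo_subset_Icc_self hv) (right_mem_Icc.2 hab) hv.2⟩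
  have hle : p.ρ a ≤ p.ρ b := hmono.monotoneOn (left_mem_Icc.2 hab) (right_mem_Icc.2 hab) hab
  have := p.integral_image hM hab (hmono.injOn.mono Ioo_subset_Icc_self) hne hφ
  rw [himg] at this
  rwa [intervalIntegrable_iff_integrableOn_Ioo_of_le hle, intervalIntegral.integral_of_le hle,
    MeasureTheory.integral_Ioc_eq_integral_Ioo]

lemma integral_decreasing_of_le (hM : 0 < M) {a b s : ℝ} {φ : ℝ → ℝ} (hab : a ≤ b)
    (hne : ∀ v ∈ Icc a b, p.ρ v ≠ 2 * M) (hw : ∀ v ∈ Ioo a b, p.w v < 0)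
    (hφ : ∀ v ∈ Ioo a b, φ (p.ρ v) * |p.w v| = s * (rate H c (p.ρ v) / h M (p.ρ v))) :
    IntervalIntegrable φ MeasureTheory.volume (p.ρ b) (p.ρ a) ∧
      ∫ x in p.ρ b..p.ρ a, φ x = s * (p.time b - p.time a) := by
  have hmono : StrictAntiOn p.ρ (Icc a b) := by
    refine strictAntiOn_of_deriv_neg (convex_Icc a b) p.contDiff_ρ.continuous.continuousOn ?_
    intro v hv
    rw [interior_Icc] at hv
    rw [(p.hasDerivAt_ρ v).deriv]
    exact mul_neg_of_pos_of_neg (p.l_pos v) (hw v hv)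
  have himg : p.ρ '' Ioo a b = Ioo (p.ρ b) (p.ρ a) := by
    refine Subset.antisymm ?_ (intermediate_value_Ioo' hab p.contDiff_ρ.continuous.continuousOn)
    rintro _ ⟨v, hv, rfl⟩
    exact ⟨hmono (Ioo_subset_Icc_self hv) (right_mem_Icc.2 hab) hv.2,
      hmono (left_mem_Icc.2 hab) (Ioo_subset_Icc_self hv) hv.1⟩
  have hle : p.ρ b ≤ p.ρ a := hmono.antitoneOn (left_mem_Icc.2 hab) (right_mem_Icc.2 hab) hab
  have := p.integral_image hM hab (hmono.injOn.mono Ioo_subset_Icc_self) hne hφ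
  rw [himg] at this
  rwa [intervalIntegrable_iff_integrableOn_Ioo_of_le hle, intervalIntegral.integral_of_le hle,
    MeasureTheory.integral_Ioc_eq_integral_Ioo]

lemma integral_increasing (hM : 0 < M) {a b s : ℝ} {φ : ℝ → ℝ}
    (hne : ∀ v ∈ uIcc a b, p.ρ v ≠ 2 * M) (hw : ∀ v ∈ Ioo (min a b) (max a b), 0 < p.w v)
    (hφ : ∀ v ∈ Ioo (min a b) (max a b),
      φ (p.ρ v) * |p.w v| = s * (rate H c (p.ρ v) / h M (p.ρ v))) :
    IntervalIntegrable φ MeasureTheory.volume (p.ρ a) (p.ρ b) ∧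
      ∫ x in p.ρ a..p.ρ b, φ x = s * (p.time b - p.time a) := by
  rcases le_total a b with hab | hab
  · rw [min_eq_left hab, max_eq_right hab] at *
    rw [uIcc_of_le hab] at hne
    exact p.integral_increasing_of_le hM hab hne hw hφ
  · rw [min_eq_right hab, max_eq_left hab] at *
    rw [uIcc_of_ge hab] at hne
    obtain ⟨h1, h2⟩ := p.integral_increasing_of_le hM hab hne hw hφ
    refine ⟨h1.symm, ?_⟩
    rw [intervalIntegral.integral_symm, h2]; ring

lemma integral_decreasing (hM : 0 < M) {a b s : ℝ} {φ : ℝ → ℝ}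
    (hne : ∀ v ∈ uIcc a b, p.ρ v ≠ 2 * M) (hw : ∀ v ∈ Ioo (min a b) (max a b), p.w v < 0)
    (hφ : ∀ v ∈ Ioo (min a b) (max a b),
      φ (p.ρ v) * |p.w v| = s * (rate H c (p.ρ v) / h M (p.ρ v))) :
    IntervalIntegrable φ MeasureTheory.volume (p.ρ a) (p.ρ b) ∧
      ∫ x in p.ρ a..p.ρ b, φ x = -s * (p.time b - p.time a) := by
  rcases le_total a b with hab | hab
  · rw [min_eq_left hab, max_eq_right hab] at *
    rw [uIcc_of_le hab] at hne
    obtain ⟨h1, h2⟩ := p.integral_decreasing_of_le hM hab hne hw hφ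
    refine ⟨h1.symm, ?_⟩
    rw [intervalIntegral.integral_symm, h2]; ring
  · rw [min_eq_right hab, max_eq_left hab] at *
    rw [uIcc_of_ge hab] at hne
    obtain ⟨h1, h2⟩ := p.integral_decreasing_of_le hM hab hne hw hφ
    refine ⟨h1, ?_⟩
    rw [h2]; ring

lemma image_eq_curve_image {emb : ℝ → ℝ → ℝ → ℝ × ℝ} {f : ℝ → ℝ} {J S : Set ℝ}
    (hS : p.ρ '' J = S) (hf : ∀ v ∈ J, f (p.ρ v) = p.time v)
    (hemb : ∀ v ∈ J, emb M (p.time v) (p.ρ v) = p.curve v) :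
    (fun r => emb M (f r) r) '' S = p.curve '' J := by
  rw [← hS, image_image]
  refine image_congr fun v hv => ?_
  rw [hf v hv, hemb v hv]

lemma sigma₁_eq (hM : 0 < M) {v₁ v₀ : ℝ} (hJ : p.ρ '' Ioi v₁ = Ioi (2 * M))
    (hw : ∀ v, v₁ < v → 0 < p.w v) (hv₀ : v₁ < v₀) :
    Sigma₁ M H c (p.ρ v₀) (p.time v₀) = p.curve '' Ioi v₁ := by
  have hr : ∀ v, v₁ < v → 2 * M < p.ρ v := fun v hv => by
    have : p.ρ v ∈ Ioi (2 * M) := hJ ▸ mem_image_of_mem _ hv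
    exact this
  refine p.image_eq_curve_image hJ (fun v hv => ?_) fun v hv =>
    p.toI_time hM (p.sign_I hM (hr v hv) (hw v hv)).1 (p.sign_I hM (hr v hv) (hw v hv)).2
  have hlt : v₁ < min v₀ v := lt_min hv₀ hv
  have := (p.integral_increasing hM (a := v₀) (b := v) (s := 1)
    (φ := fun x => l₁ M H c x / h M x * Real.sqrt (1 / (1 + l₁ M H c x ^ 2)))
    (fun x hx => (hr x (hlt.trans_le hx.1)).ne') (fun x hx => hw x (hlt.trans hx.1))
    fun x hx => by
      rw [one_mul]
      exact l₁_integrand (h_pos hM (hr x (hlt.trans hx.1))) (p.w_sq x)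
        (hw x (hlt.trans hx.1)).ne').2
  rw [f₁, this]
  ring

lemma sigma₃_eq (hM : 0 < M) {v₁ v₀ : ℝ} (hJ : p.ρ '' Iio v₁ = Ioi (2 * M))
    (hw : ∀ v, v < v₁ → p.w v < 0) (hv₀ : v₀ < v₁) :
    Sigma₃ M H c (p.ρ v₀) (p.time v₀) = p.curve '' Iio v₁ := by
  have hr : ∀ v, v < v₁ → 2 * M < p.ρ v := fun v hv => by
    have : p.ρ v ∈ Ioi (2 * M) := hJ ▸ mem_image_of_mem _ hv
    exact this
  refine p.image_eq_curve_image hJ (fun v hv => ?_) fun v hv =>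
    p.toI'_time hM (p.sign_I' hM (hr v hv) (hw v hv)).1 (p.sign_I' hM (hr v hv) (hw v hv)).2
  have hlt : max v₀ v < v₁ := max_lt hv₀ hv
  have := (p.integral_decreasing hM (a := v₀) (b := v) (s := -1)
    (φ := fun x => l₃ M H c x / h M x * Real.sqrt (1 / (1 + l₃ M H c x ^ 2)))
    (fun x hx => (hr x (hx.2.trans_lt hlt)).ne') (fun x hx => hw x (hx.2.trans hlt))
    fun x hx => l₃_integrand (h_pos hM (hr x (hx.2.trans hlt))) (p.w_sq x)
        (hw x (hx.2.trans hlt)).ne).2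
  rw [f₃, this]
  ring

lemma integral_slope₂_increasing (hM : 0 < M) {v₀ v : ℝ}
    (hr : ∀ x ∈ uIcc v₀ v, p.ρ x < 2 * M ∧ rate H c (p.ρ x) < 0)
    (hw : ∀ x ∈ Ioo (min v₀ v) (max v₀ v), 0 < p.w x) :
    IntervalIntegrable (slope₂ M H c) MeasureTheory.volume (p.ρ v₀) (p.ρ v) ∧
      ∫ x in p.ρ v₀..p.ρ v, slope₂ M H c x = p.time v - p.time v₀ := by
  have := p.integral_increasing hM (a := v₀) (b := v) (s := 1) (φ := slope₂ M H c)
    (fun x hx => (hr x hx).1.ne) hw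
    fun x hx => by
      have hx' := hr x (Ioo_subset_Icc_self hx)
      rw [one_mul]
      exact slope₂_mul (h_neg (p.ρ_pos x) hx'.1) (p.w_sq x) (hw x hx).ne' hx'.2
  rwa [one_mul] at this

lemma integral_slope₂_decreasing (hM : 0 < M) {v₀ v : ℝ}
    (hr : ∀ x ∈ uIcc v₀ v, p.ρ x < 2 * M ∧ rate H c (p.ρ x) < 0)
    (hw : ∀ x ∈ Ioo (min v₀ v) (max v₀ v), p.w x < 0) :
    ∫ x in p.ρ v₀..p.ρ v, slope₂ M H c x = -(p.time v - p.time v₀) := by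
  have := (p.integral_decreasing hM (a := v₀) (b := v) (s := 1) (φ := slope₂ M H c)
    (fun x hx => (hr x hx).1.ne) hw
    fun x hx => by
      have hx' := hr x (Ioo_subset_Icc_self hx)
      rw [one_mul]
      exact slope₂_mul (h_neg (p.ρ_pos x) hx'.1) (p.w_sq x) (hw x hx).ne hx'.2).2
  rwa [neg_one_mul] at this

lemma sigma₂star_eq (hM : 0 < M) {J : Set ℝ} [hJc : J.OrdConnected] {v₀ : ℝ} (hv₀ : v₀ ∈ J)
    (hJ : p.ρ '' J = domain₂ M H c (p.ρ v₀))
    (hr : ∀ v ∈ J, p.ρ v < 2 * M ∧ rate H c (p.ρ v) < 0)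
    (hw : ∀ v ∈ J, ∀ x ∈ Ioo (min v₀ v) (max v₀ v), 0 < p.w x) :
    Sigma₂star M H c (p.ρ v₀) (p.time v₀) = p.curve '' J := by
  refine p.image_eq_curve_image hJ (fun v hv => ?_) fun v hv =>
    p.toII_time hM (p.sign_II hM (hr v hv).1 (hr v hv).2).1
      (p.sign_II hM (hr v hv).1 (hr v hv).2).2
  rw [f₂star, (p.integral_slope₂_increasing hM
    (fun x hx => hr x (hJc.uIcc_subset hv₀ hv hx)) (hw v hv)).2]
  ring

lemma sigma₂starstar_eq (hM : 0 < M) {J : Set ℝ} [hJc : J.OrdConnected] {v₀ : ℝ} (hv₀ : v₀ ∈ J)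
    (hJ : p.ρ '' J = domain₂ M H c (p.ρ v₀))
    (hr : ∀ v ∈ J, p.ρ v < 2 * M ∧ rate H c (p.ρ v) < 0)
    (hw : ∀ v ∈ J, ∀ x ∈ Ioo (min v₀ v) (max v₀ v), p.w x < 0) :
    Sigma₂starstar M H c (p.ρ v₀) (p.time v₀) = p.curve '' J := by
  refine p.image_eq_curve_image hJ (fun v hv => ?_) fun v hv =>
    p.toII_time hM (p.sign_II hM (hr v hv).1 (hr v hv).2).1
      (p.sign_II hM (hr v hv).1 (hr v hv).2).2
  rw [f₂starstar, intervalIntegral.integral_neg, p.integral_slope₂_decreasing hM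
    (fun x hx => hr x (hJc.uIcc_subset hv₀ hv hx)) (hw v hv)]
  ring

lemma curve_mem_Lplus (hM : 0 < M) {v : ℝ} (hr : p.ρ v = 2 * M)
    (hP : rate H c (p.ρ v) < 0) (hw : 0 < p.w v) : p.curve v ∈ Lplus := by
  have hV := (p.V_pos_iff hM v).2 (hP.trans hw)
  have hU : p.U v = 0 := by
    have := p.U_mul_V hM v
    rw [hr, radial, sub_self, zero_mul] at this
    exact (mul_eq_zero.1 this).resolve_right hV.ne'
  simp only [Lplus, mem_ofPred_eq, curve, X, T, hU, add_zero, sub_zero, and_true]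
  positivity

lemma curve_mem_Lminus (hM : 0 < M) {v : ℝ} (hr : p.ρ v = 2 * M)
    (hP : rate H c (p.ρ v) < 0) (hw : p.w v < 0) : p.curve v ∈ Lminus := by
  have hβ := p.β_pos hM v
  have hU : p.U v < 0 := mul_neg_of_pos_of_neg (by positivity) (by linarith)
  have hV : p.V v = 0 := by
    have := p.U_mul_V hM v
    rw [hr, radial, sub_self, zero_mul] at this
    exact (mul_eq_zero.1 this).resolve_left hU.ne
  simp only [Lminus, mem_ofPred_eq, curve, X, T, hV, zero_add, zero_sub]
  exact ⟨by linarith, by ring⟩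

end Profile

/-! ### Construction of profile curves from the radial equation -/

/-- Existence of a profile curve with a prescribed Schwarzschild time at one point. -/
lemma exists_profile {M H c : ℝ} (hM : 0 < M) {ρ w l : ℝ → ℝ} (hρ : ContDiff ℝ ∞ ρ)
    (hw : ContDiff ℝ ∞ w) (hl : ContDiff ℝ ∞ l) (hρ0 : ∀ v, 0 < ρ v) (hl0 : ∀ v, 0 < l v)
    (hsq : ∀ v, w v ^ 2 = h M (ρ v) + rate H c (ρ v) ^ 2)
    (hdρ : ∀ v, HasDerivAt ρ (l v * w v) v)
    (hdw : ∀ v, HasDerivAt w (l v * (M / ρ v ^ 2 + rate H c (ρ v) * rateDeriv H c (ρ v))) v)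
    {v₀ : ℝ} (hv₀ : ρ v₀ ≠ 2 * M) (t : ℝ) :
    ∃ p : Profile M H c, p.ρ = ρ ∧ p.w = w ∧ p.l = l ∧ p.time v₀ = t := by
  have hrate : ContDiff ℝ ∞ fun v => rate H c (ρ v) :=
    (contDiff_const.mul hρ).add (contDiff_const.div (hρ.pow 2) fun v => pow_ne_zero 2 (hρ0 v).ne')
  have hrate' : ContDiff ℝ ∞ fun v => rateDeriv H c (ρ v) :=
    contDiff_const.sub (contDiff_const.div (hρ.pow 3) fun v => pow_ne_zero 3 (hρ0 v).ne')
  have hg : ContDiff ℝ ∞ fun v => l v * (rateDeriv H c (ρ v) +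
      (1 / (2 * M) + 1 / ρ v) * (w v + rate H c (ρ v)) / 2) :=
    hl.mul (hrate'.add (((contDiff_const.add (contDiff_const.div hρ fun v => (hρ0 v).ne')).mul
      (hw.add hrate)).div_const 2))
  obtain ⟨hd, hs⟩ := contDiff_primitive hg
  set A := fun v => ∫ x in (0 : ℝ)..v, l x * (rateDeriv H c (ρ x) +
      (1 / (2 * M) + 1 / ρ x) * (w x + rate H c (ρ x)) / 2) with hA
  have key : ∀ k : ℝ, 0 < k → ∃ p : Profile M H c, p.ρ = ρ ∧ p.w = w ∧ p.l = l ∧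
      ∀ v, p.α v = k * Real.exp (A v) := by
    intro k hk
    refine ⟨⟨ρ, w, l, fun v => k * Real.exp (A v), hρ, hw, hl, contDiff_const.mul hs.exp, hρ0, hl0,
      fun v => by positivity, hsq, hdρ, hdw, fun v => ?_⟩, rfl, rfl, rfl, fun v => rfl⟩
    refine ((hd v).exp.const_mul k).congr_deriv ?_
    ring
  obtain ⟨p₁, h1, h2, h3, h4⟩ := key 1 one_pos
  -- Multiplying α by k multiplies V by k and divides U by k, so the time grows by 2M log k² = 4M
  -- log k. This dictates the factor.
  obtain ⟨p₂, h1', h2', h3', h4'⟩ := key (Real.exp ((t - p₁.time v₀) / (4 * M))) (Real.exp_pos _)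
  refine ⟨p₂, h1', h2', h3', ?_⟩
  have hα : p₂.α v₀ = Real.exp ((t - p₁.time v₀) / (4 * M)) * p₁.α v₀ := by rw [h4, h4', one_mul]
  have hne : p₁.V v₀ / p₁.U v₀ ≠ 0 :=
    div_ne_zero (p₁.V_ne_zero hM (by rwa [h1])) (p₁.U_ne_zero hM (by rwa [h1]))
  have hratio : p₂.V v₀ / p₂.U v₀ =
      Real.exp ((t - p₁.time v₀) / (4 * M)) ^ 2 * (p₁.V v₀ / p₁.U v₀) := by
    simp only [Profile.V, Profile.U, Profile.β, hα, h1, h1', h2, h2']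
    have := Real.exp_pos ((t - p₁.time v₀) / (4 * M))
    generalize Real.exp ((t - p₁.time v₀) / (4 * M)) = k at *
    have := p₁.α_pos v₀
    have := hρ0 v₀
    field_simp
  rw [Profile.time, hratio, Real.log_mul (by positivity) hne, Real.log_pow, Real.log_exp, mul_add,
    ← Profile.time]
  field_simp
  push_cast
  ring

/-! ### The function `k` -/

lemma continuous_k (M H : ℝ) : Continuous (k M H) := by
  unfold k; fun_prop

lemma k_two_mul (M H : ℝ) : k M H (2 * M) = -8 * M ^ 3 * H := by
  simp only [k, sub_self, mul_zero, Real.sqrt_zero]; ring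

lemma cube_mul_pos {M r : ℝ} (hr : r ∈ Ioo 0 (2 * M)) : 0 < r ^ 3 * (2 * M - r) :=
  mul_pos (pow_pos hr.1 3) (sub_pos.2 hr.2)

lemma hasDerivAt_sqrt_cube {M r : ℝ} (hr : r ∈ Ioo 0 (2 * M)) :
    HasDerivAt (fun r : ℝ => Real.sqrt (r ^ 3 * (2 * M - r)))
      (r ^ 2 * (3 * M - 2 * r) / Real.sqrt (r ^ 3 * (2 * M - r))) r := by
  have h1 : HasDerivAt (fun r : ℝ => r ^ 3 * (2 * M - r)) _ r :=
    (hasDerivAt_pow 3 r).mul ((hasDerivAt_id r).const_sub (2 * M))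
  refine (h1.sqrt (cube_mul_pos hr).ne').congr_deriv ?_
  have := Real.sqrt_pos.2 (cube_mul_pos hr)
  field_simp
  ring

lemma hasDerivAt_k {M H r : ℝ} (hr : r ∈ Ioo 0 (2 * M)) :
    HasDerivAt (k M H) (r ^ 2 / Real.sqrt (r ^ 3 * (2 * M - r)) *
      (2 * r - 3 * M - 3 * H * Real.sqrt (r ^ 3 * (2 * M - r)))) r := by
  refine (((hasDerivAt_pow 3 r).const_mul (-H)).sub (hasDerivAt_sqrt_cube hr)).congr_deriv ?_
  have := Real.sqrt_pos.2 (cube_mul_pos hr)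
  generalize Real.sqrt (r ^ 3 * (2 * M - r)) = s at *
  field_simp
  ring

/-- The derivative of the root has the sign opposite to 2r - 3M, so both terms of the quotient rule
contribute nonnegatively. As k' has the sign of this quotient minus 3H, it changes sign exactly
once. -/
lemma strictMonoOn_slope {M : ℝ} :
    StrictMonoOn (fun r : ℝ => (2 * r - 3 * M) / Real.sqrt (r ^ 3 * (2 * M - r)))
      (Ioo 0 (2 * M)) := by
  have hd : ∀ r ∈ Ioo 0 (2 * M), HasDerivAt
      (fun r : ℝ => (2 * r - 3 * M) / Real.sqrt (r ^ 3 * (2 * M - r))) _ r := fun r hr =>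
    (((hasDerivAt_id r).const_mul 2).sub_const (3 * M)).div (hasDerivAt_sqrt_cube hr)
      (Real.sqrt_pos.2 (cube_mul_pos hr)).ne'
  refine strictMonoOn_of_deriv_pos (convex_Ioo 0 (2 * M))
    (fun r hr => (hd r hr).continuousAt.continuousWithinAt) fun r hr => ?_
  rw [interior_Ioo] at hr
  rw [(hd r hr).deriv]
  have hs := Real.sqrt_pos.2 (cube_mul_pos hr)
  have hr0 := hr.1
  refine div_pos ?_ (by positivity)
  have h1 : (2 * id r - 3 * M) * (r ^ 2 * (3 * M - 2 * r) / Real.sqrt (r ^ 3 * (2 * M - r))) =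
      -(r ^ 2 * (2 * r - 3 * M) ^ 2 / Real.sqrt (r ^ 3 * (2 * M - r))) := by
    simp only [id]; ring
  rw [h1, sub_neg_eq_add, mul_one]
  positivity

/-- The minimum point of `k`. -/
lemma exists_minimum_k {M : ℝ} (hM : 0 < M) (H : ℝ) :
    ∃ rH ∈ Ioo 0 (2 * M), 3 * H * Real.sqrt (rH ^ 3 * (2 * M - rH)) = 2 * rH - 3 * M ∧
      StrictAntiOn (k M H) (Icc 0 rH) ∧ StrictMonoOn (k M H) (Icc rH (2 * M)) ∧
      ∀ r ∈ Ioo rH (2 * M), 0 < 2 * r - 3 * M - 3 * H * Real.sqrt (r ^ 3 * (2 * M - r)) := by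
  have hcont : Continuous fun r : ℝ => 2 * r - 3 * M - 3 * H * Real.sqrt (r ^ 3 * (2 * M - r)) := by
    fun_prop
  -- The boundary values are -3M at 0 and M at 2M.
  obtain ⟨rH, hrH, h0⟩ := intermediate_value_Ioo (by linarith : (0 : ℝ) ≤ 2 * M)
    hcont.continuousOn (show (0 : ℝ) ∈ Ioo _ _ by
      simp only [sub_self, mul_zero, Real.sqrt_zero]
      norm_num
      constructor <;> linarith)
  have hsH := Real.sqrt_pos.2 (cube_mul_pos hrH)
  have hH : 3 * H = (2 * rH - 3 * M) / Real.sqrt (rH ^ 3 * (2 * M - rH)) := by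
    rw [eq_div_iff hsH.ne']; linarith
  have hpos : ∀ r ∈ Ioo rH (2 * M),
      0 < 2 * r - 3 * M - 3 * H * Real.sqrt (r ^ 3 * (2 * M - r)) := by
    intro r hr
    have hr' : r ∈ Ioo 0 (2 * M) := ⟨hrH.1.trans hr.1, hr.2⟩
    have := strictMonoOn_slope hrH hr' hr.1
    simp only at this
    rw [← hH, lt_div_iff₀ (Real.sqrt_pos.2 (cube_mul_pos hr'))] at this
    linarith
  have hneg : ∀ r ∈ Ioo 0 rH,
      2 * r - 3 * M - 3 * H * Real.sqrt (r ^ 3 * (2 * M - r)) < 0 := by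
    intro r hr
    have hr' : r ∈ Ioo 0 (2 * M) := ⟨hr.1, hr.2.trans hrH.2⟩
    have := strictMonoOn_slope hr' hrH hr.2
    simp only at this
    rw [← hH, div_lt_iff₀ (Real.sqrt_pos.2 (cube_mul_pos hr'))] at this
    linarith
  refine ⟨rH, hrH, by linarith, ?_, ?_, hpos⟩
  · refine strictAntiOn_of_deriv_neg (convex_Icc _ _) (continuous_k M H).continuousOn ?_
    intro r hr
    rw [interior_Icc] at hr
    have hr' : r ∈ Ioo 0 (2 * M) := ⟨hr.1, hr.2.trans hrH.2⟩
    rw [(hasDerivAt_k hr').deriv]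
    exact mul_neg_of_pos_of_neg
      (div_pos (pow_pos hr.1 2) (Real.sqrt_pos.2 (cube_mul_pos hr'))) (hneg r hr)
  · refine strictMonoOn_of_deriv_pos (convex_Icc _ _) (continuous_k M H).continuousOn ?_
    intro r hr
    rw [interior_Icc] at hr
    have hr' : r ∈ Ioo 0 (2 * M) := ⟨hrH.1.trans hr.1, hr.2⟩
    rw [(hasDerivAt_k hr').deriv]
    exact mul_pos
      (div_pos (pow_pos hr'.1 2) (Real.sqrt_pos.2 (cube_mul_pos hr'))) (hpos r hr)

/-! ### The square of the derivative of the area radius with respect to the arc length -/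

/-- The square of the derivative of the area radius with respect to the arc length. -/
noncomputable def energy (M H c r : ℝ) : ℝ := h M r + rate H c r ^ 2

lemma energy_mul {M H c r : ℝ} (hr : r ≠ 0) :
    energy M H c r * r ^ 4 =
      H ^ 2 * r ^ 6 + r ^ 4 + (2 * H * c - 2 * M) * r ^ 3 + c ^ 2 := by
  simp only [energy, h, rate]
  field_simp
  ring

/-- A difference of squares: r⁴E = (Hr³ + c)² - r³(2M - r). -/
lemma energy_mul_eq {M H c r : ℝ} (hr : r ∈ Ioc 0 (2 * M)) :
    energy M H c r * r ^ 4 =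
      (k M H r - c) * (-H * r ^ 3 - c + Real.sqrt (r ^ 3 * (2 * M - r))) := by
  have hs := Real.sq_sqrt (mul_nonneg (pow_pos hr.1 3).le (sub_nonneg.2 hr.2))
  rw [energy_mul hr.1.ne', k]
  linear_combination hs

/-- If c < k both factors of r⁴E are positive. Conversely P < 0 makes the second factor positive,
which excludes the branch where both are negative. -/
lemma lt_k_iff {M H c r : ℝ} (hr : r ∈ Ioo 0 (2 * M)) :
    c < k M H r ↔ rate H c r < 0 ∧ 0 < energy M H c r := by
  have hr0 := hr.1
  have hs0 := Real.sqrt_pos.2 (cube_mul_pos hr)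
  have hrate : rate H c r * r ^ 2 = H * r ^ 3 + c := by
    rw [rate]; field_simp
  have hE := energy_mul_eq (H := H) (c := c) (Ioo_subset_Ioc_self hr)
  have hr2 : 0 < r ^ 2 := by positivity
  have hr4 : 0 < r ^ 4 := by positivity
  have hk : k M H r = -H * r ^ 3 - Real.sqrt (r ^ 3 * (2 * M - r)) := rfl
  constructor
  · intro h1
    constructor
    · by_contra hcon
      have := mul_nonneg (not_lt.1 hcon) hr2.le
      linarith
    · refine pos_of_mul_pos_left ?_ hr4.le
      rw [hE]
      exact mul_pos (by linarith) (by linarith)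
  · rintro ⟨h1, h2⟩
    have h3 : H * r ^ 3 + c < 0 := hrate ▸ mul_neg_of_neg_of_pos h1 hr2
    have h4 := mul_pos h2 hr4
    rw [hE] at h4
    have := pos_of_mul_pos_left h4 (by linarith)
    linarith

lemma one_lt_l₂_iff_lt_k {M H c r : ℝ} (hr : r ∈ Ioo 0 (2 * M)) :
    1 < l₂ M H c r ↔ c < k M H r := by
  rw [one_lt_l₂_iff (h_neg hr.1 hr.2), lt_k_iff hr, energy]

lemma rate_two_mul_neg {M H c : ℝ} (hM : 0 < M) (hc : c < -8 * M ^ 3 * H) :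
    rate H c (2 * M) < 0 := by
  have : rate H c (2 * M) * (2 * M) ^ 2 = 8 * M ^ 3 * H + c := by
    rw [rate]; field_simp; ring
  by_contra hcon
  have := mul_nonneg (not_lt.1 hcon) (sq_nonneg (2 * M))
  linarith

lemma energy_pos_of_ge {M H c r : ℝ} (hM : 0 < M) (hc : c < -8 * M ^ 3 * H) (hr : 2 * M ≤ r) :
    0 < energy M H c r := by
  rcases hr.eq_or_lt with rfl | hr
  · have h1 := rate_two_mul_neg hM hc
    have h2 : h M (2 * M) = 0 := by rw [h, div_self (by positivity), sub_self]
    rw [energy, h2, zero_add]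
    exact sq_pos_of_neg h1
  · exact add_pos_of_pos_of_nonneg (h_pos hM hr) (sq_nonneg _)

lemma rate_neg_of_lt_k {M H c a : ℝ} (hM : 0 < M) (hc : c < -8 * M ^ 3 * H) (ha : 0 ≤ a)
    (hk : ∀ r ∈ Ioo a (2 * M), c < k M H r) {r : ℝ} (hr : r ∈ Ioc a (2 * M)) :
    rate H c r < 0 := by
  rcases hr.2.eq_or_lt with rfl | h2
  · exact rate_two_mul_neg hM hc
  · exact ((lt_k_iff ⟨ha.trans_lt hr.1, h2⟩).1 (hk r ⟨hr.1, h2⟩)).1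

lemma energy_pos_of_lt_k {M H c a : ℝ} (hM : 0 < M) (hc : c < -8 * M ^ 3 * H) (ha : 0 ≤ a)
    (hk : ∀ r ∈ Ioo a (2 * M), c < k M H r) {r : ℝ} (hr : a < r) : 0 < energy M H c r := by
  rcases lt_or_ge r (2 * M) with h | h
  · exact ((lt_k_iff ⟨ha.trans_lt hr, h⟩).1 (hk r ⟨hr, h⟩)).2
  · exact energy_pos_of_ge hM hc h

lemma hasDerivAt_energy {M H c r : ℝ} (hr : r ≠ 0) :
    HasDerivAt (energy M H c) (2 * (M / r ^ 2 + rate H c r * rateDeriv H c r)) r := by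
  have h1 : HasDerivAt (h M) (2 * M / r ^ 2) r := by
    unfold h
    refine (((hasDerivAt_const r (2 * M)).div (hasDerivAt_id r) hr).const_sub 1).congr_deriv ?_
    simp only [id]; field_simp; ring
  refine (h1.add ((hasDerivAt_rate H c hr).pow 2)).congr_deriv ?_
  push_cast
  ring

lemma contDiffAt_energy {M H c r : ℝ} (hr : r ≠ 0) : ContDiffAt ℝ ∞ (energy M H c) r := by
  unfold energy h rate
  have h2 : r ^ 2 ≠ 0 := pow_ne_zero 2 hr
  fun_prop (disch := assumption)

/-! ### Profile curves -/

/-- The profile curve that is parametrized by `log (r - a)`. -/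
lemma exists_profile_exp {M H c a : ℝ} (hM : 0 < M) (ha : 0 ≤ a)
    (hE : ∀ r, a < r → 0 < energy M H c r) {v₀ : ℝ} (hv₀ : a + Real.exp v₀ ≠ 2 * M) (t : ℝ) :
    ∃ p : Profile M H c, p.ρ = (fun v => a + Real.exp v) ∧
      p.w = (fun v => Real.sqrt (energy M H c (a + Real.exp v))) ∧
      p.l = (fun v => Real.exp v / Real.sqrt (energy M H c (a + Real.exp v))) ∧
      p.time v₀ = t := by
  have hlt : ∀ v, a < a + Real.exp v := fun v => lt_add_of_pos_right a (Real.exp_pos v)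
  have hρ0 : ∀ v, 0 < a + Real.exp v := fun v => ha.trans_lt (hlt v)
  have hEv : ∀ v, 0 < energy M H c (a + Real.exp v) := fun v => hE _ (hlt v)
  have hs : ∀ v, 0 < Real.sqrt (energy M H c (a + Real.exp v)) := fun v => Real.sqrt_pos.2 (hEv v)
  have hρ : ContDiff ℝ ∞ fun v => a + Real.exp v := contDiff_const.add Real.contDiff_exp
  have hw : ContDiff ℝ ∞ fun v => Real.sqrt (energy M H c (a + Real.exp v)) := by
    rw [contDiff_iff_contDiffAt]
    intro v
    exact ContDiffAt.sqrt (ContDiffAt.comp (g := energy M H c) v (contDiffAt_energy (hρ0 v).ne')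
      hρ.contDiffAt) (hEv v).ne'
  have hl : ContDiff ℝ ∞ fun v => Real.exp v / Real.sqrt (energy M H c (a + Real.exp v)) :=
    Real.contDiff_exp.div hw fun v => (hs v).ne'
  refine exists_profile hM hρ hw hl hρ0
    (fun v => div_pos (Real.exp_pos v) (hs v)) (fun v => ?_) (fun v => ?_) (fun v => ?_) hv₀ t
  · exact Real.sq_sqrt (hEv v).le
  · refine ((Real.hasDerivAt_exp v).const_add a).congr_deriv ?_
    rw [div_mul_cancel₀ _ (hs v).ne']
  · have h1 : HasDerivAt (fun v => energy M H c (a + Real.exp v)) _ v :=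
      HasDerivAt.comp (h₂ := energy M H c) v (hasDerivAt_energy (hρ0 v).ne')
        ((Real.hasDerivAt_exp v).const_add a)
    refine (h1.sqrt (hEv v).ne').congr_deriv ?_
    have := hs v
    field_simp

/-- The profile curve that is parametrized by `arsinh √(r - a)`. -/
lemma exists_profile_sinh {M H c a : ℝ} {Q : ℝ → ℝ} (hM : 0 < M) (ha : 0 < a)
    (hE : ∀ r, 0 < r → energy M H c r = (r - a) * Q r) (hQ : ∀ r, a ≤ r → 0 < Q r)
    (hQd : ∀ r, a ≤ r → ContDiffAt ℝ ∞ Q r)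
    {v₀ : ℝ} (hv₀ : a + Real.sinh v₀ ^ 2 ≠ 2 * M) (t : ℝ) :
    ∃ p : Profile M H c, p.ρ = (fun v => a + Real.sinh v ^ 2) ∧
      p.w = (fun v => Real.sinh v * Real.sqrt (Q (a + Real.sinh v ^ 2))) ∧
      p.l = (fun v => 2 * Real.cosh v / Real.sqrt (Q (a + Real.sinh v ^ 2))) ∧
      p.time v₀ = t := by
  have hle : ∀ v, a ≤ a + Real.sinh v ^ 2 := fun v => le_add_of_nonneg_right (sq_nonneg _)
  have hρ0 : ∀ v, 0 < a + Real.sinh v ^ 2 := fun v => ha.trans_le (hle v)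
  have hQv : ∀ v, 0 < Q (a + Real.sinh v ^ 2) := fun v => hQ _ (hle v)
  have hs : ∀ v, 0 < Real.sqrt (Q (a + Real.sinh v ^ 2)) := fun v => Real.sqrt_pos.2 (hQv v)
  have hρ : ContDiff ℝ ∞ fun v => a + Real.sinh v ^ 2 :=
    contDiff_const.add (Real.contDiff_sinh.pow 2)
  have hdρ : ∀ v, HasDerivAt (fun v => a + Real.sinh v ^ 2) (2 * Real.sinh v * Real.cosh v) v :=
    fun v => (((Real.hasDerivAt_sinh v).pow 2).const_add a).congr_deriv (by push_cast; ring)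
  have hsq : ContDiff ℝ ∞ fun v => Real.sqrt (Q (a + Real.sinh v ^ 2)) := by
    rw [contDiff_iff_contDiffAt]
    intro v
    exact ((hQd _ (hle v)).comp v hρ.contDiffAt).sqrt (hQv v).ne'
  have hl : ContDiff ℝ ∞ fun v => 2 * Real.cosh v / Real.sqrt (Q (a + Real.sinh v ^ 2)) :=
    (contDiff_const.mul Real.contDiff_cosh).div hsq fun v => (hs v).ne'
  -- At a simple zero √E is not smooth, but with r - a = sinh² v it becomes sinh v · √Q, smooth and
  -- changing sign at the throat. The factor cosh v in the speed keeps it bounded below for large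
  -- |v|.
  refine exists_profile hM hρ (Real.contDiff_sinh.mul hsq) hl hρ0
    (fun v => div_pos (mul_pos two_pos (Real.cosh_pos v)) (hs v)) (fun v => ?_) (fun v => ?_)
    (fun v => ?_) hv₀ t
  · have := hE _ (hρ0 v)
    rw [energy] at this
    rw [this, mul_pow, Real.sq_sqrt (hQv v).le]
    ring
  · refine (hdρ v).congr_deriv ?_
    have := hs v
    field_simp
  · set r := a + Real.sinh v ^ 2 with hr
    have hQ' : HasDerivAt Q (deriv Q r) r :=
      ((hQd r (hle v)).differentiableAt (by simp)).hasDerivAt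
    have hE1 : HasDerivAt (energy M H c) (1 * Q r + (r - a) * deriv Q r) r := by
      refine (((hasDerivAt_id r).sub_const a).mul hQ').congr_of_eventuallyEq ?_
      filter_upwards [lt_mem_nhds (hρ0 v)] with x hx
      exact hE x hx
    -- Equating the product rule for (r - a)Q with the explicit derivative of E expresses the
    -- required w' through Q and Q'.
    have h1 := hE1.unique (hasDerivAt_energy (hρ0 v).ne')
    have h2 : HasDerivAt (fun v => Real.sqrt (Q (a + Real.sinh v ^ 2)))
        (deriv Q r * (2 * Real.sinh v * Real.cosh v) / (2 * Real.sqrt (Q r))) v :=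
      (hQ'.comp v (hdρ v)).sqrt (hQv v).ne'
    refine ((Real.hasDerivAt_sinh v).mul h2).congr_deriv ?_
    have hs' : Real.sqrt (Q r) ^ 2 = Q r := Real.sq_sqrt (hQv v).le
    have hs0 : 0 < Real.sqrt (Q r) := hs v
    have h3 : r - a = Real.sinh v ^ 2 := by rw [hr]; ring
    rw [h3] at h1
    have h4 : M / r ^ 2 + rate H c r * rateDeriv H c r =
        (Q r + Real.sinh v ^ 2 * deriv Q r) / 2 := by linarith
    rw [h4]
    generalize Real.sqrt (Q r) = s at *
    rw [← hs']
    field_simp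

/-! ### The energy near its zeros -/

/-- The quotient of `r ^ 4 * energy r` by `r - a`, for a zero `a` of the energy. -/
noncomputable def quot (M H c a r : ℝ) : ℝ :=
  H ^ 2 * (r ^ 5 + a * r ^ 4 + a ^ 2 * r ^ 3 + a ^ 3 * r ^ 2 + a ^ 4 * r + a ^ 5) +
    (r ^ 3 + a * r ^ 2 + a ^ 2 * r + a ^ 3) + (2 * H * c - 2 * M) * (r ^ 2 + a * r + a ^ 2)

lemma energy_eq_quot {M H c a r : ℝ} (ha : a ∈ Ioo 0 (2 * M)) (hk : k M H a = c) (hr : 0 < r) :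
    energy M H c r = (r - a) * (quot M H c a r / r ^ 4) := by
  have h1 := energy_mul_eq (H := H) (c := c) (Ioo_subset_Ioc_self ha)
  rw [hk, sub_self, zero_mul, energy_mul ha.1.ne'] at h1
  have h2 := energy_mul (M := M) (H := H) (c := c) hr.ne'
  rw [quot]
  field_simp
  linear_combination h2 + h1

/-- This is the derivative of r⁴E at its zero a. It has the sign of k'(a), so the zero is double at
r_H and simple to the right of it. -/
lemma quot_self {M H c a : ℝ} (hk : k M H a = c) :
    quot M H c a a =
      2 * a ^ 2 * (2 * a - 3 * M - 3 * H * Real.sqrt (a ^ 3 * (2 * M - a))) := by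
  rw [k] at hk
  rw [quot]
  linear_combination (-6 * a ^ 2 * H) * hk

/-- Each monomial is compared with its value at a = r, hence the counts 6, 4 and 3. Linear growth in
r = a + sinh² v is what the factor cosh v of the speed can absorb. -/
lemma quot_le {M H c a r : ℝ} (ha : 0 < a) (har : a ≤ r) :
    quot M H c a r / r ^ 4 ≤ (6 * H ^ 2 + 4 / a ^ 2 + 3 * |2 * H * c - 2 * M| / a ^ 3) * r := by
  have hr : 0 < r := ha.trans_le har
  have h1 : r ^ 5 + a * r ^ 4 + a ^ 2 * r ^ 3 + a ^ 3 * r ^ 2 + a ^ 4 * r + a ^ 5 ≤ 6 * r ^ 5 := by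
    have e1 : a * r ^ 4 ≤ r * r ^ 4 := by gcongr
    have e2 : a ^ 2 * r ^ 3 ≤ r ^ 2 * r ^ 3 := by gcongr
    have e3 : a ^ 3 * r ^ 2 ≤ r ^ 3 * r ^ 2 := by gcongr
    have e4 : a ^ 4 * r ≤ r ^ 4 * r := by gcongr
    have e5 : a ^ 5 ≤ r ^ 5 := by gcongr
    nlinarith
  have h2 : r ^ 3 + a * r ^ 2 + a ^ 2 * r + a ^ 3 ≤ 4 * r ^ 3 := by
    have e1 : a * r ^ 2 ≤ r * r ^ 2 := by gcongr
    have e2 : a ^ 2 * r ≤ r ^ 2 * r := by gcongr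
    have e3 : a ^ 3 ≤ r ^ 3 := by gcongr
    nlinarith
  have h3 : r ^ 2 + a * r + a ^ 2 ≤ 3 * r ^ 2 := by
    have e1 : a * r ≤ r * r := by gcongr
    have e2 : a ^ 2 ≤ r ^ 2 := by gcongr
    nlinarith
  have h4 : r ^ 3 ≤ r ^ 5 / a ^ 2 := by
    rw [le_div_iff₀ (by positivity)]
    calc r ^ 3 * a ^ 2 ≤ r ^ 3 * r ^ 2 := by gcongr
      _ = r ^ 5 := by ring
  have h5 : r ^ 2 ≤ r ^ 5 / a ^ 3 := by
    rw [le_div_iff₀ (by positivity)]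
    calc r ^ 2 * a ^ 3 ≤ r ^ 2 * r ^ 3 := by gcongr
      _ = r ^ 5 := by ring
  rw [div_le_iff₀ (by positivity), quot]
  have h6 : (2 * H * c - 2 * M) * (r ^ 2 + a * r + a ^ 2) ≤
      |2 * H * c - 2 * M| * (3 * (r ^ 5 / a ^ 3)) :=
    (mul_le_mul_of_nonneg_right (le_abs_self (2 * H * c - 2 * M)) (by positivity)).trans
      (mul_le_mul_of_nonneg_left (by linarith) (abs_nonneg _))
  have h7 := mul_le_mul_of_nonneg_left h1 (sq_nonneg H)
  calc _ ≤ H ^ 2 * (6 * r ^ 5) + 4 * (r ^ 5 / a ^ 2) +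
        |2 * H * c - 2 * M| * (3 * (r ^ 5 / a ^ 3)) := by linarith
    _ = _ := by ring

lemma energy_le_of_double_zero {M H c a : ℝ} (ha : a ∈ Ioo 0 (2 * M)) (hk : k M H a = c)
    (hcrit : 3 * H * Real.sqrt (a ^ 3 * (2 * M - a)) = 2 * a - 3 * M) :
    ∃ C, 0 < C ∧ ∀ r, a < r → energy M H c r ≤ C * (r - a) ^ 2 := by
  have ha0 := ha.1
  -- The coefficients are 1+2+3+4+5, 1+2+3 and 1+2, the sums of the coefficients after a second
  -- division by r - a, each power of a being bounded by that of r.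
  refine ⟨15 * H ^ 2 + 6 / a ^ 2 + 3 * |2 * H * c - 2 * M| / a ^ 3, by positivity, fun r har => ?_⟩
  have hr : 0 < r := ha0.trans har
  have h0 : quot M H c a a = 0 := by rw [quot_self hk, hcrit]; ring
  have hq : quot M H c a r = (r - a) *
      (H ^ 2 * (r ^ 4 + 2 * a * r ^ 3 + 3 * a ^ 2 * r ^ 2 + 4 * a ^ 3 * r + 5 * a ^ 4) +
        (r ^ 2 + 2 * a * r + 3 * a ^ 2) + (2 * H * c - 2 * M) * (r + 2 * a)) := by
    rw [quot] at h0 ⊢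
    linear_combination h0
  have h1 : r ^ 4 + 2 * a * r ^ 3 + 3 * a ^ 2 * r ^ 2 + 4 * a ^ 3 * r + 5 * a ^ 4 ≤
      15 * r ^ 4 := by
    have e1 : a * r ^ 3 ≤ r * r ^ 3 := by gcongr
    have e2 : a ^ 2 * r ^ 2 ≤ r ^ 2 * r ^ 2 := by gcongr
    have e3 : a ^ 3 * r ≤ r ^ 3 * r := by gcongr
    have e4 : a ^ 4 ≤ r ^ 4 := by gcongr
    nlinarith
  have h2 : r ^ 2 + 2 * a * r + 3 * a ^ 2 ≤ 6 * r ^ 2 := by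
    have e1 : a * r ≤ r * r := by gcongr
    have e2 : a ^ 2 ≤ r ^ 2 := by gcongr
    nlinarith
  have h4 : r ^ 2 ≤ r ^ 4 / a ^ 2 := by
    rw [le_div_iff₀ (by positivity)]
    calc r ^ 2 * a ^ 2 ≤ r ^ 2 * r ^ 2 := by gcongr
      _ = r ^ 4 := by ring
  have h5 : r ≤ r ^ 4 / a ^ 3 := by
    rw [le_div_iff₀ (by positivity)]
    calc r * a ^ 3 ≤ r * r ^ 3 := by gcongr
      _ = r ^ 4 := by ring
  have h6 : (2 * H * c - 2 * M) * (r + 2 * a) ≤ |2 * H * c - 2 * M| * (3 * (r ^ 4 / a ^ 3)) :=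
    (mul_le_mul_of_nonneg_right (le_abs_self (2 * H * c - 2 * M)) (by positivity)).trans
      (mul_le_mul_of_nonneg_left (by linarith) (abs_nonneg _))
  have h7 := mul_le_mul_of_nonneg_left h1 (sq_nonneg H)
  rw [energy_eq_quot ha hk hr, hq, mul_comm _ ((r - a) ^ 2), mul_div_assoc, ← mul_assoc, ← sq]
  refine mul_le_mul_of_nonneg_left ?_ (sq_nonneg (r - a))
  rw [div_le_iff₀ (by positivity)]
  calc _ ≤ H ^ 2 * (15 * r ^ 4) + 6 * (r ^ 4 / a ^ 2) +
        |2 * H * c - 2 * M| * (3 * (r ^ 4 / a ^ 3)) := by linarith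
    _ = _ := by ring

lemma energy_le_of_one_le {M H c r : ℝ} (hM : 0 < M) (hr : 1 ≤ r) :
    energy M H c r ≤ (1 + 2 * H ^ 2 + 2 * c ^ 2) * r ^ 2 := by
  have hr0 : 0 < r := by linarith
  have h1 : h M r ≤ r ^ 2 := by
    have : 0 ≤ 2 * M / r := by positivity
    rw [h]; nlinarith
  have h2 : (c / r ^ 2) ^ 2 ≤ c ^ 2 * r ^ 2 := by
    rw [div_pow, div_le_iff₀ (by positivity)]
    have : 1 ≤ r ^ 2 * (r ^ 2) ^ 2 := by
      rw [← pow_mul, ← pow_add]; exact one_le_pow₀ hr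
    nlinarith [sq_nonneg c]
  rw [energy, rate]
  nlinarith [sq_nonneg (H * r - c / r ^ 2)]

/-! ### Hypersurfaces that reach all radii larger than some `a < 2M` once -/

namespace Profile
variable {M H c a : ℝ} (p : Profile M H c)

lemma image_Ioi_exp (hρ : p.ρ = fun v => a + Real.exp v) (ha : a < 2 * M) :
    p.ρ '' Ioi (Real.log (2 * M - a)) = Ioi (2 * M) := by
  rw [hρ]
  ext r
  constructor
  · rintro ⟨v, hv, rfl⟩
    have := (Real.log_lt_iff_lt_exp (sub_pos.2 ha)).1 hv
    simp only [mem_Ioi]; linarith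
  · intro hr
    have hr' : 2 * M < r := hr
    refine ⟨Real.log (r - a), Real.log_lt_log (sub_pos.2 ha) (by linarith), ?_⟩
    simp only
    rw [Real.exp_log (by linarith)]; ring

lemma image_Iio_exp (hρ : p.ρ = fun v => a + Real.exp v) (ha : a < 2 * M) :
    p.ρ '' Iio (Real.log (2 * M - a)) = Ioo a (2 * M) := by
  rw [hρ]
  ext r
  constructor
  · rintro ⟨v, hv, rfl⟩
    have := (Real.lt_log_iff_exp_lt (sub_pos.2 ha)).1 hv
    exact ⟨by linarith [Real.exp_pos v], by linarith⟩
  · intro hr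
    refine ⟨Real.log (r - a), Real.log_lt_log (sub_pos.2 hr.1) (by linarith [hr.2]), ?_⟩
    simp only
    rw [Real.exp_log (by linarith [hr.1])]; ring

lemma ρ_log (hρ : p.ρ = fun v => a + Real.exp v) {r : ℝ} (hr : a < r) :
    p.ρ (Real.log (r - a)) = r := by
  rw [hρ]; simp only
  rw [Real.exp_log (sub_pos.2 hr)]; ring

lemma Ioo_subset_domain₂ (hM : 0 < M) (ha0 : 0 ≤ a) (ha : a < 2 * M)
    (hρ : p.ρ = fun v => a + Real.exp v) (hw : ∀ v, 0 < p.w v)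
    (hk : ∀ r ∈ Ioo a (2 * M), c < k M H r) {r₂ : ℝ} (hr₂ : r₂ ∈ Ioo a (2 * M)) :
    Ioo a (2 * M) ⊆ domain₂ M H c r₂ := by
  intro r hr
  refine ⟨⟨ha0.trans_lt hr.1, hr.2⟩, fun x hx => ?_, ?_⟩
  · have hx' : x ∈ Ioo a (2 * M) :=
      ⟨(lt_min hr₂.1 hr.1).trans hx.1, hx.2.trans (max_lt hr₂.2 hr.2)⟩
    rw [one_lt_l₂_iff_lt_k ⟨ha0.trans_lt hx'.1, hx'.2⟩]
    exact hk x hx'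
  · have h1 := image_Iio_exp p hρ ha
    have := (p.integral_slope₂_increasing hM (v₀ := Real.log (r₂ - a)) (v := Real.log (r - a))
      (fun x hx => ?_) fun x _ => hw x).1
    · rwa [p.ρ_log hρ hr₂.1, p.ρ_log hρ hr.1] at this
    · have hx' : x ∈ Iio (Real.log (2 * M - a)) := hx.2.trans_lt (max_lt
        (Real.log_lt_log (sub_pos.2 hr₂.1) (by linarith [hr₂.2]))
        (Real.log_lt_log (sub_pos.2 hr.1) (by linarith [hr.2])))
      have h2 : p.ρ x ∈ Ioo a (2 * M) := h1 ▸ mem_image_of_mem _ hx'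
      exact ⟨h2.2, ((lt_k_iff ⟨ha0.trans_lt h2.1, h2.2⟩).1 (hk _ h2)).1⟩

/-- The curve is cut at v = log(2M - a), where r = 2M. The constants of the height functions are the
times at the base points. -/
lemma pieces_exp (hM : 0 < M) (ha0 : 0 ≤ a) (ha : a < 2 * M) (hc : c < -8 * M ^ 3 * H)
    (hρ : p.ρ = fun v => a + Real.exp v) (hw : ∀ v, 0 < p.w v)
    (hk : ∀ r ∈ Ioo a (2 * M), c < k M H r) {r₁ : ℝ} (hr₁ : 2 * M < r₁) :
    Sigma₁ M H c r₁ (p.time (Real.log (r₁ - a))) = p.curve '' Ioi (Real.log (2 * M - a)) ∧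
    p.curve (Real.log (2 * M - a)) ∈ Lplus ∧
    ∀ r₂ ∈ Ioo a (2 * M), domain₂ M H c r₂ = Ioo a (2 * M) →
      Sigma₂star M H c r₂ (p.time (Real.log (r₂ - a))) =
        p.curve '' Iio (Real.log (2 * M - a)) := by
  refine ⟨?_, ?_, fun r₂ hr₂ hdom => ?_⟩
  · have := p.sigma₁_eq hM (p.image_Ioi_exp hρ ha) (fun v _ => hw v)
      (v₀ := Real.log (r₁ - a)) (Real.log_lt_log (sub_pos.2 ha) (by linarith))
    rwa [p.ρ_log hρ (ha.trans hr₁)] at this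
  · have h1 := p.ρ_log hρ ha
    exact p.curve_mem_Lplus hM h1 (by rw [h1]; exact rate_two_mul_neg hM hc) (hw _)
  · have h1 := image_Iio_exp p hρ ha
    have := p.sigma₂star_eq hM (J := Iio (Real.log (2 * M - a))) (v₀ := Real.log (r₂ - a))
      (Real.log_lt_log (sub_pos.2 hr₂.1) (by linarith [hr₂.2]))
      (by rw [h1, p.ρ_log hρ hr₂.1, hdom]) (fun v hv => ?_) (fun v _ x _ => hw x)
    · rwa [p.ρ_log hρ hr₂.1] at this
    · have h2 : p.ρ v ∈ Ioo a (2 * M) := h1 ▸ mem_image_of_mem _ hv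
      exact ⟨h2.2, ((lt_k_iff ⟨ha0.trans_lt h2.1, h2.2⟩).1 (hk _ h2)).1⟩

lemma range_curve_eq (v : ℝ) :
    range p.curve = p.curve '' Ioi v ∪ {p.curve v} ∪ p.curve '' Iio v := by
  rw [← image_univ, ← image_singleton, ← image_union, ← image_union]
  congr 1
  ext x
  rcases lt_trichotomy x v with h | h | h <;> simp [h]

/-- Bounds for the parameter on both sides give closedness. -/
lemma isClosed_of_bounds (hM : 0 < M)
    (hlow : ∀ x ∈ plane M, ∃ A, ∀ᶠ y in 𝓝 x, ∀ v, p.curve v = y → A ≤ v)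
    (hup : ∀ R, ∃ B, ∀ v, p.ρ v < R → v ≤ B) : IsClosed (sphericalLift M (range p.curve)) := by
  refine p.isClosed_sphericalLift hM fun x hx => ?_
  obtain ⟨A, hA⟩ := hlow x hx
  obtain ⟨B, hB⟩ := hup (radius M x + 1)
  refine ⟨A, B, ?_⟩
  filter_upwards [hA, (continuousAt_radius hM hx).eventually (gt_mem_nhds (lt_add_one _))]
    with y h1 h2 v hv
  refine ⟨h1 v hv, hB v ?_⟩
  rwa [← p.radius_curve hM, hv]

lemma le_of_ρ_lt_exp (hρ : p.ρ = fun v => a + Real.exp v) (R : ℝ) :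
    ∃ B, ∀ v, p.ρ v < R → v ≤ B := by
  refine ⟨R - a, fun v hv => ?_⟩
  rw [hρ] at hv
  simp only at hv
  linarith [Real.add_one_le_exp v]

lemma le_of_lt_ρ_exp (hM : 0 < M) (hρ : p.ρ = fun v => a + Real.exp v) {x : ℝ × ℝ}
    (hx : x ∈ plane M) (hr : a < radius M x) :
    ∃ A, ∀ᶠ y in 𝓝 x, ∀ v, p.curve v = y → A ≤ v := by
  obtain ⟨s, hs1, hs2⟩ := exists_between hr
  refine ⟨Real.log (s - a), ?_⟩
  filter_upwards [(continuousAt_radius hM hx).eventually (lt_mem_nhds hs2)] with y hy v hv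
  rw [← hv, p.radius_curve hM, hρ] at hy
  simp only at hy
  exact ((Real.log_lt_iff_lt_exp (sub_pos.2 hs1)).2 (by linarith)).le

lemma V_pos_exp (hM : 0 < M) (hw : ∀ v, 0 < p.w v)
    (hP : ∀ v, p.ρ v ≤ 2 * M → rate H c (p.ρ v) < 0) (v : ℝ) : 0 < p.V v := by
  rcases le_or_gt (p.ρ v) (2 * M) with h1 | h1
  · exact (p.V_pos_iff hM v).2 ((hP v h1).trans (hw v))
  · exact (p.sign_I hM h1 (hw v)).2

/-- At a double zero of the energy the null coordinate `X + T` tends to zero. -/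
lemma tendsto_V_exp (hM : 0 < M) (ha0 : 0 < a) (hρ : p.ρ = fun v => a + Real.exp v)
    (hw : p.w = fun v => Real.sqrt (energy M H c (a + Real.exp v))) (hV : ∀ v, 0 < p.V v)
    {C : ℝ} (hC0 : 0 < C) (hC : ∀ v, C ≤ p.l v) : Tendsto p.V atBot (𝓝 0) := by
  -- √E - P extends continuously to the zero a of the energy, so w - P is bounded for v ≤ 0.
  have hcont : ContinuousOn (fun r => Real.sqrt (energy M H c r) - rate H c r) (Icc a (a + 1)) := by
    intro r hr
    have hr0 : r ≠ 0 := (ha0.trans_le hr.1).ne'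
    exact ((Real.continuous_sqrt.continuousAt.comp (contDiffAt_energy hr0).continuousAt).sub
      (hasDerivAt_rate H c hr0).continuousAt).continuousWithinAt
  obtain ⟨B, hB⟩ := isCompact_Icc.bddAbove_image hcont
  have hD : 0 < max B 1 := lt_max_of_lt_right one_pos
  have hbound : ∀ v, v ≤ 0 → p.w v - rate H c (p.ρ v) ≤ max B 1 := by
    intro v hv
    have h1 : a + Real.exp v ∈ Icc a (a + 1) :=
      ⟨by linarith [Real.exp_pos v], by linarith [Real.exp_le_one_iff.2 hv]⟩
    rw [hw, hρ]
    exact (hB ⟨_, h1, rfl⟩).trans (le_max_left _ _)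
  set κ := C / (4 * M * max B 1) with hκ
  have hκ0 : 0 < κ := by positivity
  have hd : ∀ v, HasDerivAt (fun v => Real.log (p.V v)) (p.l v * p.α v / p.V v) v := fun v =>
    (p.hasDerivAt_V hM v).log (hV v).ne'
  -- The logarithmic derivative of V is l/(4M(w - P)), with l bounded below and w - P bounded above;
  -- so V decays exponentially as v → -∞.
  have hge : ∀ v, v ≤ 0 → κ ≤ p.l v * p.α v / p.V v := by
    intro v hv
    have hα := p.α_pos v
    rw [hκ, div_le_div_iff₀ (by positivity) (hV v), V]
    have h1 := hbound v hv
    have h2 : C * (p.w v - rate H c (p.ρ v)) ≤ p.l v * max B 1 := by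
      refine (mul_le_mul_of_nonneg_left h1 hC0.le).trans
        (mul_le_mul_of_nonneg_right (hC v) hD.le)
    calc _ = (4 * M * p.α v) * (C * (p.w v - rate H c (p.ρ v))) := by ring
      _ ≤ (4 * M * p.α v) * (p.l v * max B 1) := mul_le_mul_of_nonneg_left h2 (by positivity)
      _ = _ := by ring
  have hle : ∀ v, v ≤ 0 → p.V v ≤ Real.exp (Real.log (p.V 0) + κ * v) := by
    intro v hv
    have h := (convex_Iic (0 : ℝ)).mul_sub_le_image_sub_of_le_deriv
      (fun x _ => (hd x).continuousAt.continuousWithinAt)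
      (fun x _ => (hd x).differentiableAt.differentiableWithinAt) (C := κ)
      (fun x hx => by
        rw [interior_Iic] at hx
        rw [(hd x).deriv]; exact hge x (le_of_lt hx)) v hv 0 self_mem_Iic hv
    rw [← Real.log_le_iff_le_exp (hV v)]
    linarith
  have hlim : Tendsto (fun v => Real.exp (Real.log (p.V 0) + κ * v)) atBot (𝓝 0) :=
    Real.tendsto_exp_atBot.comp
      (tendsto_atBot_add_const_left _ _ (tendsto_id.const_mul_atBot hκ0))
  refine tendsto_of_tendsto_of_tendsto_of_le_of_le' tendsto_const_nhds hlim
    (Eventually.of_forall fun v => (hV v).le) ?_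
  filter_upwards [eventually_le_atBot 0] with v hv
  exact hle v hv

/-- Write V/U = V²/(UV); the denominator tends to `radial M a`, which is not zero as a < 2M. -/
lemma tendsto_time_exp (hM : 0 < M) (ha : a < 2 * M)
    (hρ : p.ρ = fun v => a + Real.exp v) (hV : Tendsto p.V atBot (𝓝 0)) :
    Tendsto p.time atBot atBot := by
  have hρlim : Tendsto p.ρ atBot (𝓝 a) := by
    rw [hρ]
    simpa using tendsto_const_nhds.add Real.tendsto_exp_atBot
  have hrad : Tendsto (fun v => radial M (p.ρ v)) atBot (𝓝 (radial M a)) :=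
    (contDiff_radial M).continuous.continuousAt.tendsto.comp hρlim
  have hne : ∀ᶠ v in atBot, p.ρ v ≠ 2 * M :=
    (hρlim.eventually (gt_mem_nhds ha)).mono fun v hv => hv.ne
  have hlim : Tendsto (fun v => p.V v / p.U v) atBot (𝓝[≠] 0) := by
    rw [tendsto_nhdsWithin_iff]
    constructor
    · have h1 := (hV.mul hV).div hrad (radial_ne_zero ha.ne)
      rw [mul_zero, zero_div] at h1
      refine h1.congr' ?_
      filter_upwards [hne] with v hv
      have := p.V_ne_zero hM hv
      have := p.U_ne_zero hM hv
      simp only [Pi.div_apply]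
      rw [← p.U_mul_V hM]
      field_simp
    · filter_upwards [hne] with v hv
      exact div_ne_zero (p.V_ne_zero hM hv) (p.U_ne_zero hM hv)
  exact (Real.tendsto_log_nhdsNE_zero.comp hlim).const_mul_atBot (by positivity)

/-- The nonnegative slope has time differences as partial integrals, and these are unbounded towards
a. Hence a itself is not in the domain of f₂*. -/
lemma not_intervalIntegrable_slope₂ (hM : 0 < M) (ha0 : 0 < a)
    (ha : a < 2 * M) (hρ : p.ρ = fun v => a + Real.exp v) (hw : ∀ v, 0 < p.w v)
    (hk : ∀ r ∈ Ioo a (2 * M), c < k M H r) (htime : Tendsto p.time atBot atBot) {r₂ : ℝ}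
    (hr₂ : r₂ ∈ Ioo a (2 * M)) :
    ¬ IntervalIntegrable (slope₂ M H c) MeasureTheory.volume r₂ a := by
  intro hint
  rw [intervalIntegrable_iff, uIoc_of_ge hr₂.1.le] at hint
  set v₂ := Real.log (r₂ - a) with hv₂
  have hv₂' : v₂ < Real.log (2 * M - a) :=
    Real.log_lt_log (sub_pos.2 hr₂.1) (by linarith [hr₂.2])
  have h1 := image_Iio_exp p hρ ha
  have hbound : ∀ v, v ≤ v₂ →
      p.time v₂ - p.time v ≤ ∫ x in Ioc a r₂, slope₂ M H c x := by
    intro v hv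
    have h3 := (p.integral_slope₂_increasing hM (v₀ := v) (v := v₂)
      (fun x hx => by
        have hx' : x ∈ Iio (Real.log (2 * M - a)) := by
          rw [uIcc_of_le hv] at hx
          exact hx.2.trans_lt hv₂'
        have h2 : p.ρ x ∈ Ioo a (2 * M) := h1 ▸ mem_image_of_mem _ hx'
        exact ⟨h2.2, ((lt_k_iff ⟨ha0.trans h2.1, h2.2⟩).1 (hk _ h2)).1⟩)
      fun x _ => hw x).2
    have h4 : p.ρ v ≤ p.ρ v₂ := by
      rw [hρ]; simpa using hv
    have h5 : a ≤ p.ρ v := by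
      rw [hρ]; simpa using (Real.exp_pos v).le
    rw [← h3, intervalIntegral.integral_of_le h4, hv₂, p.ρ_log hρ hr₂.1]
    refine MeasureTheory.setIntegral_mono_set hint ?_
      (Ioc_subset_Ioc_left h5).eventuallyLE
    filter_upwards [MeasureTheory.ae_restrict_mem measurableSet_Ioc] with x hx
    exact slope₂_nonneg (h_neg (ha0.trans hx.1) (hx.2.trans_lt hr₂.2))
  obtain ⟨v, hv1, hv2⟩ := ((htime.eventually (eventually_lt_atBot
    (p.time v₂ - ∫ x in Ioc a r₂, slope₂ M H c x))).and (eventually_le_atBot v₂)).exists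
  linarith [hbound v hv2]

end Profile

/-! ### The cases without a throat -/

/-- Hypersurfaces that run into the singularity. -/
lemma isSSCMC_of_lt_k {M H c : ℝ} (hM : 0 < M) (hc : c < -8 * M ^ 3 * H)
    (hk : ∀ r ∈ Ioo 0 (2 * M), c < k M H r) {r₁ : ℝ} (hr₁ : 2 * M < r₁) (t : ℝ) :
    IsSSCMC M H (Sigma₁ M H c r₁ t) ∧
      ∀ r₂ ∈ Ioo 0 (2 * M), domain₂ M H c r₂ = Ioo 0 (2 * M) ∧
        ∃ t₂ : ℝ, ∃ q ∈ Lplus, ∃ Γ : Set (ℝ × ℝ),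
          Γ = Sigma₁ M H c r₁ t ∪ {q} ∪ Sigma₂star M H c r₂ t₂ ∧
          IsSSCMC M H (Sigma₂star M H c r₂ t₂) ∧ IsSSCMC M H Γ ∧
          IsCompleteInExtension M Γ ∧ HasEnds 2 (sphericalLift M Γ) := by
  have hE : ∀ r, 0 < r → 0 < energy M H c r := fun r hr =>
    energy_pos_of_lt_k hM hc le_rfl hk hr
  have h2M : 0 < 2 * M := by positivity
  obtain ⟨p, hρ, hw, hl, ht⟩ := exists_profile_exp hM le_rfl hE (v₀ := Real.log (r₁ - 0))
    (by rw [Real.exp_log (by linarith)]; linarith) t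
  have hw0 : ∀ v, 0 < p.w v := fun v => by
    rw [hw]; exact Real.sqrt_pos.2 (hE _ (by linarith [Real.exp_pos v]))
  obtain ⟨h1, h2, h3⟩ := p.pieces_exp hM le_rfl h2M hc hρ hw0 hk hr₁
  rw [ht] at h1
  refine ⟨h1 ▸ p.isSSCMC_image hM isOpen_Ioi, fun r₂ hr₂ => ?_⟩
  have hdom : domain₂ M H c r₂ = Ioo 0 (2 * M) :=
    Subset.antisymm (fun r hr => hr.1) (p.Ioo_subset_domain₂ hM le_rfl h2M hρ hw0 hk hr₂)
  have h3' := h3 r₂ hr₂ hdom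
  refine ⟨hdom, _, _, h2, range p.curve, ?_, h3' ▸ p.isSSCMC_image hM isOpen_Iio,
    p.isSSCMC_range hM, ⟨?_, ?_⟩, p.hasEnds_two_range hM⟩
  · rw [h1, h3']
    exact p.range_curve_eq _
  · refine p.isClosed_of_bounds hM (fun x hx => ?_) (p.le_of_ρ_lt_exp hρ)
    exact p.le_of_lt_ρ_exp hM hρ hx (radius_spec hM hx).1
  · intro σ hσ
    have hC : 0 < 1 + 2 * H ^ 2 + 2 * c ^ 2 := by positivity
    -- For v ≥ 0 one has r = exp v ≥ 1, where E grows at most quadratically. No bound is needed for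
    -- v < 0: a parameter tending to -∞ means r → 0.
    refine (p.hasEndPoint_or_tendsto hM hσ
      (C := 1 / Real.sqrt (1 + 2 * H ^ 2 + 2 * c ^ 2)) (by positivity) fun v hv => ?_).imp_right ?_
    · rw [hl]
      simp only [zero_add]
      have he := Real.exp_pos v
      rw [div_le_div_iff₀ (Real.sqrt_pos.2 hC) (Real.sqrt_pos.2 (hE _ he)), one_mul]
      refine Real.sqrt_le_iff.2 ⟨by positivity, ?_⟩
      rw [mul_pow, Real.sq_sqrt hC.le, mul_comm]
      exact energy_le_of_one_le hM (Real.one_le_exp hv)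
    · rintro ⟨-, hlim⟩
      have h4 := Real.tendsto_exp_atBot.comp hlim
      refine h4.congr' ?_
      filter_upwards [Ioo_mem_nhdsLT zero_lt_one] with τ hτ
      rw [← p.curve_param hM hσ (Ioo_subset_Ico_self hτ), p.radius_curve hM, hρ]
      simp

/-- Hypersurfaces that are asymptotic to a sphere of constant radius in region II. -/
lemma isSSCMC_of_double_zero {M H c a : ℝ} (hM : 0 < M) (hc : c < -8 * M ^ 3 * H)
    (ha : a ∈ Ioo 0 (2 * M)) (hka : k M H a = c)
    (hcrit : 3 * H * Real.sqrt (a ^ 3 * (2 * M - a)) = 2 * a - 3 * M)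
    (hk : ∀ r ∈ Ioo a (2 * M), c < k M H r) {r₁ : ℝ} (hr₁ : 2 * M < r₁) (t : ℝ) :
    IsSSCMC M H (Sigma₁ M H c r₁ t) ∧
      ∀ r₂ ∈ Ioo a (2 * M), domain₂ M H c r₂ = Ioo a (2 * M) ∧
        ∃ t₂ : ℝ, ∃ q ∈ Lplus, ∃ Γ : Set (ℝ × ℝ),
          Γ = Sigma₁ M H c r₁ t ∪ {q} ∪ Sigma₂star M H c r₂ t₂ ∧
          IsSSCMC M H (Sigma₂star M H c r₂ t₂) ∧ IsSSCMC M H Γ ∧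
          IsCompleteInExtension M Γ ∧ IsRiemannianComplete M Γ ∧
          HasEnds 2 (sphericalLift M Γ) := by
  have hE : ∀ r, a < r → 0 < energy M H c r := fun r hr =>
    energy_pos_of_lt_k hM hc ha.1.le hk hr
  have ha1 : a < r₁ := ha.2.trans hr₁
  obtain ⟨p, hρ, hw, hl, ht⟩ := exists_profile_exp hM ha.1.le hE (v₀ := Real.log (r₁ - a))
    (by rw [Real.exp_log (by linarith)]; linarith) t
  have hw0 : ∀ v, 0 < p.w v := fun v => by
    rw [hw]; exact Real.sqrt_pos.2 (hE _ (by linarith [Real.exp_pos v]))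
  have hV : ∀ v, 0 < p.V v := p.V_pos_exp hM hw0 fun v hv => by
    refine rate_neg_of_lt_k hM hc ha.1.le hk ⟨?_, hv⟩
    rw [hρ]; exact lt_add_of_pos_right a (Real.exp_pos v)
  obtain ⟨C, hC0, hC⟩ := energy_le_of_double_zero ha hka hcrit
  have hl0 : ∀ v, 1 / Real.sqrt C ≤ p.l v := by
    intro v
    rw [hl]
    have he := Real.exp_pos v
    have hlt := lt_add_of_pos_right a he
    simp only
    rw [div_le_div_iff₀ (Real.sqrt_pos.2 hC0) (Real.sqrt_pos.2 (hE _ hlt)), one_mul]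
    refine Real.sqrt_le_iff.2 ⟨by positivity, ?_⟩
    rw [mul_pow, Real.sq_sqrt hC0.le, mul_comm]
    simpa using hC _ hlt
  have hC' : 0 < 1 / Real.sqrt C := by positivity
  have hVlim := p.tendsto_V_exp hM ha.1 hρ hw hV hC' hl0
  have htime := p.tendsto_time_exp hM ha.2 hρ hVlim
  obtain ⟨h1, h2, h3⟩ := p.pieces_exp hM ha.1.le ha.2 hc hρ hw0 hk hr₁
  rw [ht] at h1
  refine ⟨h1 ▸ p.isSSCMC_image hM isOpen_Ioi, fun r₂ hr₂ => ?_⟩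
  have hdom : domain₂ M H c r₂ = Ioo a (2 * M) := by
    refine Subset.antisymm (fun r hr => ⟨?_, hr.1.2⟩)
      (p.Ioo_subset_domain₂ hM ha.1.le ha.2 hρ hw0 hk hr₂)
    obtain ⟨h4, h5, h6⟩ := hr
    by_contra hcon
    -- The end point a fails by divergence of the integral; a smaller r fails because a would lie
    -- strictly in between, where l₂ > 1 is violated.
    rcases (not_lt.1 hcon).eq_or_lt with rfl | hlt
    · exact p.not_intervalIntegrable_slope₂ hM ha.1 ha.2 hρ hw0 hk htime hr₂ h6
    · have := h5 a ⟨(min_le_right _ _).trans_lt hlt, hr₂.1.trans_le (le_max_left _ _)⟩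
      rw [one_lt_l₂_iff_lt_k ha, hka] at this
      exact lt_irrefl _ this
  have h3' := h3 r₂ hr₂ hdom
  have hcomplete := p.isRiemannianComplete hM hC' hl0
  refine ⟨hdom, _, _, h2, range p.curve, ?_, h3' ▸ p.isSSCMC_image hM isOpen_Iio,
    p.isSSCMC_range hM, ⟨?_, fun σ hσ => Or.inl (hcomplete σ hσ)⟩, hcomplete,
    p.hasEnds_two_range hM⟩
  · rw [h1, h3']
    exact p.range_curve_eq _
  · refine p.isClosed_of_bounds hM (fun x hx => ?_) (p.le_of_ρ_lt_exp hρ)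
    -- Where r ≠ 2M the coordinate X + T is not zero, while it tends to 0 as v → -∞; so nearby
    -- points have parameters bounded below. Where r = 2M the radius itself stays away from a.
    by_cases hr : radius M x = 2 * M
    · exact p.le_of_lt_ρ_exp hM hρ hx (hr ▸ ha.2)
    · have h4 := (radius_spec hM hx).2
      have h5 : x.1 + x.2 ≠ 0 := fun h0 => by
        refine Profile.radial_ne_zero hr (h4.trans ?_)
        linear_combination (x.1 - x.2) * h0
      have h6 : 0 < |x.1 + x.2| / 2 := by positivity
      obtain ⟨A, hA⟩ := (hVlim.eventually (gt_mem_nhds h6)).exists_forall_of_atBot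
      have h7 : ContinuousAt (fun y : ℝ × ℝ => |y.1 + y.2|) x := by fun_prop
      refine ⟨A, ?_⟩
      filter_upwards [h7.eventually (lt_mem_nhds (half_lt_self (abs_pos.2 h5)))] with y hy v hv
      by_contra hcon
      have h8 := hA v (not_le.1 hcon).le
      have h9 : y.1 + y.2 = p.V v := by
        rw [← hv]; simp only [Profile.curve, Profile.X, Profile.T]; ring
      rw [h9, abs_of_pos (hV v)] at hy
      exact lt_irrefl _ (hy.trans h8)

/-! ### Hypersurfaces with a throat -/

lemma rate_neg_of_k_eq {M H c a : ℝ} (ha : a ∈ Ioo 0 (2 * M)) (hka : k M H a = c) :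
    rate H c a < 0 := by
  have ha0 := ha.1
  have hs := Real.sqrt_pos.2 (cube_mul_pos ha)
  have h1 : rate H c a * a ^ 2 = H * a ^ 3 + c := by rw [rate]; field_simp
  rw [k] at hka
  by_contra hcon
  have := mul_nonneg (not_lt.1 hcon) (sq_nonneg a)
  linarith

lemma quot_pos {M H c a : ℝ} (hM : 0 < M) (hc : c < -8 * M ^ 3 * H) (ha : a ∈ Ioo 0 (2 * M))
    (hka : k M H a = c)
    (hcrit : 0 < 2 * a - 3 * M - 3 * H * Real.sqrt (a ^ 3 * (2 * M - a)))
    (hk : ∀ r ∈ Ioo a (2 * M), c < k M H r) {r : ℝ} (hr : a ≤ r) :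
    0 < quot M H c a r / r ^ 4 := by
  have ha0 := ha.1
  rcases hr.eq_or_lt with rfl | hr
  · rw [quot_self hka]; positivity
  · have h1 := energy_pos_of_lt_k hM hc ha0.le hk hr
    rw [energy_eq_quot ha hka (ha0.trans hr)] at h1
    exact pos_of_mul_pos_right h1 (sub_pos.2 hr).le

namespace Profile
variable {M H c a : ℝ} (p : Profile M H c)

lemma ρ_lt_iff_sinh (hρ : p.ρ = fun v => a + Real.sinh v ^ 2) {u : ℝ} (hu : 0 ≤ u) (v : ℝ) :
    p.ρ v < p.ρ u ↔ |v| < u := by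
  simp only [hρ, add_lt_add_iff_left]
  rw [sq_lt_sq, Real.abs_sinh, Real.abs_sinh, Real.sinh_lt_sinh, abs_of_nonneg hu]

lemma ρ_arsinh (hρ : p.ρ = fun v => a + Real.sinh v ^ 2) {r : ℝ} (hr : a ≤ r) :
    p.ρ (Real.arsinh (Real.sqrt (r - a))) = r := by
  simp only [hρ]
  rw [Real.sinh_arsinh, Real.sq_sqrt (sub_nonneg.2 hr)]; ring

lemma ρ_neg_sinh (hρ : p.ρ = fun v => a + Real.sinh v ^ 2) (v : ℝ) : p.ρ (-v) = p.ρ v := by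
  simp only [hρ, Real.sinh_neg, neg_sq]

lemma arsinh_sqrt_nonneg (x : ℝ) : 0 ≤ Real.arsinh (Real.sqrt x) :=
  Real.arsinh_nonneg_iff.2 (Real.sqrt_nonneg _)

lemma image_Ico_sinh (hρ : p.ρ = fun v => a + Real.sinh v ^ 2) {u : ℝ} (hu : 0 ≤ u) :
    p.ρ '' Ico 0 u = Ico a (p.ρ u) := by
  ext r
  constructor
  · rintro ⟨v, hv, rfl⟩
    refine ⟨?_, (p.ρ_lt_iff_sinh hρ hu v).2 (by rw [abs_of_nonneg hv.1]; exact hv.2)⟩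
    simp only [hρ]; exact le_add_of_nonneg_right (sq_nonneg _)
  · intro hr
    have h1 := p.ρ_arsinh hρ hr.1
    have h2 := arsinh_sqrt_nonneg (r - a)
    refine ⟨_, ⟨h2, ?_⟩, h1⟩
    rw [← abs_of_nonneg h2]
    exact (p.ρ_lt_iff_sinh hρ hu _).1 (by rw [h1]; exact hr.2)

lemma image_Ioi_sinh (hρ : p.ρ = fun v => a + Real.sinh v ^ 2) {u : ℝ} (hu : 0 ≤ u) :
    p.ρ '' Ioi u = Ioi (p.ρ u) := by
  ext r
  constructor
  · rintro ⟨v, hv, rfl⟩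
    exact (p.ρ_lt_iff_sinh hρ (hu.trans (le_of_lt hv)) u).2 (by rw [abs_of_nonneg hu]; exact hv)
  · intro hr
    have har : a ≤ r := by
      refine le_trans ?_ (le_of_lt hr)
      simp only [hρ]; exact le_add_of_nonneg_right (sq_nonneg _)
    have h1 := p.ρ_arsinh hρ har
    refine ⟨_, ?_, h1⟩
    have := (p.ρ_lt_iff_sinh hρ (arsinh_sqrt_nonneg (r - a)) u).1 (h1.symm ▸ hr)
    rwa [abs_of_nonneg hu] at this

lemma image_neg_sinh (hρ : p.ρ = fun v => a + Real.sinh v ^ 2) (S : Set ℝ) :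
    p.ρ '' (Neg.neg '' S) = p.ρ '' S := by
  rw [image_image]
  exact image_congr fun v _ => p.ρ_neg_sinh hρ v

lemma range_curve_eq_of_two (u : ℝ) :
    range p.curve = p.curve '' Ioi u ∪ {p.curve u} ∪ (p.curve '' Ioo (-u) u) ∪ {p.curve (-u)} ∪
      p.curve '' Iio (-u) := by
  rw [← image_univ, ← image_singleton, ← image_singleton, ← image_union, ← image_union,
    ← image_union, ← image_union]
  congr 1
  ext x
  simp only [mem_univ, mem_union, mem_Ioi, mem_singleton_iff, mem_Ioo, mem_Iio, true_iff]
  rcases lt_trichotomy x u with h | h | h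
  · rcases lt_trichotomy x (-u) with h' | h' | h' <;> simp [h, h']
  · simp [h]
  · simp [h]

end Profile

/-- Hypersurfaces with a throat in region II. -/
lemma isSSCMC_of_simple_zero {M H c a b : ℝ} (hM : 0 < M) (hc : c < -8 * M ^ 3 * H)
    (ha : a ∈ Ioo 0 (2 * M)) (hka : k M H a = c)
    (hcrit : 0 < 2 * a - 3 * M - 3 * H * Real.sqrt (a ^ 3 * (2 * M - a)))
    (hk : ∀ r ∈ Ioo a (2 * M), c < k M H r) (hb0 : 0 ≤ b) (hba : b < a)
    (hlow : ∀ r ∈ Ioo b a, k M H r < c) {r₁ : ℝ} (hr₁ : 2 * M < r₁) (t : ℝ) :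
    IsSSCMC M H (Sigma₁ M H c r₁ t) ∧ domain₂ M H c a = Ico a (2 * M) ∧
      ∃ t₂ : ℝ, ∃ q ∈ Lplus, ∃ S₂ : Set (ℝ × ℝ),
        S₂ = Sigma₂star M H c a t₂ ∪ Sigma₂starstar M H c a t₂ ∧ IsSSCMC M H S₂ ∧
        ∀ r₃ : ℝ, 2 * M < r₃ → ∃ t₃ : ℝ, ∃ q' ∈ Lminus, ∃ Γ : Set (ℝ × ℝ),
          Γ = Sigma₁ M H c r₁ t ∪ {q} ∪ S₂ ∪ {q'} ∪ Sigma₃ M H c r₃ t₃ ∧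
          IsSSCMC M H (Sigma₃ M H c r₃ t₃) ∧ IsSSCMC M H Γ ∧
          IsCompleteInExtension M Γ ∧ IsRiemannianComplete M Γ ∧
          HasEnds 2 (sphericalLift M Γ) := by
  have ha0 := ha.1
  have ha1 : a < r₁ := ha.2.trans hr₁
  have hQ : ∀ r, a ≤ r → 0 < quot M H c a r / r ^ 4 := fun r hr =>
    quot_pos hM hc ha hka hcrit hk hr
  obtain ⟨p, hρ, hw, hl, ht⟩ := exists_profile_sinh (Q := fun r => quot M H c a r / r ^ 4) hM ha0
    (fun r hr => energy_eq_quot ha hka hr) hQ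
    (fun r hr => by
      have hr0 : r ^ 4 ≠ 0 := pow_ne_zero 4 (ha0.trans_le hr).ne'
      unfold quot
      fun_prop (disch := assumption))
    (v₀ := Real.arsinh (Real.sqrt (r₁ - a)))
    (by rw [Real.sinh_arsinh, Real.sq_sqrt (by linarith)]; linarith) t
  have hle : ∀ v, a ≤ a + Real.sinh v ^ 2 := fun v => le_add_of_nonneg_right (sq_nonneg _)
  have hwpos : ∀ v, 0 < v → 0 < p.w v := fun v hv => by
    rw [hw]; exact mul_pos (Real.sinh_pos_iff.2 hv) (Real.sqrt_pos.2 (hQ _ (hle v)))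
  have hwneg : ∀ v, v < 0 → p.w v < 0 := fun v hv => by
    rw [hw]; exact mul_neg_of_neg_of_pos (Real.sinh_neg_iff.2 hv) (Real.sqrt_pos.2 (hQ _ (hle v)))
  set u := Real.arsinh (Real.sqrt (2 * M - a)) with hu
  have hρu : p.ρ u = 2 * M := p.ρ_arsinh hρ ha.2.le
  have hu0 : 0 < u := Real.arsinh_pos_iff.2 (Real.sqrt_pos.2 (sub_pos.2 ha.2))
  have hρ0 : p.ρ 0 = a := by simp [hρ]
  have hρle : ∀ v, a ≤ p.ρ v := fun v => by rw [hρ]; exact hle v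
  have hIoi : p.ρ '' Ioi u = Ioi (2 * M) := by rw [p.image_Ioi_sinh hρ hu0.le, hρu]
  have hIio : p.ρ '' Iio (-u) = Ioi (2 * M) := by
    rw [← hIoi, ← p.image_neg_sinh hρ (Ioi u), image_neg_eq_neg, neg_Ioi]
  have hIco : p.ρ '' Ico 0 u = Ico a (2 * M) := by rw [p.image_Ico_sinh hρ hu0.le, hρu]
  have hIoc : p.ρ '' Ioc (-u) 0 = Ico a (2 * M) := by
    rw [← hIco, ← p.image_neg_sinh hρ (Ico 0 u), image_neg_eq_neg, neg_Ico, neg_zero]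
  have hrate : ∀ r ∈ Ico a (2 * M), rate H c r < 0 := by
    intro r hr
    rcases hr.1.eq_or_lt with rfl | h1
    · exact rate_neg_of_k_eq ha hka
    · exact ((lt_k_iff ⟨ha0.trans h1, hr.2⟩).1 (hk r ⟨h1, hr.2⟩)).1
  have hrIco : ∀ v ∈ Ico 0 u, p.ρ v < 2 * M ∧ rate H c (p.ρ v) < 0 := fun v hv => by
    have : p.ρ v ∈ Ico a (2 * M) := hIco ▸ mem_image_of_mem _ hv
    exact ⟨this.2, hrate _ this⟩
  have hrIoc : ∀ v ∈ Ioc (-u) 0, p.ρ v < 2 * M ∧ rate H c (p.ρ v) < 0 := fun v hv => by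
    have : p.ρ v ∈ Ico a (2 * M) := hIoc ▸ mem_image_of_mem _ hv
    exact ⟨this.2, hrate _ this⟩
  have hdom : domain₂ M H c a = Ico a (2 * M) := by
    refine Subset.antisymm (fun r hr => ⟨?_, hr.1.2⟩) fun r hr => ⟨⟨ha0.trans_le hr.1, hr.2⟩, ?_, ?_⟩
    · obtain ⟨h4, h5, -⟩ := hr
      by_contra hcon
      have hra := not_le.1 hcon
      -- On (b, a) the condition l₂ > 1 fails, so the domain cannot continue below the throat.
      obtain ⟨x, hx1, hx2⟩ := exists_between (max_lt hba hra)
      have hx : x ∈ Ioo 0 (2 * M) :=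
        ⟨hb0.trans_lt ((le_max_left _ _).trans_lt hx1), hx2.trans ha.2⟩
      have h6 := h5 x ⟨(min_le_right _ _).trans_lt ((le_max_right _ _).trans_lt hx1),
        hx2.trans_le (le_max_left _ _)⟩
      rw [one_lt_l₂_iff_lt_k hx] at h6
      exact lt_asymm h6 (hlow x ⟨(le_max_left _ _).trans_lt hx1, hx2⟩)
    · intro x hx
      rw [min_eq_left hr.1, max_eq_right hr.1] at hx
      rw [one_lt_l₂_iff_lt_k ⟨ha0.trans hx.1, hx.2.trans hr.2⟩]
      exact hk x ⟨hx.1, hx.2.trans hr.2⟩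
    · rw [← hIco] at hr
      obtain ⟨v, hv, rfl⟩ := hr
      rw [← hρ0]
      refine (p.integral_slope₂_increasing hM (fun x hx => ?_) fun x hx => ?_).1
      · rw [uIcc_of_le hv.1] at hx
        exact hrIco x ⟨hx.1, hx.2.trans_lt hv.2⟩
      · rw [min_eq_left hv.1] at hx
        exact hwpos x hx.1
  have hs₁ := p.sigma₁_eq hM hIoi (fun v hv => hwpos v (hu0.trans hv))
    (v₀ := Real.arsinh (Real.sqrt (r₁ - a)))
    (Real.arsinh_lt_arsinh.2 (Real.sqrt_lt_sqrt (sub_nonneg.2 ha.2.le) (by linarith)))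
  rw [ht, p.ρ_arsinh hρ ha1.le] at hs₁
  have hs₂ := p.sigma₂star_eq hM (J := Ico 0 u) (v₀ := 0) ⟨le_rfl, hu0⟩
    (by rw [hIco, hρ0, hdom]) hrIco (fun v hv x hx => by
      rw [min_eq_left hv.1] at hx
      exact hwpos x hx.1)
  have hs₂' := p.sigma₂starstar_eq hM (J := Ioc (-u) 0) (v₀ := 0) ⟨by linarith, le_rfl⟩
    (by rw [hIoc, hρ0, hdom]) hrIoc (fun v hv x hx => by
      rw [max_eq_left hv.2] at hx
      exact hwneg x hx.2)
  rw [hρ0] at hs₂ hs₂'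
  -- Both height functions start at the throat v = 0 with the same constant; f₂* follows the half
  -- where r increases with v, f₂** the half where it decreases.
  have hS₂ : Sigma₂star M H c a (p.time 0) ∪ Sigma₂starstar M H c a (p.time 0) =
      p.curve '' Ioo (-u) u := by
    rw [hs₂, hs₂', ← image_union, union_comm, Ioc_union_Ico_eq_Ioo (by linarith) hu0]
  have hL : p.curve u ∈ Lplus := p.curve_mem_Lplus hM hρu
    (by rw [hρu]; exact rate_two_mul_neg hM hc) (hwpos u hu0)
  have hρu' : p.ρ (-u) = 2 * M := by rw [p.ρ_neg_sinh hρ, hρu]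
  have hL' : p.curve (-u) ∈ Lminus := p.curve_mem_Lminus hM hρu'
    (by rw [hρu']; exact rate_two_mul_neg hM hc) (hwneg _ (by linarith))
  -- a lower bound for the speed
  set C := 6 * H ^ 2 + 4 / a ^ 2 + 3 * |2 * H * c - 2 * M| / a ^ 3 with hC
  have hC0 : 0 < C := by positivity
  have hl0 : ∀ v, 2 / Real.sqrt (C * (a + 1)) ≤ p.l v := by
    intro v
    have hcosh := Real.cosh_pos v
    have hq := hQ _ (hle v)
    rw [hl]
    simp only
    rw [div_le_div_iff₀ (by positivity) (Real.sqrt_pos.2 hq), mul_assoc]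
    refine mul_le_mul_of_nonneg_left (Real.sqrt_le_iff.2 ⟨by positivity, ?_⟩) two_pos.le
    rw [mul_pow, Real.sq_sqrt (by positivity)]
    refine (quot_le ha0 (hle v)).trans ?_
    rw [← hC]
    have h1 : a + Real.sinh v ^ 2 ≤ Real.cosh v ^ 2 * (a + 1) := by
      rw [Real.cosh_sq]
      nlinarith [sq_nonneg (Real.sinh v)]
    calc C * (a + Real.sinh v ^ 2) ≤ C * (Real.cosh v ^ 2 * (a + 1)) :=
          mul_le_mul_of_nonneg_left h1 hC0.le
      _ = _ := by ring
  have hcomplete := p.isRiemannianComplete hM (by positivity : 0 < 2 / Real.sqrt (C * (a + 1))) hl0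
  have hclosed : IsClosed (sphericalLift M (range p.curve)) := by
    refine p.isClosed_sphericalLift hM fun x hx => ?_
    refine ⟨-(radius M x + 2), radius M x + 2, ?_⟩
    filter_upwards [(continuousAt_radius hM hx).eventually (gt_mem_nhds (lt_add_one _))]
      with y hy v hv
    rw [← hv, p.radius_curve hM, hρ] at hy
    simp only at hy
    rw [mem_Icc, ← abs_le]
    have h1 : |v| ≤ |Real.sinh v| := by
      rw [Real.abs_sinh]
      exact Real.self_le_sinh_iff.2 (abs_nonneg v)
    -- Uses |v| ≤ |sinh v| and 2|sinh v| ≤ sinh² v + 1.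
    nlinarith [sq_abs (Real.sinh v), sq_nonneg (|Real.sinh v| - 1)]
  refine ⟨hs₁ ▸ p.isSSCMC_image hM isOpen_Ioi, hdom, p.time 0, _, hL, _, rfl,
    hS₂ ▸ p.isSSCMC_image hM isOpen_Ioo, fun r₃ hr₃ => ?_⟩
  have ha3 : a < r₃ := ha.2.trans hr₃
  have hs₃ := p.sigma₃_eq hM hIio (fun v hv => hwneg v (by linarith))
    (v₀ := -Real.arsinh (Real.sqrt (r₃ - a)))
    (neg_lt_neg (Real.arsinh_lt_arsinh.2
      (Real.sqrt_lt_sqrt (sub_nonneg.2 ha.2.le) (by linarith))))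
  rw [p.ρ_neg_sinh hρ, p.ρ_arsinh hρ ha3.le] at hs₃
  refine ⟨_, _, hL', range p.curve, ?_, hs₃ ▸ p.isSSCMC_image hM isOpen_Iio,
    p.isSSCMC_range hM, ⟨hclosed, fun σ hσ => Or.inl (hcomplete σ hσ)⟩, hcomplete,
    p.hasEnds_two_range hM⟩
  rw [hs₁, hS₂, hs₃]
  exact p.range_curve_eq_of_two u

end Kruskal

/-! ### The three cases combined -/

theorem theorem1 (M : ℝ) (hM : 0 < M) (H : ℝ) :
    ∃ rH ∈ Ioo 0 (2 * M),
      (∀ r ∈ Ioo 0 (2 * M), r ≠ rH → k M H rH < k M H r) ∧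
      cMin M H = k M H rH ∧
      3 * H * Real.sqrt (rH ^ 3 * (2 * M - rH)) = 2 * rH - 3 * M ∧
      cMin M H < -8 * M ^ 3 * H ∧
      ∀ c₁ : ℝ, c₁ < -8 * M ^ 3 * H → ∀ r₁ : ℝ, 2 * M < r₁ → ∀ cbar₁ : ℝ,
        IsSSCMC M H (Sigma₁ M H c₁ r₁ cbar₁) ∧
        (c₁ < cMin M H →
          ∀ r₂ ∈ Ioo 0 (2 * M),
            domain₂ M H c₁ r₂ = Ioo 0 (2 * M) ∧
            ∃ cbar₂ : ℝ, ∃ p ∈ Lplus, ∃ Γ : Set (ℝ × ℝ),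
              Γ = Sigma₁ M H c₁ r₁ cbar₁ ∪ {p} ∪ Sigma₂star M H c₁ r₂ cbar₂ ∧
              IsSSCMC M H (Sigma₂star M H c₁ r₂ cbar₂) ∧
              IsSSCMC M H Γ ∧
              IsCompleteInExtension M Γ ∧
              HasEnds 2 (sphericalLift M Γ)) ∧
        (c₁ = cMin M H →
          ∀ r₂ ∈ Ioo rH (2 * M),
            domain₂ M H c₁ r₂ = Ioo rH (2 * M) ∧
            ∃ cbar₂ : ℝ, ∃ p ∈ Lplus, ∃ Γ : Set (ℝ × ℝ),
              Γ = Sigma₁ M H c₁ r₁ cbar₁ ∪ {p} ∪ Sigma₂star M H c₁ r₂ cbar₂ ∧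
              IsSSCMC M H (Sigma₂star M H c₁ r₂ cbar₂) ∧
              IsSSCMC M H Γ ∧
              IsCompleteInExtension M Γ ∧
              IsRiemannianComplete M Γ ∧
              HasEnds 2 (sphericalLift M Γ)) ∧
        (cMin M H < c₁ →
          ∃ r₂ ∈ Ioo rH (2 * M), k M H r₂ = c₁ ∧
            domain₂ M H c₁ r₂ = Ico r₂ (2 * M) ∧
            ∃ cbar₂ : ℝ, ∃ p ∈ Lplus, ∃ S₂ : Set (ℝ × ℝ),
              S₂ = Sigma₂star M H c₁ r₂ cbar₂ ∪ Sigma₂starstar M H c₁ r₂ cbar₂ ∧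
              IsSSCMC M H S₂ ∧
              ∀ r₃ : ℝ, 2 * M < r₃ → ∃ cbar₃ : ℝ, ∃ q ∈ Lminus, ∃ Γ : Set (ℝ × ℝ),
              Γ = Sigma₁ M H c₁ r₁ cbar₁ ∪ {p} ∪ S₂ ∪ {q} ∪ Sigma₃ M H c₁ r₃ cbar₃ ∧
              IsSSCMC M H (Sigma₃ M H c₁ r₃ cbar₃) ∧
              IsSSCMC M H Γ ∧
              IsCompleteInExtension M Γ ∧
              IsRiemannianComplete M Γ ∧
              HasEnds 2 (sphericalLift M Γ)) := by
  obtain ⟨rH, hrH, hcrit, hanti, hmono, hpos⟩ := exists_minimum_k hM H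
  have hlt_k : ∀ r ∈ Ioo 0 (2 * M), r ≠ rH → k M H rH < k M H r := by
    intro r hr hne
    rcases lt_or_gt_of_ne hne with h1 | h1
    · exact hanti ⟨hr.1.le, h1.le⟩ ⟨hrH.1.le, le_rfl⟩ h1
    · exact hmono ⟨le_rfl, hrH.2.le⟩ ⟨h1.le, hr.2.le⟩ h1
  have hmin : cMin M H = k M H rH := by
    refine IsLeast.csInf_eq ⟨⟨rH, hrH, rfl⟩, ?_⟩
    rintro _ ⟨r, hr, rfl⟩
    by_cases h1 : r = rH
    · rw [h1]
    · exact (hlt_k r hr h1).le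
  have h2M := hmono ⟨le_rfl, hrH.2.le⟩ ⟨hrH.2.le, le_rfl⟩ hrH.2
  refine ⟨rH, hrH, hlt_k, hmin, hcrit, by rw [hmin, ← k_two_mul]; exact h2M, ?_⟩
  intro c₁ hc₁ r₁ hr₁ cbar₁
  have hA : c₁ < cMin M H → _ := fun hc => isSSCMC_of_lt_k hM hc₁ (fun r hr => by
    by_cases h1 : r = rH
    · rw [h1, ← hmin]; exact hc
    · exact (hmin ▸ hc).trans (hlt_k r hr h1)) hr₁ cbar₁
  have hB : c₁ = cMin M H → _ := fun hc => isSSCMC_of_double_zero hM hc₁ hrH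
    (by rw [hc, hmin]) hcrit (fun r hr => by
      rw [hc, hmin]; exact hlt_k r ⟨hrH.1.trans hr.1, hr.2⟩ hr.1.ne') hr₁ cbar₁
  have hC : cMin M H < c₁ → ∃ r₂ ∈ Ioo rH (2 * M), k M H r₂ = c₁ ∧ _ := fun hc => by
    -- On [r_H, 2M] the function k rises from c_H to -8M³H. Its monotonicity gives k > c₁ to the
    -- right of r₂, and k < c₁ on (r_H, r₂), so r_H serves as the bound b.
    obtain ⟨r₂, hr₂, hk₂⟩ := intermediate_value_Ioo hrH.2.le (continuous_k M H).continuousOn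
      (show c₁ ∈ Ioo _ _ from ⟨hmin ▸ hc, by rw [k_two_mul]; exact hc₁⟩)
    have hm₂ : r₂ ∈ Icc rH (2 * M) := Ioo_subset_Icc_self hr₂
    exact ⟨r₂, hr₂, hk₂, isSSCMC_of_simple_zero hM hc₁ ⟨hrH.1.trans hr₂.1, hr₂.2⟩ hk₂
      (hpos r₂ hr₂)
      (fun r hr => hk₂ ▸ hmono hm₂ ⟨hm₂.1.trans hr.1.le, hr.2.le⟩ hr.1) hrH.1.le hr₂.1
      (fun r hr => hk₂ ▸ hmono ⟨hr.1.le, hr.2.le.trans hm₂.2⟩ hm₂ hr.2) hr₁ cbar₁⟩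
  refine ⟨?_, fun hc => (hA hc).2, fun hc => (hB hc).2, fun hc => ?_⟩
  · rcases lt_trichotomy c₁ (cMin M H) with h1 | h1 | h1
    · exact (hA h1).1
    · exact (hB h1).1
    · obtain ⟨r₂, -, -, h2, -⟩ := hC h1
      exact h2
  · obtain ⟨r₂, h1, h2, -, h3⟩ := hC hc
    exact ⟨r₂, h1, h2, h3⟩
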